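/- Let $ABC$ be a non-degenerate triangle in $\mathbb R^3$, placed as $A=(0,0,0)$, $B=(x_2,0,0)$, $C=(x_3,y_3,0)$ with $x_2,y_3>0$ (every triangle is congruent to one of this form). Its *danger cylinder* is the right circular cylinder over the circumcircle of $ABC$; write $g=0$ for its equation $g=x^2+y^2-x_2x+\frac{x_2x_3-x_3^2-y_3^2}{y_3}\,y$. For a camera centre $O\notin\{A,B,C\}$ the P3P system is $$e_1^2+e_2^2-2\cos(\angle AOB)\,e_1e_2=|AB|^2,\quad e_1^2+e_3^2-2\cos(\angle AOC)\,e_1e_3=|AC|^2,\quad e_2^2+e_3^2-2\cos(\angle BOC)\,e_2e_3=|BC|^2 .$$ A point $O'$ is *complementary* to $O$ if $(|O'A|,|O'B|,|O'C|)$ is a solution of the P3P system of $O$ with positive entries, different from $(|OA|,|OB|,|OC|)$. The *deltoidal surface* is the Zariski closure in $\mathbb R^3$ of the set of all points $O'$ complementary to some $O$ on the danger cylinder. Let $DEF$ be the first Morley triangle of $ABC$. The three *Morley generatrices* are the generatrices of the danger cylinder through the three points of the circumcircle that are reached from the circumcentre in the directions of the three altitudes of $DEF$, each directed from its foot to its vertex.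 Then the following hold. 1. If $O$ lies on the danger cylinder, every $O'$ complementary to $O$ lies on the deltoidal surface. This is an algebraic surface of degree $12$: the ideal of all polynomials in $\mathbb R[x,y,z]$ vanishing on it is generated by one polynomial $f$ of total degree $12$, and the surface is the zero set of $f$. 2. The deltoidal surface is tangent to the danger cylinder along the three Morley generatrices: at each of their points $\nabla f$ is a multiple of $\nabla g$; at all but finitely many of their points both gradients are non-zero, so that the tangent planes of the two surfaces exist and coincide. If $ABC$ is not obtuse, this is so at all points of the Morley generatrices that are not on the circumcircle. 3. The deltoidal surface and the danger cylinder both contain the three Morley generatrices and the circumcircle. If $ABC$ is not obtuse (for example, if its sides are $7,6,5$), their intersection is exactly the union of the three Morley generatrices and the circumcircle. -/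

import Mathlib

open MvPolynomial

noncomputable section

namespace P3P

/-- Euclidean three-space. -/
abbrev Space : Type := EuclideanSpace ℝ (Fin 3)

/-- The value of a polynomial in three variables at a point of space. -/
def evalAt (p : MvPolynomial (Fin 3) ℝ) (P : Space) : ℝ := eval (fun i => P i) p

/-- The gradient of a polynomial at a point of space. -/
def gradAt (p : MvPolynomial (Fin 3) ℝ) (P : Space) : Fin 3 → ℝ :=
  fun i => evalAt (pderiv i p) P

/-! ### The triangle `A = (0,0,0)`, `B = (x₂,0,0)`, `C = (x₃,y₃,0)`, its circumcircle and its
danger cylinder -/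

def vertexA : Space := !₂[0, 0, 0]

def vertexB (x₂ : ℝ) : Space := !₂[x₂, 0, 0]

def vertexC (x₃ y₃ : ℝ) : Space := !₂[x₃, y₃, 0]

/-- The centre of the circumcircle of the triangle `A B C`. -/
def circumcentre (x₂ x₃ y₃ : ℝ) : Space :=
  !₂[x₂ / 2, (x₃ ^ 2 + y₃ ^ 2 - x₂ * x₃) / (2 * y₃), 0]

/-- The equation of the circumcircle in the plane `z = 0`, read as a polynomial in `x, y, z`:
`x² + y² - x₂ x + ((x₂ x₃ - x₃² - y₃²) / y₃) y`. -/
def cylinderPoly (x₂ x₃ y₃ : ℝ) : MvPolynomial (Fin 3) ℝ :=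
  X 0 ^ 2 + X 1 ^ 2 - C x₂ * X 0 + C ((x₂ * x₃ - x₃ ^ 2 - y₃ ^ 2) / y₃) * X 1

/-- The danger cylinder: the right circular cylinder whose base is the circumcircle. -/
def dangerCylinder (x₂ x₃ y₃ : ℝ) : Set Space :=
  {P | evalAt (cylinderPoly x₂ x₃ y₃) P = 0}

/-- The circumcircle: the points of the danger cylinder in the plane of the triangle. -/
def circumcircle (x₂ x₃ y₃ : ℝ) : Set Space :=
  {P | P ∈ dangerCylinder x₂ x₃ y₃ ∧ P 2 = 0}

/-! ### P3P solutions and complementary camera centres -/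

/-- `(e₁, e₂, e₃)` are positive and solve the P3P system
`eᵢ² + eⱼ² - 2 cos θᵢⱼ eᵢ eⱼ = sᵢⱼ²` (`1 ≤ i < j ≤ 3`) of the triangle `A B C`, where the `θᵢⱼ` are
the angles under which the sides are seen from the camera centre `O`. -/
structure IsSolution (A B C O : Space) (e₁ e₂ e₃ : ℝ) : Prop where
  pos₁ : 0 < e₁
  pos₂ : 0 < e₂
  pos₃ : 0 < e₃
  eq₁₂ : e₁ ^ 2 + e₂ ^ 2 - 2 * Real.cos (EuclideanGeometry.angle A O B) * e₁ * e₂ = dist A B ^ 2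
  eq₁₃ : e₁ ^ 2 + e₃ ^ 2 - 2 * Real.cos (EuclideanGeometry.angle A O C) * e₁ * e₃ = dist A C ^ 2
  eq₂₃ : e₂ ^ 2 + e₃ ^ 2 - 2 * Real.cos (EuclideanGeometry.angle B O C) * e₂ * e₃ = dist B C ^ 2

/-- `O'` is complementary to the camera centre `O` (which is not a vertex, so that the angles at
`O` make sense): the distances of `O'` from the vertices solve the P3P system of `O`, and they are
not the solution given by `O` itself. -/
structure IsComplementary (A B C O O' : Space) : Prop where
  ne_A : O ≠ A
  ne_B : O ≠ B
  ne_C : O ≠ C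
  solution : IsSolution A B C O (dist O' A) (dist O' B) (dist O' C)
  other : ¬ (dist O' A = dist O A ∧ dist O' B = dist O B ∧ dist O' C = dist O C)

/-! ### The deltoidal surface -/

/-- All camera centres complementary to a camera centre on the danger cylinder. -/
def complementarySet (x₂ x₃ y₃ : ℝ) : Set Space :=
  {O' | ∃ O ∈ dangerCylinder x₂ x₃ y₃,
    IsComplementary vertexA (vertexB x₂) (vertexC x₃ y₃) O O'}

/-- The ideal of all polynomials in `x, y, z` that vanish on the complementary camera centres. -/
def deltoidalIdeal (x₂ x₃ y₃ : ℝ) : Ideal (MvPolynomial (Fin 3) ℝ) :=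
  vanishingIdeal ℝ ((fun P : Space => fun i => P i) '' complementarySet x₂ x₃ y₃)

/-- The deltoidal surface: the Zariski closure of the set of the complementary camera centres. -/
def deltoidalSurface (x₂ x₃ y₃ : ℝ) : Set Space :=
  {P | ∀ p ∈ deltoidalIdeal x₂ x₃ y₃, evalAt p P = 0}

/-! ### The Morley triangle and the Morley generatrices -/

/-- `P` is the intersection, inside the triangle `A B C`, of the trisectors of the angles at `A`
and at `B` that are adjacent to the side `A B`. -/
structure IsMorleyVertex (A B C P : Space) : Prop where
  mem : P ∈ convexHull ℝ {A, B, C}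
  angle_left : EuclideanGeometry.angle P A B = EuclideanGeometry.angle C A B / 3
  angle_right : EuclideanGeometry.angle P B A = EuclideanGeometry.angle C B A / 3

/-- `D E F` is the first Morley triangle of `A B C`; its vertices `D`, `E`, `F` are adjacent to the
sides `A B`, `B C`, `C A`. -/
structure IsMorleyTriangle (A B C D E F : Space) : Prop where
  adjacent_AB : IsMorleyVertex A B C D
  adjacent_BC : IsMorleyVertex B C A E
  adjacent_CA : IsMorleyVertex C A B F

/-- The generatrix of the danger cylinder that belongs to the altitude of the Morley triangle
`D E F` from `D`: it passes through the point of the circumcircle that is reached from the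
circumcentre in the direction of this altitude, from its foot on the line `E F` to the
vertex `D`. (The Morley triangle lies in the plane `z = 0`, so the third coordinate of `P` does not
enter the two conditions on inner products.) -/
def morleyGeneratrix (x₂ x₃ y₃ : ℝ) (D E F : Space) : Set Space :=
  {P | P ∈ dangerCylinder x₂ x₃ y₃ ∧
    inner ℝ (P - circumcentre x₂ x₃ y₃) (F - E) = 0 ∧
    0 < inner ℝ (P - circumcentre x₂ x₃ y₃) (D - E)}

/-- The union of the three Morley generatrices. -/
def morleyGeneratrices (x₂ x₃ y₃ : ℝ) (D E F : Space) : Set Space :=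
  morleyGeneratrix x₂ x₃ y₃ D E F ∪ morleyGeneratrix x₂ x₃ y₃ E F D ∪
    morleyGeneratrix x₂ x₃ y₃ F D E

/-! ### Tangency and obtuse triangles -/

/-- The surfaces `f = 0` and `g = 0` are tangent at `P`: both pass through `P` with non-zero
gradient, and they have the same tangent plane at `P`. -/
structure TangentAt (f g : MvPolynomial (Fin 3) ℝ) (P : Space) : Prop where
  left_mem : evalAt f P = 0
  right_mem : evalAt g P = 0
  left_regular : gradAt f P ≠ 0
  right_regular : gradAt g P ≠ 0
  parallel : ∃ c : ℝ, gradAt f P = c • gradAt g P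

/-- No angle of the triangle `A B C` is obtuse. -/
structure IsNonObtuse (A B C : Space) : Prop where
  angle_A : EuclideanGeometry.angle B A C ≤ Real.pi / 2
  angle_B : EuclideanGeometry.angle A B C ≤ Real.pi / 2
  angle_C : EuclideanGeometry.angle A C B ≤ Real.pi / 2

end P3P

end

/-! Let a, b, c be the vectors from a point O' to the vertices. A camera centre with the same
viewing angles corresponds to positive scalars (u, v, w) for which ua, vb, wc span a triangle
congruent to ABC; O' itself gives (1, 1, 1). Let Q(u, v, w) be the triple of squared side lengths
and κ = Q(1, 1, 1). The Jacobian determinant of Q is `gramDet` up to a constant, and at a camera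
centre it is a multiple of the equation of the danger cylinder (`gram_jacobian`). Hence O lies on
the cylinder exactly when its triple (u, v, w) is a degenerate solution of Q = κ.

Projecting from (1, 1, 1) by s = v - u, t = w - u, write Q(u, u + s, u + t) = u² κ + 2u β + θ with β
linear and θ quadratic in (s, t). Proportionality of this vector to κ forces det(κ, β, θ) = 0, a
binary cubic in (s, t) whose coefficients are polynomials in x, y and Z = z². At a solution its
gradient is `gramDet` times a vector that vanishes only if s = t = 0 (`gram_deriv_s`,
`gram_deriv_t`), so a degenerate second solution is a double root. The surface is therefore the zero
set of the discriminant `delt`, of degree 4 · 3 = 12.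

That `delt` generates the whole ideal needs two things. First, it is irreducible in ℝ[x, y][Z]: the
coefficient of Z⁴ is an irreducible quartic (`irreducible_deltLead`), and a factor with constant
leading coefficient is excluded by degrees along the three altitudes (`isUnit_of_mul_eq_deltPoly`).
Second, there are enough real complementary points: high zeros of `delt` off the cylinder are
complementary (`mem_complementarySet_of_high`), and the intermediate value theorem yields such zeros
over infinitely many lines (`exists_infinite_complementary`). A resultant turns a polynomial that
vanishes at these points, but is not divisible by `delt`, into a nonzero polynomial in Z and y with
too many zeros. The even and odd parts in z are treated separately.

On the cylinder the trivial solution is itself degenerate, so the cubic splits into a linear and a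
quadratic form, and `delt` becomes a nonzero constant times z⁴ cos²(σ) times a quadratic in z²
(`delt_circle`), where σ is the sum of the three half angles under which the vertices are seen from
the circumcentre. The factor z⁴ gives the circumcircle. The square of the cosine gives tangency
along the lines cos σ = 0, provided that the radial derivative is nonzero
(`exists_hasDerivAt_delt_radial`). The last factor is positive off the plane z = 0 for non-obtuse
triangles, since there the squared distances of a point of the circumcircle from the vertices add up
to at least the squared diameter.

Finally, the law of sines and the tripling formula give the sides of the Morley triangle with their
directions (`IsMorleyTriangle.exists_isPolar`), and its three altitude directions are exactly those
with cos σ = 0 (`mem_morleyGeneratrices_iff`). -/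

noncomputable section

namespace P3P

/-! ### Binary cubics -/

section Cubic

variable {R : Type*} [CommRing R]

/-- The discriminant of the binary cubic `a s³ + b s² t + c s t² + d t³`. -/
def cubicDisc (a b c d : R) : R :=
  b ^ 2 * c ^ 2 - 4 * a * c ^ 3 - 4 * b ^ 3 * d - 27 * a ^ 2 * d ^ 2 + 18 * a * b * c * d

lemma map_cubicDisc {S F : Type*} [CommRing S] [FunLike F R S] [RingHomClass F R S] (φ : F)
    (a b c d : R) : φ (cubicDisc a b c d) = cubicDisc (φ a) (φ b) (φ c) (φ d) := by
  simp [cubicDisc, map_ofNat]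

end Cubic

/-- A binary cubic with a double root has discriminant zero. -/
lemma cubicDisc_eq_zero_of_double_root {a b c d s t : ℝ} (hst : s ≠ 0 ∨ t ≠ 0)
    (h1 : 3 * a * s ^ 2 + 2 * b * s * t + c * t ^ 2 = 0)
    (h2 : b * s ^ 2 + 2 * c * s * t + 3 * d * t ^ 2 = 0) : cubicDisc a b c d = 0 := by
  by_cases ht : t = 0
  · subst ht
    have hs : s ≠ 0 := by tauto
    have ha : a = 0 := by
      have : a * s ^ 2 = 0 := by linear_combination h1 / 3
      simpa [hs] using this
    have hb : b = 0 := by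
      have : b * s ^ 2 = 0 := by linear_combination h2
      simpa [hs] using this
    simp [cubicDisc, ha, hb]
  · obtain ⟨x, rfl⟩ : ∃ x, s = x * t := ⟨s / t, by field_simp⟩
    have hc : c = -(3 * a * x ^ 2 + 2 * b * x) := by
      have : (c + (3 * a * x ^ 2 + 2 * b * x)) * t ^ 2 = 0 := by linear_combination h1
      have := (mul_eq_zero.1 this).resolve_right (by positivity)
      linarith
    have hd : d = -(b * x ^ 2 + 2 * c * x) / 3 := by
      have : (3 * d + (b * x ^ 2 + 2 * c * x)) * t ^ 2 = 0 := by linear_combination h2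
      have := (mul_eq_zero.1 this).resolve_right (by positivity)
      linarith
    rw [hd, hc, cubicDisc]
    ring

/-- A real binary cubic with discriminant zero has a real double root. -/
lemma exists_double_root_of_cubicDisc_eq_zero {a b c d : ℝ} (h : cubicDisc a b c d = 0) :
    ∃ s t : ℝ, (s ≠ 0 ∨ t ≠ 0) ∧ 3 * a * s ^ 2 + 2 * b * s * t + c * t ^ 2 = 0 ∧
      b * s ^ 2 + 2 * c * s * t + 3 * d * t ^ 2 = 0 := by
  -- The Hessian of the cubic has the coefficients b² - 3ac, bc - 9ad, c² - 3bd and discriminant -3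
  -- times that of the cubic. If it is nonzero, its double root is the double root of the cubic; if
  -- it vanishes, the cubic is a multiple of a cube.
  unfold cubicDisc at h
  by_cases h1 : b ^ 2 - 3 * a * c = 0
  · by_cases h2 : c ^ 2 - 3 * b * d = 0
    · have h3 : b * c - 9 * a * d = 0 := by
        have : (b * c - 9 * a * d) ^ 2 = 0 := by
          linear_combination (-3) * h + 4 * (c ^ 2 - 3 * b * d) * h1
        simpa using this
      by_cases ha : a = 0
      · have hb : b = 0 := by
          have : b ^ 2 = 0 := by rw [ha] at h1; linear_combination h1
          simpa using this
        have hc : c = 0 := by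
          have : c ^ 2 = 0 := by rw [hb] at h2; linear_combination h2
          simpa using this
        exact ⟨1, 0, by simp, by rw [ha, hb, hc]; ring, by rw [hb, hc]; ring⟩
      · refine ⟨-b, 3 * a, Or.inr (by simpa using ha), ?_, ?_⟩
        · linear_combination (-3 * a) * h1
        · linear_combination b * h1 - 3 * a * h3
    · refine ⟨2 * (c ^ 2 - 3 * b * d), 9 * a * d - b * c, Or.inl (by simpa using h2), ?_, ?_⟩
      · linear_combination (-3 * c) * h
      · linear_combination (-9 * d) * h
  · refine ⟨9 * a * d - b * c, 2 * (b ^ 2 - 3 * a * c), Or.inr (by simpa using h1), ?_, ?_⟩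
    · linear_combination (-9 * a) * h
    · linear_combination (-3 * b) * h

/-! ### The cubic of a camera centre -/

section Coefficients

variable {R : Type*} [CommRing R]

/-- The coefficient of `s³` in the cubic of the point `(x, y, z)`, `Z = z²`, for the triangle
`(0,0)`, `(b,0)`, `(c,h)`. -/
def coeffS3 (b c h x y Z : R) : R :=
  -(c ^ 2 + h ^ 2) * (x ^ 2 + y ^ 2 + Z - 2 * b * x + b ^ 2) *
    (b * (b - x) - ((b - x) * (b - c) + y * h))

/-- The coefficient of `s² t`. -/
def coeffS2T (b c h x y Z : R) : R :=
  b ^ 2 * (c * (c - x) + h * (h - y)) * (x ^ 2 + y ^ 2 + Z - 2 * b * x + b ^ 2) +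
  (c ^ 2 + h ^ 2) * (2 * (b * (b - x)) * (x ^ 2 + y ^ 2 + Z - (b + c) * x - h * y + b * c) +
    (x ^ 2 + y ^ 2 + Z - 2 * b * x + b ^ 2) * ((c - x) * (c - b) + (h - y) * h)) -
  ((b - c) ^ 2 + h ^ 2) * (x ^ 2 + y ^ 2 + Z - 2 * b * x + b ^ 2) * (c * (c - x) + h * (h - y))

/-- The coefficient of `s t²`. -/
def coeffST2 (b c h x y Z : R) : R :=
  b ^ 2 * (-2 * (c * (c - x) + h * (h - y)) *
      (x ^ 2 + y ^ 2 + Z - (b + c) * x - h * y + b * c) -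
    (x ^ 2 + y ^ 2 + Z - 2 * c * x - 2 * h * y + c ^ 2 + h ^ 2) *
      ((b - x) * (b - c) + y * h)) -
  (c ^ 2 + h ^ 2) * (b * (b - x)) *
    (x ^ 2 + y ^ 2 + Z - 2 * c * x - 2 * h * y + c ^ 2 + h ^ 2) +
  ((b - c) ^ 2 + h ^ 2) * (b * (b - x)) *
    (x ^ 2 + y ^ 2 + Z - 2 * c * x - 2 * h * y + c ^ 2 + h ^ 2)

/-- The coefficient of `t³`. -/
def coeffT3 (b c h x y Z : R) : R :=
  b ^ 2 * (x ^ 2 + y ^ 2 + Z - 2 * c * x - 2 * h * y + c ^ 2 + h ^ 2) *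
    ((c * (c - x) + h * (h - y)) - ((c - x) * (c - b) + (h - y) * h))

/-- The equation of the deltoidal surface in terms of `x`, `y` and `Z = z²`: the discriminant of
the cubic. -/
def delt (b c h x y Z : R) : R :=
  cubicDisc (coeffS3 b c h x y Z) (coeffS2T b c h x y Z) (coeffST2 b c h x y Z)
    (coeffT3 b c h x y Z)

variable {S F : Type*} [CommRing S] [FunLike F R S] [RingHomClass F R S] (φ : F)

lemma map_coeffS3 (b c h x y Z : R) :
    φ (coeffS3 b c h x y Z) = coeffS3 (φ b) (φ c) (φ h) (φ x) (φ y) (φ Z) := by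
  simp [coeffS3, map_ofNat]

lemma map_coeffS2T (b c h x y Z : R) :
    φ (coeffS2T b c h x y Z) = coeffS2T (φ b) (φ c) (φ h) (φ x) (φ y) (φ Z) := by
  simp [coeffS2T, map_ofNat]

lemma map_coeffST2 (b c h x y Z : R) :
    φ (coeffST2 b c h x y Z) = coeffST2 (φ b) (φ c) (φ h) (φ x) (φ y) (φ Z) := by
  simp [coeffST2, map_ofNat]

lemma map_coeffT3 (b c h x y Z : R) :
    φ (coeffT3 b c h x y Z) = coeffT3 (φ b) (φ c) (φ h) (φ x) (φ y) (φ Z) := by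
  simp [coeffT3, map_ofNat]

lemma map_delt (b c h x y Z : R) :
    φ (delt b c h x y Z) = delt (φ b) (φ c) (φ h) (φ x) (φ y) (φ Z) := by
  simp [delt, map_cubicDisc, map_coeffS3, map_coeffS2T, map_coeffST2, map_coeffT3]

/-- The equation of the circumcircle, cleared of denominators. -/
def circ (b c h x y : R) : R := (x ^ 2 + y ^ 2 - b * x) * h + (b * c - c ^ 2 - h ^ 2) * y

end Coefficients

/-! ### Gram matrices -/

section Gram

variable (p q r l m n : ℝ)

/-- The cubic of a camera centre in terms of the Gram matrix of the three vectors to the vertices: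
`p, q, r` are the squared norms, `l, m, n` the inner products of the vectors to `A, B`, to `A, C`
and to `B, C`. -/
def gramS3 : ℝ := -(p + r - 2 * m) * q * ((q - l) - (q - n))

def gramS2T : ℝ := (p + q - 2 * l) * (r - m) * q +
  (p + r - 2 * m) * (2 * (q - l) * n + q * (r - n)) - (q + r - 2 * n) * q * (r - m)

def gramST2 : ℝ := (p + q - 2 * l) * (-2 * (r - m) * n - r * (q - n)) -
  (p + r - 2 * m) * (q - l) * r + (q + r - 2 * n) * (q - l) * r

def gramT3 : ℝ := (p + q - 2 * l) * r * ((r - m) - (r - n))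

/-- The determinant of the bilinear forms of the three conics at `(u, v, w)`. -/
def gramDet (u v w : ℝ) : ℝ :=
  -((u * p - v * l) * (w * r - u * m) * (v * q - w * n) +
    (v * q - u * l) * (u * p - w * m) * (w * r - v * n))

variable {p q r l m n}

/-- Together with `gram_deriv_t` this says that the gradient of the cubic at (v - u, w - u) is 2
`gramDet` · (w - u, -(v - u)). Hence a solution other than a multiple of (1, 1, 1) is a double root
of the cubic if and only if the Jacobian determinant vanishes there. -/
lemma gram_deriv_s (u v w : ℝ)
    (h1 : u ^ 2 * p + v ^ 2 * q - 2 * u * v * l = p + q - 2 * l)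
    (h2 : u ^ 2 * p + w ^ 2 * r - 2 * u * w * m = p + r - 2 * m)
    (h3 : v ^ 2 * q + w ^ 2 * r - 2 * v * w * n = q + r - 2 * n) :
    3 * gramS3 p q r l m n * (v - u) ^ 2 + 2 * gramS2T p q r l m n * (v - u) * (w - u) +
      gramST2 p q r l m n * (w - u) ^ 2 = 2 * gramDet p q r l m n u v w * (w - u) := by
  simp only [gramS3, gramS2T, gramST2, gramDet]
  linear_combination ((p + r - 2 * m) * (q - n) -
      2 * ((u * (p - m) + w * (r - m)) * (v * q - w * n))) * h1 +
    ((q + r - 2 * n) * (q - l) - (p + q - 2 * l) * (q - n) -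
      2 * ((v * (q - n) + w * (r - n)) * (v * q - u * l) - (u * (p - l) + v * (q - l)) * (v * q - w * n))) * h2 +
    (-(p + r - 2 * m) * (q - l) -
      2 * (-(u * (p - m) + w * (r - m)) * (v * q - u * l))) * h3

lemma gram_deriv_t (u v w : ℝ)
    (h1 : u ^ 2 * p + v ^ 2 * q - 2 * u * v * l = p + q - 2 * l)
    (h2 : u ^ 2 * p + w ^ 2 * r - 2 * u * w * m = p + r - 2 * m)
    (h3 : v ^ 2 * q + w ^ 2 * r - 2 * v * w * n = q + r - 2 * n) :
    gramS2T p q r l m n * (v - u) ^ 2 + 2 * gramST2 p q r l m n * (v - u) * (w - u) +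
      3 * gramT3 p q r l m n * (w - u) ^ 2 = -2 * gramDet p q r l m n u v w * (v - u) := by
  simp only [gramS2T, gramST2, gramT3, gramDet]
  linear_combination ((p + r - 2 * m) * (r - n) - (q + r - 2 * n) * (r - m) -
      2 * ((u * (p - m) + w * (r - m)) * (w * r - v * n) - (v * (q - n) + w * (r - n)) * (w * r - u * m))) * h1 +
    (-(p + q - 2 * l) * (r - n) -
      2 * (-(u * (p - l) + v * (q - l)) * (w * r - v * n))) * h2 +
    ((p + q - 2 * l) * (r - m) -
      2 * ((u * (p - l) + v * (q - l)) * (w * r - u * m))) * h3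

end Gram

/-! ### Complementary camera centres satisfy the equation -/

section Coordinates

variable (b c h x y z : ℝ)

/-- The Gram entries of the vectors from the point `(x, y, z)` to the vertices. -/
def gAA : ℝ := x ^ 2 + y ^ 2 + z ^ 2
def gBB : ℝ := (b - x) ^ 2 + y ^ 2 + z ^ 2
def gCC : ℝ := (c - x) ^ 2 + (h - y) ^ 2 + z ^ 2
def gAB : ℝ := -x * (b - x) + y ^ 2 + z ^ 2
def gAC : ℝ := -x * (c - x) - y * (h - y) + z ^ 2
def gBC : ℝ := (b - x) * (c - x) - y * (h - y) + z ^ 2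

/-- The determinant of the Jacobian matrix of the system is a multiple of the equation of the
danger cylinder. -/
lemma gram_jacobian :
    -((gAA x y z - gAB b x y z) * (gCC c h x y z - gAC c h x y z) *
        (gBB b x y z - gBC b c h x y z) +
      (gBB b x y z - gAB b x y z) * (gAA x y z - gAC c h x y z) *
        (gCC c h x y z - gBC b c h x y z)) = b ^ 2 * h * circ b c h x y := by
  simp only [gAA, gBB, gCC, gAB, gAC, gBC, circ]; ring

lemma coeffS3_eq_gram : coeffS3 b c h x y (z ^ 2) = gramS3 (gAA x y z) (gBB b x y z)
    (gCC c h x y z) (gAB b x y z) (gAC c h x y z) (gBC b c h x y z) := by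
  simp only [gAA, gBB, gCC, gAB, gAC, gBC, gramS3, coeffS3]; ring

lemma coeffS2T_eq_gram : coeffS2T b c h x y (z ^ 2) = gramS2T (gAA x y z) (gBB b x y z)
    (gCC c h x y z) (gAB b x y z) (gAC c h x y z) (gBC b c h x y z) := by
  simp only [gAA, gBB, gCC, gAB, gAC, gBC, gramS2T, coeffS2T]; ring

lemma coeffST2_eq_gram : coeffST2 b c h x y (z ^ 2) = gramST2 (gAA x y z) (gBB b x y z)
    (gCC c h x y z) (gAB b x y z) (gAC c h x y z) (gBC b c h x y z) := by
  simp only [gAA, gBB, gCC, gAB, gAC, gBC, gramST2, coeffST2]; ring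

lemma coeffT3_eq_gram : coeffT3 b c h x y (z ^ 2) = gramT3 (gAA x y z) (gBB b x y z)
    (gCC c h x y z) (gAB b x y z) (gAC c h x y z) (gBC b c h x y z) := by
  simp only [gAA, gBB, gCC, gAB, gAC, gBC, gramT3, coeffT3]; ring

end Coordinates

section Distances

variable (b c h : ℝ) (P : Space)

lemma dist_vertexA_sq : dist P vertexA ^ 2 = gAA (P 0) (P 1) (P 2) := by
  rw [EuclideanSpace.dist_eq, Real.sq_sqrt (Finset.sum_nonneg fun _ _ => sq_nonneg _),
    Fin.sum_univ_three]
  simp [vertexA, gAA]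

lemma dist_vertexB_sq : dist P (vertexB b) ^ 2 = gBB b (P 0) (P 1) (P 2) := by
  rw [EuclideanSpace.dist_eq, Real.sq_sqrt (Finset.sum_nonneg fun _ _ => sq_nonneg _),
    Fin.sum_univ_three]
  simp [vertexB, Real.dist_eq, gBB]
  ring

lemma dist_vertexC_sq : dist P (vertexC c h) ^ 2 = gCC c h (P 0) (P 1) (P 2) := by
  rw [EuclideanSpace.dist_eq, Real.sq_sqrt (Finset.sum_nonneg fun _ _ => sq_nonneg _),
    Fin.sum_univ_three]
  simp [vertexC, Real.dist_eq, gCC]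
  ring

lemma dist_AB_sq : dist vertexA (vertexB b) ^ 2 = b ^ 2 := by
  rw [dist_vertexB_sq]; simp [vertexA, gBB]

lemma dist_AC_sq : dist vertexA (vertexC c h) ^ 2 = c ^ 2 + h ^ 2 := by
  rw [dist_vertexC_sq]; simp [vertexA, gCC]

lemma dist_BC_sq : dist (vertexB b) (vertexC c h) ^ 2 = (b - c) ^ 2 + h ^ 2 := by
  rw [dist_vertexC_sq]; simp [vertexB, gCC]; ring

lemma mem_dangerCylinder_iff {h : ℝ} (hh : 0 < h) :
    P ∈ dangerCylinder b c h ↔ circ b c h (P 0) (P 1) = 0 := by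
  have e : circ b c h (P 0) (P 1) = h * evalAt (cylinderPoly b c h) P := by
    simp only [evalAt, cylinderPoly, circ, map_add, map_sub, map_mul, map_pow, eval_X, eval_C]
    field_simp
  rw [e, mul_eq_zero, or_iff_right hh.ne']
  rfl

end Distances

/-- The law of cosines. -/
lemma two_mul_cos_angle_mul_dist (X O Y : Space) :
    2 * Real.cos (EuclideanGeometry.angle X O Y) * dist O X * dist O Y =
      dist O X ^ 2 + dist O Y ^ 2 - dist X Y ^ 2 := by
  have := EuclideanGeometry.law_cos X O Y
  rw [dist_comm O X, dist_comm O Y]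
  linarith

/-- Solutions of the P3P system in terms of the Gram matrices: the inner products at `O` are the
rescaled inner products at `O'`. -/
lemma solution_eq_iff {k e₁ e₂ d₁ d₂ s l l' : ℝ} (h1 : 0 < d₁) (h2 : 0 < d₂)
    (hk : 2 * k * d₁ * d₂ = d₁ ^ 2 + d₂ ^ 2 - s) (hl : 2 * l = e₁ ^ 2 + e₂ ^ 2 - s)
    (hl' : 2 * l' = d₁ ^ 2 + d₂ ^ 2 - s) :
    e₁ ^ 2 + e₂ ^ 2 - 2 * k * e₁ * e₂ = s ↔ l * (d₁ * d₂) = l' * (e₁ * e₂) := by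
  have h12 : d₁ * d₂ ≠ 0 := by positivity
  have e : (e₁ ^ 2 + e₂ ^ 2 - 2 * k * e₁ * e₂ - s) * (d₁ * d₂) =
      2 * (l * (d₁ * d₂) - l' * (e₁ * e₂)) := by
    linear_combination (-(d₁ * d₂)) * hl + e₁ * e₂ * hl' - e₁ * e₂ * hk
  constructor
  · intro h
    have : (e₁ ^ 2 + e₂ ^ 2 - 2 * k * e₁ * e₂ - s) = 0 := by linarith
    rw [this] at e; linarith
  · intro h
    rw [h, sub_self, mul_zero] at e
    linarith [(mul_eq_zero.1 e).resolve_right h12]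

/-- The cubic is taken at O', and O provides the degenerate second solution (u, v, w), which is a
double root. -/
lemma delt_eq_zero_of_isComplementary {b c h : ℝ} (hb : 0 < b) (hh : 0 < h) {O O' : Space}
    (hO : O ∈ dangerCylinder b c h)
    (hc : IsComplementary vertexA (vertexB b) (vertexC c h) O O') :
    delt b c h (O' 0) (O' 1) (O' 2 ^ 2) = 0 := by
  obtain ⟨nA, nB, nC, ⟨e1, e2, e3, q12, q13, q23⟩, ho⟩ := hc
  have d1 := dist_pos.2 nA
  have d2 := dist_pos.2 nB
  have d3 := dist_pos.2 nC
  have k12 := two_mul_cos_angle_mul_dist vertexA O (vertexB b)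
  have k13 := two_mul_cos_angle_mul_dist vertexA O (vertexC c h)
  have k23 := two_mul_cos_angle_mul_dist (vertexB b) O (vertexC c h)
  have hO' := (mem_dangerCylinder_iff b c O hh).1 hO
  have hJ := gram_jacobian b c h (O 0) (O 1) (O 2)
  rw [hO', mul_zero] at hJ
  have DA := dist_vertexA_sq O
  have DB := dist_vertexB_sq b O
  have DC := dist_vertexC_sq c h O
  have EA := dist_vertexA_sq O'
  have EB := dist_vertexB_sq b O'
  have EC := dist_vertexC_sq c h O'
  have AB := dist_AB_sq b
  have AC := dist_AC_sq c h
  have BC := dist_BC_sq b c h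
  have r12 := (solution_eq_iff (l := gAB b (O' 0) (O' 1) (O' 2))
    (l' := gAB b (O 0) (O 1) (O 2)) d1 d2 k12
    (by rw [EA, EB, AB]; simp only [gAA, gBB, gAB]; ring)
    (by rw [DA, DB, AB]; simp only [gAA, gBB, gAB]; ring)).1 q12
  have r13 := (solution_eq_iff (l := gAC c h (O' 0) (O' 1) (O' 2))
    (l' := gAC c h (O 0) (O 1) (O 2)) d1 d3 k13
    (by rw [EA, EC, AC]; simp only [gAA, gCC, gAC]; ring)
    (by rw [DA, DC, AC]; simp only [gAA, gCC, gAC]; ring)).1 q13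
  have r23 := (solution_eq_iff (l := gBC b c h (O' 0) (O' 1) (O' 2))
    (l' := gBC b c h (O 0) (O 1) (O 2)) d2 d3 k23
    (by rw [EB, EC, BC]; simp only [gBB, gCC, gBC]; ring)
    (by rw [DB, DC, BC]; simp only [gBB, gCC, gBC]; ring)).1 q23
  have c12 : gAA (O 0) (O 1) (O 2) + gBB b (O 0) (O 1) (O 2) - 2 * gAB b (O 0) (O 1) (O 2) =
      gAA (O' 0) (O' 1) (O' 2) + gBB b (O' 0) (O' 1) (O' 2) - 2 * gAB b (O' 0) (O' 1) (O' 2) := by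
    simp only [gAA, gBB, gAB]; ring
  have c13 : gAA (O 0) (O 1) (O 2) + gCC c h (O 0) (O 1) (O 2) - 2 * gAC c h (O 0) (O 1) (O 2) =
      gAA (O' 0) (O' 1) (O' 2) + gCC c h (O' 0) (O' 1) (O' 2) -
        2 * gAC c h (O' 0) (O' 1) (O' 2) := by
    simp only [gAA, gCC, gAC]; ring
  have c23 : gBB b (O 0) (O 1) (O 2) + gCC c h (O 0) (O 1) (O 2) - 2 * gBC b c h (O 0) (O 1) (O 2) =
      gBB b (O' 0) (O' 1) (O' 2) + gCC c h (O' 0) (O' 1) (O' 2) -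
        2 * gBC b c h (O' 0) (O' 1) (O' 2) := by
    simp only [gBB, gCC, gBC]; ring
  have c12' : gAA (O' 0) (O' 1) (O' 2) + gBB b (O' 0) (O' 1) (O' 2) -
      2 * gAB b (O' 0) (O' 1) (O' 2) = b ^ 2 := by
    simp only [gAA, gBB, gAB]; ring
  rw [delt, coeffS3_eq_gram, coeffS2T_eq_gram, coeffST2_eq_gram, coeffT3_eq_gram]
  generalize gAA (O' 0) (O' 1) (O' 2) = p at *
  generalize gBB b (O' 0) (O' 1) (O' 2) = q at *
  generalize gCC c h (O' 0) (O' 1) (O' 2) = r at *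
  generalize gAB b (O' 0) (O' 1) (O' 2) = l at *
  generalize gAC c h (O' 0) (O' 1) (O' 2) = m at *
  generalize gBC b c h (O' 0) (O' 1) (O' 2) = n at *
  -- The second solution is given by the ratios of the distances from O to those from O'; equality
  -- of the viewing angles then rescales the inner products by the corresponding products of ratios.
  obtain ⟨u, hu⟩ : ∃ u, dist O vertexA = u * dist O' vertexA :=
    ⟨dist O vertexA / dist O' vertexA, by field_simp⟩
  obtain ⟨v, hv⟩ : ∃ v, dist O (vertexB b) = v * dist O' (vertexB b) :=
    ⟨dist O (vertexB b) / dist O' (vertexB b), by field_simp⟩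
  obtain ⟨w, hw⟩ : ∃ w, dist O (vertexC c h) = w * dist O' (vertexC c h) :=
    ⟨dist O (vertexC c h) / dist O' (vertexC c h), by field_simp⟩
  rw [hu] at d1 DA r12 r13 ho
  rw [hv] at d2 DB r12 r23 ho
  rw [hw] at d3 DC r13 r23 ho
  have pu : 0 < u := pos_of_mul_pos_left d1 e1.le
  have pv : 0 < v := pos_of_mul_pos_left d2 e2.le
  have pw : 0 < w := pos_of_mul_pos_left d3 e3.le
  rw [← DA, ← DB, ← DC] at hJ
  rw [← DA, ← DB] at c12
  rw [← DA, ← DC] at c13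
  rw [← DB, ← DC] at c23
  generalize dist O' vertexA = eA at *
  generalize dist O' (vertexB b) = eB at *
  generalize dist O' (vertexC c h) = eC at *
  have r12' : gAB b (O 0) (O 1) (O 2) = u * v * l := by
    have : (gAB b (O 0) (O 1) (O 2) - u * v * l) * (eA * eB) = 0 := by linear_combination -r12
    linarith [(mul_eq_zero.1 this).resolve_right (by positivity)]
  have r13' : gAC c h (O 0) (O 1) (O 2) = u * w * m := by
    have : (gAC c h (O 0) (O 1) (O 2) - u * w * m) * (eA * eC) = 0 := by linear_combination -r13
    linarith [(mul_eq_zero.1 this).resolve_right (by positivity)]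
  have r23' : gBC b c h (O 0) (O 1) (O 2) = v * w * n := by
    have : (gBC b c h (O 0) (O 1) (O 2) - v * w * n) * (eB * eC) = 0 := by linear_combination -r23
    linarith [(mul_eq_zero.1 this).resolve_right (by positivity)]
  rw [r12', r13', r23'] at hJ
  rw [r12'] at c12
  rw [r13'] at c13
  rw [r23'] at c23
  subst EA EB EC
  have hdet : gramDet (eA ^ 2) (eB ^ 2) (eC ^ 2) l m n u v w = 0 := by
    have : gramDet (eA ^ 2) (eB ^ 2) (eC ^ 2) l m n u v w * (u * v * w) = 0 := by
      rw [← hJ, gramDet]; ring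
    exact (mul_eq_zero.1 this).resolve_right (by positivity)
  have g1 := gram_deriv_s (p := eA ^ 2) (q := eB ^ 2) (r := eC ^ 2) (l := l) (m := m) (n := n)
    u v w (by linear_combination c12) (by linear_combination c13) (by linear_combination c23)
  have g2 := gram_deriv_t (p := eA ^ 2) (q := eB ^ 2) (r := eC ^ 2) (l := l) (m := m) (n := n)
    u v w (by linear_combination c12) (by linear_combination c13) (by linear_combination c23)
  rw [hdet] at g1 g2
  refine cubicDisc_eq_zero_of_double_root (s := v - u) (t := w - u) ?_
    (by linear_combination g1) (by linear_combination g2)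
  by_contra! hne
  obtain ⟨h1, h2⟩ := hne
  have hvu : v = u := by linarith
  have hwu : w = u := by linarith
  subst hvu hwu
  -- If the three ratios agree, both centres see similar triangles on the same rays; the common side
  -- AB forces the ratio 1, against the assumption that O' gives another solution.
  have : (w ^ 2 - 1) * b ^ 2 = 0 := by
    rw [← c12']; linear_combination c12
  have hw1 : w = 1 := by
    have h3 := (mul_eq_zero.1 this).resolve_right (by positivity)
    have h4 : (w - 1) * (w + 1) = 0 := by linear_combination h3
    linarith [(mul_eq_zero.1 h4).resolve_right (by positivity)]
  subst hw1
  simp at ho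

/-! ### High points of the surface are complementary camera centres -/

lemma eq_zero_of_sum_sq_nonpos {x y z : ℝ} (h : x ^ 2 + y ^ 2 + z ^ 2 ≤ 0) :
    x = 0 ∧ y = 0 ∧ z = 0 := by
  have h1 := sq_nonneg x
  have h2 := sq_nonneg y
  have h3 := sq_nonneg z
  refine ⟨?_, ?_, ?_⟩ <;> rw [← sq_eq_zero_iff] <;> linarith

/-- A double root of the cubic gives a second solution of the system, at which the Jacobian
determinant vanishes. -/
lemma exists_solution_of_double_root {p q r l m n s t : ℝ} (hst : s ≠ 0 ∨ t ≠ 0)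
    (hJ : gramDet p q r l m n 1 1 1 ≠ 0)
    (h1 : 3 * gramS3 p q r l m n * s ^ 2 + 2 * gramS2T p q r l m n * s * t +
      gramST2 p q r l m n * t ^ 2 = 0)
    (h2 : gramS2T p q r l m n * s ^ 2 + 2 * gramST2 p q r l m n * s * t +
      3 * gramT3 p q r l m n * t ^ 2 = 0) :
    ∃ u k : ℝ,
      u ^ 2 * p + (u + s) ^ 2 * q - 2 * u * (u + s) * l = k * (p + q - 2 * l) ∧
      u ^ 2 * p + (u + t) ^ 2 * r - 2 * u * (u + t) * m = k * (p + r - 2 * m) ∧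
      (u + s) ^ 2 * q + (u + t) ^ 2 * r - 2 * (u + s) * (u + t) * n = k * (q + r - 2 * n) := by
  obtain ⟨c1, hc1⟩ : ∃ c1, c1 = p + q - 2 * l := ⟨_, rfl⟩
  obtain ⟨c2, hc2⟩ : ∃ c2, c2 = p + r - 2 * m := ⟨_, rfl⟩
  obtain ⟨c3, hc3⟩ : ∃ c3, c3 = q + r - 2 * n := ⟨_, rfl⟩
  obtain ⟨b1, hb1⟩ : ∃ b1, b1 = s * (q - l) := ⟨_, rfl⟩
  obtain ⟨b2, hb2⟩ : ∃ b2, b2 = t * (r - m) := ⟨_, rfl⟩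
  obtain ⟨b3, hb3⟩ : ∃ b3, b3 = s * (q - n) + t * (r - n) := ⟨_, rfl⟩
  obtain ⟨q1, hq1⟩ : ∃ q1, q1 = s ^ 2 * q := ⟨_, rfl⟩
  obtain ⟨q2, hq2⟩ : ∃ q2, q2 = t ^ 2 * r := ⟨_, rfl⟩
  obtain ⟨q3, hq3⟩ : ∃ q3, q3 = s ^ 2 * q + t ^ 2 * r - 2 * s * t * n := ⟨_, rfl⟩
  -- This determinant of the vectors c, b, q is the cubic itself, and it vanishes by Euler's
  -- identity.
  have hK : (c2 * b3 - c3 * b2) * q1 + (c3 * b1 - c1 * b3) * q2 + (c1 * b2 - c2 * b1) * q3 = 0 := by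
    subst hc1 hc2 hc3 hb1 hb2 hb3 hq1 hq2 hq3
    simp only [gramS3, gramS2T, gramST2, gramT3] at h1 h2
    linear_combination (s / 3) * h1 + (t / 3) * h2
  -- If c and b were parallel, a nonzero vector would lie in the kernel of the Jacobian matrix at
  -- (1, 1, 1), which `hJ` excludes. So q is a combination α c + β b.
  have hw : 0 < (c2 * b3 - c3 * b2) ^ 2 + (c3 * b1 - c1 * b3) ^ 2 + (c1 * b2 - c2 * b1) ^ 2 := by
    by_contra hneg
    obtain ⟨w1, w2, w3⟩ := eq_zero_of_sum_sq_nonpos (not_lt.1 hneg)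
    have e1 : gramDet p q r l m n 1 1 1 * t = 0 := by
      have : gramDet p q r l m n 1 1 1 * t =
          -((c2 * b3 - c3 * b2) * (q - l) + (c1 * b2 - c2 * b1) * (q - n)) := by
        subst hc1 hc2 hc3 hb1 hb2 hb3
        simp only [gramDet]; ring
      rw [this, w1, w3]; ring
    have e2 : gramDet p q r l m n 1 1 1 * s = 0 := by
      have : gramDet p q r l m n 1 1 1 * s =
          (c3 * b1 - c1 * b3) * (r - m) + (c1 * b2 - c2 * b1) * (r - n) := by
        subst hc1 hc2 hc3 hb1 hb2 hb3
        simp only [gramDet]; ring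
      rw [this, w2, w3]; ring
    have hs := (mul_eq_zero.1 e2).resolve_left hJ
    have ht := (mul_eq_zero.1 e1).resolve_left hJ
    tauto
  set w1 := c2 * b3 - c3 * b2 with hw1
  set w2 := c3 * b1 - c1 * b3 with hw2
  set w3 := c1 * b2 - c2 * b1 with hw3
  set N := w1 ^ 2 + w2 ^ 2 + w3 ^ 2 with hN
  obtain ⟨α, hα⟩ : ∃ α, α * N =
      (q2 * b3 - q3 * b2) * w1 + (q3 * b1 - q1 * b3) * w2 + (q1 * b2 - q2 * b1) * w3 :=
    ⟨_ / N, div_mul_cancel₀ _ hw.ne'⟩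
  obtain ⟨β, hβ⟩ : ∃ β, β * N =
      (c2 * q3 - c3 * q2) * w1 + (c3 * q1 - c1 * q3) * w2 + (c1 * q2 - c2 * q1) * w3 :=
    ⟨_ / N, div_mul_cancel₀ _ hw.ne'⟩
  have r1 : q1 = α * c1 + β * b1 := by
    have : (q1 - (α * c1 + β * b1)) * N = 0 := by
      rw [sub_mul, add_mul, mul_right_comm α, mul_right_comm β, hα, hβ]
      linear_combination w1 * hK
    linarith [(mul_eq_zero.1 this).resolve_right hw.ne']
  have r2 : q2 = α * c2 + β * b2 := by
    have : (q2 - (α * c2 + β * b2)) * N = 0 := by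
      rw [sub_mul, add_mul, mul_right_comm α, mul_right_comm β, hα, hβ]
      linear_combination w2 * hK
    linarith [(mul_eq_zero.1 this).resolve_right hw.ne']
  have r3 : q3 = α * c3 + β * b3 := by
    have : (q3 - (α * c3 + β * b3)) * N = 0 := by
      rw [sub_mul, add_mul, mul_right_comm α, mul_right_comm β, hα, hβ]
      linear_combination w3 * hK
    linarith [(mul_eq_zero.1 this).resolve_right hw.ne']
  -- The left-hand sides are u² c + 2u b + q = (u² + α) c + (2u + β) b, so u = -β / 2 removes b.
  refine ⟨-β / 2, β ^ 2 / 4 + α, ?_, ?_, ?_⟩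
  · rw [← hc1]; linear_combination r1 - hq1 + β * hb1 - (β ^ 2 / 4) * hc1
  · rw [← hc2]; linear_combination r2 - hq2 + β * hb2 - (β ^ 2 / 4) * hc2
  · rw [← hc3]; linear_combination r3 - hq3 + β * hb3 - (β ^ 2 / 4) * hc3

/-- Heron's expression (16 times the squared area) vanishes for the collinear lengths X, X + Y, Y.
Twelve of the eighteen units in the bound come from the terms linear in the errors, six from the
products of two errors. -/
lemma le_of_heron {X Y a b c ε σ : ℝ} (ha : X ^ 2 ≤ a) (hb : (X + Y) ^ 2 ≤ b) (hc : Y ^ 2 ≤ c)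
    (ha' : a ≤ X ^ 2 + ε) (hb' : b ≤ (X + Y) ^ 2 + ε) (hc' : c ≤ Y ^ 2 + ε)
    (ha2 : a ≤ σ) (hb2 : b ≤ σ) (hc2 : c ≤ σ) :
    2 * a * b + 2 * b * c + 2 * c * a - a ^ 2 - b ^ 2 - c ^ 2 ≤ 18 * σ * ε := by
  obtain ⟨e1, rfl⟩ : ∃ e, a = X ^ 2 + e := ⟨a - X ^ 2, by ring⟩
  obtain ⟨e2, rfl⟩ : ∃ e, b = (X + Y) ^ 2 + e := ⟨b - (X + Y) ^ 2, by ring⟩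
  obtain ⟨e3, rfl⟩ : ∃ e, c = Y ^ 2 + e := ⟨c - Y ^ 2, by ring⟩
  have p1 : 0 ≤ e1 := by linarith
  have p2 : 0 ≤ e2 := by linarith
  have p3 : 0 ≤ e3 := by linarith
  have q1 : e1 ≤ ε := by linarith
  have q2 : e2 ≤ ε := by linarith
  have q3 : e3 ≤ ε := by linarith
  have s1 : X ^ 2 ≤ σ := by linarith
  have s2 : (X + Y) ^ 2 ≤ σ := by linarith
  have s3 : Y ^ 2 ≤ σ := by linarith
  have t1 : e1 ≤ σ := by nlinarith [sq_nonneg X]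
  have t2 : e2 ≤ σ := by nlinarith [sq_nonneg (X + Y)]
  have t3 : e3 ≤ σ := by nlinarith [sq_nonneg Y]
  have hσ : 0 ≤ σ := le_trans p1 t1
  have m12 : X ^ 2 * e2 ≤ σ * ε := mul_le_mul s1 q2 p2 hσ
  have m13 : X ^ 2 * e3 ≤ σ * ε := mul_le_mul s1 q3 p3 hσ
  have m21 : (X + Y) ^ 2 * e1 ≤ σ * ε := mul_le_mul s2 q1 p1 hσ
  have m23 : (X + Y) ^ 2 * e3 ≤ σ * ε := mul_le_mul s2 q3 p3 hσ
  have m31 : Y ^ 2 * e1 ≤ σ * ε := mul_le_mul s3 q1 p1 hσ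
  have m32 : Y ^ 2 * e2 ≤ σ * ε := mul_le_mul s3 q2 p2 hσ
  have n12 : e1 * e2 ≤ σ * ε := mul_le_mul t1 q2 p2 hσ
  have n13 : e1 * e3 ≤ σ * ε := mul_le_mul t1 q3 p3 hσ
  have n23 : e2 * e3 ≤ σ * ε := mul_le_mul t2 q3 p3 hσ
  have k1 : 0 ≤ X ^ 2 * e1 := by positivity
  have k2 : 0 ≤ (X + Y) ^ 2 * e2 := by positivity
  have k3 : 0 ≤ Y ^ 2 * e3 := by positivity
  linarith [sq_nonneg e1, sq_nonneg e2, sq_nonneg e3]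

/-- If a triangle with bounded horizontal parts of its rays is seen from far below, the parameters
along the rays are small, and the triangle is flat. -/
lemma heron_le_of_small {XA YA XB YB XC YC z u v w a b c σ H : ℝ} (hz : 0 < z ^ 2)
    (hA : XA ^ 2 + YA ^ 2 ≤ H) (hB : XB ^ 2 + YB ^ 2 ≤ H) (hC : XC ^ 2 + YC ^ 2 ≤ H)
    (h1 : (u * XA - v * XB) ^ 2 + (u * YA - v * YB) ^ 2 + z ^ 2 * (u - v) ^ 2 = a)
    (h2 : (u * XA - w * XC) ^ 2 + (u * YA - w * YC) ^ 2 + z ^ 2 * (u - w) ^ 2 = b)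
    (h3 : (v * XB - w * XC) ^ 2 + (v * YB - w * YC) ^ 2 + z ^ 2 * (v - w) ^ 2 = c)
    (ha : a ≤ σ) (hb : b ≤ σ) (hc : c ≤ σ)
    (hu : z ^ 2 * u ^ 2 ≤ σ) (hv : z ^ 2 * v ^ 2 ≤ σ) (hw : z ^ 2 * w ^ 2 ≤ σ) :
    z ^ 2 * (2 * a * b + 2 * b * c + 2 * c * a - a ^ 2 - b ^ 2 - c ^ 2) ≤ 72 * σ ^ 2 * H := by
  have key : ∀ {X Y X' Y' u v : ℝ}, X ^ 2 + Y ^ 2 ≤ H → X' ^ 2 + Y' ^ 2 ≤ H →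
      z ^ 2 * u ^ 2 ≤ σ → z ^ 2 * v ^ 2 ≤ σ →
      (u * X - v * X') ^ 2 + (u * Y - v * Y') ^ 2 ≤ 4 * σ * H / z ^ 2 := by
    intro X Y X' Y' u v hX hX' hu hv
    rw [le_div_iff₀ hz]
    have m1 : (z ^ 2 * u ^ 2) * (X ^ 2 + Y ^ 2) ≤ σ * H :=
      mul_le_mul hu hX (by positivity) (le_trans (by positivity) hu)
    have m2 : (z ^ 2 * v ^ 2) * (X' ^ 2 + Y' ^ 2) ≤ σ * H :=
      mul_le_mul hv hX' (by positivity) (le_trans (by positivity) hv)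
    have m3 : 0 ≤ z ^ 2 * ((u * X + v * X') ^ 2 + (u * Y + v * Y') ^ 2) := by positivity
    linarith
  have g1 := key hA hB hu hv
  have g2 := key hA hC hu hw
  have g3 := key hB hC hv hw
  have := le_of_heron (X := z * (u - v)) (Y := z * (v - w)) (a := a) (b := b) (c := c)
    (ε := 4 * σ * H / z ^ 2) (σ := σ)
    (by nlinarith [sq_nonneg (u * XA - v * XB), sq_nonneg (u * YA - v * YB)])
    (by nlinarith [sq_nonneg (u * XA - w * XC), sq_nonneg (u * YA - w * YC)])
    (by nlinarith [sq_nonneg (v * XB - w * XC), sq_nonneg (v * YB - w * YC)])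
    (by linarith) (by linarith) (by linarith) ha hb hc
  calc _ ≤ z ^ 2 * (18 * σ * (4 * σ * H / z ^ 2)) := by gcongr
    _ = _ := by
      have : z ≠ 0 := by rintro rfl; simp at hz
      field_simp; ring

/-- Parameters of opposite sign are each bounded by their difference, hence by a side of the
triangle; the third one is at bounded distance from the first. -/
lemma small_of_mul_nonpos {z u v w a b c : ℝ} (h1 : z ^ 2 * (u - v) ^ 2 ≤ a)
    (h2 : z ^ 2 * (u - w) ^ 2 ≤ b) (hc : 0 ≤ c) (huv : u * v ≤ 0) :
    z ^ 2 * u ^ 2 ≤ 2 * (a + b + c) ∧ z ^ 2 * v ^ 2 ≤ 2 * (a + b + c) ∧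
      z ^ 2 * w ^ 2 ≤ 2 * (a + b + c) := by
  have hz := sq_nonneg z
  have b1 : z ^ 2 * u ^ 2 ≤ z ^ 2 * (u - v) ^ 2 :=
    mul_le_mul_of_nonneg_left (by nlinarith [sq_nonneg v]) hz
  have b2 : z ^ 2 * v ^ 2 ≤ z ^ 2 * (u - v) ^ 2 :=
    mul_le_mul_of_nonneg_left (by nlinarith [sq_nonneg u]) hz
  have b3 : z ^ 2 * w ^ 2 ≤ z ^ 2 * (2 * (u - w) ^ 2 + 2 * u ^ 2) :=
    mul_le_mul_of_nonneg_left (by nlinarith [sq_nonneg (w - 2 * u)]) hz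
  have : 0 ≤ z ^ 2 * (u - v) ^ 2 := by positivity
  have : 0 ≤ z ^ 2 * (u - w) ^ 2 := by positivity
  refine ⟨by linarith, by linarith, by linarith⟩

/-- For high camera centres, the parameters of a solution along the three rays have the same
sign. -/
lemma same_sign_of_high {XA YA XB YB XC YC z u v w a b c H : ℝ} (hz : 0 < z ^ 2)
    (hA : XA ^ 2 + YA ^ 2 ≤ H) (hB : XB ^ 2 + YB ^ 2 ≤ H) (hC : XC ^ 2 + YC ^ 2 ≤ H)
    (h1 : (u * XA - v * XB) ^ 2 + (u * YA - v * YB) ^ 2 + z ^ 2 * (u - v) ^ 2 = a)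
    (h2 : (u * XA - w * XC) ^ 2 + (u * YA - w * YC) ^ 2 + z ^ 2 * (u - w) ^ 2 = b)
    (h3 : (v * XB - w * XC) ^ 2 + (v * YB - w * YC) ^ 2 + z ^ 2 * (v - w) ^ 2 = c)
    (hH : 72 * (2 * (a + b + c)) ^ 2 * H <
      z ^ 2 * (2 * a * b + 2 * b * c + 2 * c * a - a ^ 2 - b ^ 2 - c ^ 2)) :
    0 < u * v ∧ 0 < u * w ∧ 0 < v * w := by
  have a0 : 0 ≤ a := by rw [← h1]; positivity
  have b0 : 0 ≤ b := by rw [← h2]; positivity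
  have c0 : 0 ≤ c := by rw [← h3]; positivity
  have l1 : z ^ 2 * (u - v) ^ 2 ≤ a := by
    nlinarith [sq_nonneg (u * XA - v * XB), sq_nonneg (u * YA - v * YB)]
  have l2 : z ^ 2 * (u - w) ^ 2 ≤ b := by
    nlinarith [sq_nonneg (u * XA - w * XC), sq_nonneg (u * YA - w * YC)]
  have l3 : z ^ 2 * (v - w) ^ 2 ≤ c := by
    nlinarith [sq_nonneg (v * XB - w * XC), sq_nonneg (v * YB - w * YC)]
  -- Small parameters would make the triangle so flat that its area is smaller than prescribed; `hH`
  -- is this contradiction in terms of the height.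
  have fin : ¬ (z ^ 2 * u ^ 2 ≤ 2 * (a + b + c) ∧ z ^ 2 * v ^ 2 ≤ 2 * (a + b + c) ∧
      z ^ 2 * w ^ 2 ≤ 2 * (a + b + c)) := by
    rintro ⟨hu, hv, hw⟩
    exact absurd (heron_le_of_small hz hA hB hC h1 h2 h3 (by linarith) (by linarith) (by linarith)
      hu hv hw) (not_le.2 hH)
  refine ⟨?_, ?_, ?_⟩ <;> by_contra! hneg <;> apply fin
  · exact small_of_mul_nonpos l1 l2 c0 hneg
  · obtain ⟨i1, i2, i3⟩ := small_of_mul_nonpos l2 l1 c0 hneg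
    exact ⟨by linarith, by linarith, by linarith⟩
  · rw [show z ^ 2 * (u - v) ^ 2 = z ^ 2 * (v - u) ^ 2 by ring] at l1
    obtain ⟨i1, i2, i3⟩ := small_of_mul_nonpos l3 l1 b0 hneg
    exact ⟨by linarith, by linarith, by linarith⟩

/-- A vector has coordinates with respect to two vectors of prescribed Gram matrix. -/
lemma exists_coordinates {b c h o1 o2 o3 e1 e2 e3 f1 f2 f3 : ℝ} (hb : 0 < b) (hh : 0 < h)
    (hee : e1 ^ 2 + e2 ^ 2 + e3 ^ 2 = b ^ 2) (hef : e1 * f1 + e2 * f2 + e3 * f3 = b * c)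
    (hff : f1 ^ 2 + f2 ^ 2 + f3 ^ 2 = c ^ 2 + h ^ 2) :
    ∃ x y z : ℝ, o1 ^ 2 + o2 ^ 2 + o3 ^ 2 = x ^ 2 + y ^ 2 + z ^ 2 ∧
      o1 * e1 + o2 * e2 + o3 * e3 = b * x ∧ o1 * f1 + o2 * f2 + o3 * f3 = c * x + h * y := by
  obtain ⟨x, hx⟩ : ∃ x, o1 * e1 + o2 * e2 + o3 * e3 = b * x := ⟨_ / b, (mul_div_cancel₀ _ hb.ne').symm⟩
  obtain ⟨y, hy⟩ : ∃ y, o1 * f1 + o2 * f2 + o3 * f3 - c * x = h * y :=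
    ⟨_ / h, (mul_div_cancel₀ _ hh.ne').symm⟩
  -- The third coordinate is the component along the normal e × f, whose length is bh. The Gram
  -- determinant then gives the norm of o.
  obtain ⟨z, hz⟩ : ∃ z, o1 * (e2 * f3 - e3 * f2) + o2 * (e3 * f1 - e1 * f3) +
      o3 * (e1 * f2 - e2 * f1) = b * h * z := ⟨_ / (b * h), (mul_div_cancel₀ _ (by positivity)).symm⟩
  refine ⟨x, y, z, ?_, hx, by linarith⟩
  have hy' : o1 * f1 + o2 * f2 + o3 * f3 = c * x + h * y := by linarith
  have gram : (o1 * (e2 * f3 - e3 * f2) + o2 * (e3 * f1 - e1 * f3) + o3 * (e1 * f2 - e2 * f1)) ^ 2 =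
      (o1 ^ 2 + o2 ^ 2 + o3 ^ 2) * ((e1 ^ 2 + e2 ^ 2 + e3 ^ 2) * (f1 ^ 2 + f2 ^ 2 + f3 ^ 2) -
        (e1 * f1 + e2 * f2 + e3 * f3) ^ 2) -
      (o1 * e1 + o2 * e2 + o3 * e3) ^ 2 * (f1 ^ 2 + f2 ^ 2 + f3 ^ 2) -
      (o1 * f1 + o2 * f2 + o3 * f3) ^ 2 * (e1 ^ 2 + e2 ^ 2 + e3 ^ 2) +
      2 * (o1 * e1 + o2 * e2 + o3 * e3) * (o1 * f1 + o2 * f2 + o3 * f3) *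
        (e1 * f1 + e2 * f2 + e3 * f3) := by ring
  rw [hz, hee, hef, hff, hx, hy'] at gram
  have : (o1 ^ 2 + o2 ^ 2 + o3 ^ 2 - (x ^ 2 + y ^ 2 + z ^ 2)) * (b * h) ^ 2 = 0 := by
    linear_combination -gram
  linarith [(mul_eq_zero.1 this).resolve_right (by positivity)]

/-- Off the danger cylinder the trivial solution (1, 1, 1) is nondegenerate, as
`exists_solution_of_double_root` requires. -/
lemma gramDet_one_eq (b c h x y z : ℝ) : gramDet (gAA x y z) (gBB b x y z) (gCC c h x y z)
    (gAB b x y z) (gAC c h x y z) (gBC b c h x y z) 1 1 1 = b ^ 2 * h * circ b c h x y := by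
  rw [← gram_jacobian b c h x y z, gramDet]; ring

lemma pos_of_sq_pos {d : ℝ} (h : 0 ≤ d) (h2 : 0 < d ^ 2) : 0 < d :=
  lt_of_le_of_ne h fun e => by simp [← e] at h2

lemma gAA_pos {x y z : ℝ} (hz : z ≠ 0) : 0 < gAA x y z := by unfold gAA; positivity

lemma gBB_pos {b x y z : ℝ} (hz : z ≠ 0) : 0 < gBB b x y z := by unfold gBB; positivity

lemma gCC_pos {c h x y z : ℝ} (hz : z ≠ 0) : 0 < gCC c h x y z := by unfold gCC; positivity

/-- A second positive solution at which the Jacobian determinant vanishes comes from a point of the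
danger cylinder. -/
lemma mem_complementarySet_of_solution {b c h x y z u' v w : ℝ} (hb : 0 < b) (hh : 0 < h)
    (hz : z ≠ 0) (puv : 0 < u' * v) (puw : 0 < u' * w) (pvw : 0 < v * w)
    (q1 : u' ^ 2 * gAA x y z + v ^ 2 * gBB b x y z - 2 * u' * v * gAB b x y z =
      gAA x y z + gBB b x y z - 2 * gAB b x y z)
    (q2 : u' ^ 2 * gAA x y z + w ^ 2 * gCC c h x y z - 2 * u' * w * gAC c h x y z =
      gAA x y z + gCC c h x y z - 2 * gAC c h x y z)
    (q3 : v ^ 2 * gBB b x y z + w ^ 2 * gCC c h x y z - 2 * v * w * gBC b c h x y z =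
      gBB b x y z + gCC c h x y z - 2 * gBC b c h x y z)
    (hdet : gramDet (gAA x y z) (gBB b x y z) (gCC c h x y z)
      (gAB b x y z) (gAC c h x y z) (gBC b c h x y z) u' v w = 0)
    (hne : v - u' ≠ 0 ∨ w - u' ≠ 0) :
    !₂[x, y, z] ∈ complementarySet b c h := by
  -- the squared distances of the vertices of the second triangle
  have s1 : (u' * -x - v * (b - x)) ^ 2 + (u' * -y - v * -y) ^ 2 + z ^ 2 * (u' - v) ^ 2 = b ^ 2 := by
    simp only [gAA, gBB, gAB] at q1; linear_combination q1
  have s2 : (u' * -x - w * (c - x)) ^ 2 + (u' * -y - w * (h - y)) ^ 2 + z ^ 2 * (u' - w) ^ 2 =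
      c ^ 2 + h ^ 2 := by
    simp only [gAA, gCC, gAC] at q2; linear_combination q2
  have s3 : (v * (b - x) - w * (c - x)) ^ 2 + (v * -y - w * (h - y)) ^ 2 + z ^ 2 * (v - w) ^ 2 =
      (b - c) ^ 2 + h ^ 2 := by
    simp only [gBB, gCC, gBC] at q3; linear_combination q3
  -- The second triangle is congruent to ABC: e and f are its sides from the first vertex, and o
  -- leads from this vertex to the camera. The coordinates of the camera relative to it give the
  -- centre on the danger cylinder.
  obtain ⟨X, Y, Z, o1, o2, o3⟩ := exists_coordinates (b := b) (c := c) (h := h)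
    (o1 := -(u' * -x)) (o2 := -(u' * -y)) (o3 := -(u' * -z))
    (e1 := v * (b - x) - u' * -x) (e2 := v * -y - u' * -y) (e3 := v * -z - u' * -z)
    (f1 := w * (c - x) - u' * -x) (f2 := w * (h - y) - u' * -y) (f3 := w * -z - u' * -z) hb hh
    (by linear_combination s1) (by linear_combination (s1 + s2 - s3) / 2) (by linear_combination s2)
  -- the Gram matrix at the new point
  have EA : gAA X Y Z = u' ^ 2 * gAA x y z := by simp only [gAA]; linear_combination -o1
  have EB : gBB b X Y Z = v ^ 2 * gBB b x y z := by
    simp only [gBB]; linear_combination -o1 + 2 * o2 - s1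
  have EC : gCC c h X Y Z = w ^ 2 * gCC c h x y z := by
    simp only [gCC]; linear_combination -o1 + 2 * o3 - s2
  have EAB : gAB b X Y Z = u' * v * gAB b x y z := by
    simp only [gAB]; linear_combination -o1 + o2
  have EAC : gAC c h X Y Z = u' * w * gAC c h x y z := by
    simp only [gAC]; linear_combination -o1 + o3
  have EBC : gBC b c h X Y Z = v * w * gBC b c h x y z := by
    simp only [gBC]; linear_combination -o1 + o2 + o3 + (s3 - s1 - s2) / 2
  have u0 : u' ≠ 0 := by rintro rfl; simp at puv
  have v0 : v ≠ 0 := by rintro rfl; simp at puv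
  have w0 : w ≠ 0 := by rintro rfl; simp at puw
  have hcirc : circ b c h X Y = 0 := by
    have := gram_jacobian b c h X Y Z
    rw [EA, EB, EC, EAB, EAC, EBC] at this
    have e : b ^ 2 * h * circ b c h X Y = 0 := by
      rw [← this]
      rw [gramDet] at hdet
      linear_combination (u' * v * w) * hdet
    exact (mul_eq_zero.1 e).resolve_left (by positivity)
  have cA : dist !₂[x, y, z] vertexA ^ 2 = gAA x y z := by
    rw [dist_vertexA_sq]; simp
  have cB : dist !₂[x, y, z] (vertexB b) ^ 2 = gBB b x y z := by
    rw [dist_vertexB_sq]; simp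
  have cC : dist !₂[x, y, z] (vertexC c h) ^ 2 = gCC c h x y z := by
    rw [dist_vertexC_sq]; simp
  have pA : 0 < dist !₂[x, y, z] vertexA := by
    have := gAA_pos (x := x) (y := y) hz
    rw [← cA] at this
    exact pos_of_sq_pos dist_nonneg this
  have pB : 0 < dist !₂[x, y, z] (vertexB b) := by
    have := gBB_pos (b := b) (x := x) (y := y) hz
    rw [← cB] at this
    exact pos_of_sq_pos dist_nonneg this
  have pC : 0 < dist !₂[x, y, z] (vertexC c h) := by
    have := gCC_pos (c := c) (h := h) (x := x) (y := y) hz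
    rw [← cC] at this
    exact pos_of_sq_pos dist_nonneg this
  have dA : dist !₂[X, Y, Z] vertexA = |u'| * dist !₂[x, y, z] vertexA := by
    rw [← sq_eq_sq₀ dist_nonneg (by positivity), mul_pow, sq_abs, cA, ← EA, dist_vertexA_sq]
    simp
  have dB : dist !₂[X, Y, Z] (vertexB b) = |v| * dist !₂[x, y, z] (vertexB b) := by
    rw [← sq_eq_sq₀ dist_nonneg (by positivity), mul_pow, sq_abs, cB, ← EB, dist_vertexB_sq]
    simp
  have dC : dist !₂[X, Y, Z] (vertexC c h) = |w| * dist !₂[x, y, z] (vertexC c h) := by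
    rw [← sq_eq_sq₀ dist_nonneg (by positivity), mul_pow, sq_abs, cC, ← EC, dist_vertexC_sq]
    simp
  have dA0 : 0 < dist !₂[X, Y, Z] vertexA := by rw [dA]; positivity
  have dB0 : 0 < dist !₂[X, Y, Z] (vertexB b) := by rw [dB]; positivity
  have dC0 : 0 < dist !₂[X, Y, Z] (vertexC c h) := by rw [dC]; positivity
  have DA := dist_vertexA_sq !₂[X, Y, Z]
  have DB := dist_vertexB_sq b !₂[X, Y, Z]
  have DC := dist_vertexC_sq c h !₂[X, Y, Z]
  simp only [Matrix.cons_val_zero, Matrix.cons_val_one, Matrix.cons_val] at DA DB DC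
  -- The common sign of the parameters may be negative. Distances only involve absolute values and
  -- inner products only pairwise products, so this does no harm.
  have auv : |u'| * |v| = u' * v := by rw [← abs_mul, abs_of_pos puv]
  have auw : |u'| * |w| = u' * w := by rw [← abs_mul, abs_of_pos puw]
  have avw : |v| * |w| = v * w := by rw [← abs_mul, abs_of_pos pvw]
  refine ⟨!₂[X, Y, Z], ?_, ?_⟩
  · rw [mem_dangerCylinder_iff _ _ _ hh]; simpa using hcirc
  refine ⟨dist_pos.1 dA0, dist_pos.1 dB0, dist_pos.1 dC0, ⟨pA, pB, pC, ?_, ?_, ?_⟩, ?_⟩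
  · refine (solution_eq_iff (l := gAB b x y z) (l' := gAB b X Y Z) dA0 dB0
      (two_mul_cos_angle_mul_dist _ _ _)
      (by rw [cA, cB, dist_AB_sq]; simp only [gAA, gBB, gAB]; ring)
      (by rw [DA, DB, dist_AB_sq]; simp only [gAA, gBB, gAB]; ring)).2 ?_
    rw [dA, dB, EAB]
    linear_combination (gAB b x y z * dist !₂[x, y, z] vertexA * dist !₂[x, y, z] (vertexB b)) * auv
  · refine (solution_eq_iff (l := gAC c h x y z) (l' := gAC c h X Y Z) dA0 dC0
      (two_mul_cos_angle_mul_dist _ _ _)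
      (by rw [cA, cC, dist_AC_sq]; simp only [gAA, gCC, gAC]; ring)
      (by rw [DA, DC, dist_AC_sq]; simp only [gAA, gCC, gAC]; ring)).2 ?_
    rw [dA, dC, EAC]
    linear_combination
      (gAC c h x y z * dist !₂[x, y, z] vertexA * dist !₂[x, y, z] (vertexC c h)) * auw
  · refine (solution_eq_iff (l := gBC b c h x y z) (l' := gBC b c h X Y Z) dB0 dC0
      (two_mul_cos_angle_mul_dist _ _ _)
      (by rw [cB, cC, dist_BC_sq]; simp only [gBB, gCC, gBC]; ring)
      (by rw [DB, DC, dist_BC_sq]; simp only [gBB, gCC, gBC]; ring)).2 ?_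
    rw [dB, dC, EBC]
    linear_combination
      (gBC b c h x y z * dist !₂[x, y, z] (vertexB b) * dist !₂[x, y, z] (vertexC c h)) * avw
  -- Equal distances would mean |u'| = |v| = |w| = 1, and by the common sign u' = v = w, against
  -- `hne`.
  · rintro ⟨h1, h2, h3⟩
    rw [dA, eq_comm, mul_eq_right₀ pA.ne'] at h1
    rw [dB, eq_comm, mul_eq_right₀ pB.ne'] at h2
    rw [dC, eq_comm, mul_eq_right₀ pC.ne'] at h3
    have a1 : u' ^ 2 = 1 := by rw [← sq_abs, h1, one_pow]
    rw [h1, h2, one_mul] at auv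
    rw [h1, h3, one_mul] at auw
    have ev : v = u' := by linear_combination (-u') * auv - v * a1
    have ew : w = u' := by linear_combination (-u') * auw - w * a1
    subst ev ew
    simp at hne

/-- High points of the surface outside the danger cylinder are complementary to a point of the
danger cylinder. -/
lemma mem_complementarySet_of_high {b c h x y z H : ℝ} (hb : 0 < b) (hh : 0 < h)
    (hA : x ^ 2 + y ^ 2 ≤ H) (hB : (b - x) ^ 2 + y ^ 2 ≤ H)
    (hC : (c - x) ^ 2 + (h - y) ^ 2 ≤ H)
    (hz : 72 * (2 * (b ^ 2 + (c ^ 2 + h ^ 2) + ((b - c) ^ 2 + h ^ 2))) ^ 2 * H <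
      z ^ 2 * (4 * b ^ 2 * h ^ 2))
    (hg : circ b c h x y ≠ 0) (hd : delt b c h x y (z ^ 2) = 0) :
    !₂[x, y, z] ∈ complementarySet b c h := by
  have hH : 0 ≤ H := le_trans (by positivity) hA
  have hz0 : 0 < z ^ 2 := by
    have : 0 < z ^ 2 * (4 * b ^ 2 * h ^ 2) := lt_of_le_of_lt (by positivity) hz
    exact pos_of_mul_pos_left this (by positivity)
  rw [delt, coeffS3_eq_gram, coeffS2T_eq_gram, coeffST2_eq_gram, coeffT3_eq_gram] at hd
  obtain ⟨s, t, hst, h1, h2⟩ := exists_double_root_of_cubicDisc_eq_zero hd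
  obtain ⟨u, k, k1, k2, k3⟩ := exists_solution_of_double_root hst
    (by rw [gramDet_one_eq]; positivity) h1 h2
  -- the scale of the second solution is positive
  have kpos : 0 < k := by
    by_contra! hk
    have e1 : (u * -x - (u + s) * (b - x)) ^ 2 + (u * -y - (u + s) * -y) ^ 2 + z ^ 2 * s ^ 2 =
        k * b ^ 2 := by
      simp only [gAA, gBB, gAB] at k1; linear_combination k1
    have e2 : (u * -x - (u + t) * (c - x)) ^ 2 + (u * -y - (u + t) * (h - y)) ^ 2 + z ^ 2 * t ^ 2 =
        k * (c ^ 2 + h ^ 2) := by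
      simp only [gAA, gCC, gAC] at k2; linear_combination k2
    have i1 : k * b ^ 2 ≤ 0 := mul_nonpos_of_nonpos_of_nonneg hk (by positivity)
    have i2 : k * (c ^ 2 + h ^ 2) ≤ 0 := mul_nonpos_of_nonpos_of_nonneg hk (by positivity)
    have j1 : z ^ 2 * s ^ 2 ≤ 0 := by
      linarith [sq_nonneg (u * -x - (u + s) * (b - x)), sq_nonneg (u * -y - (u + s) * -y)]
    have j2 : z ^ 2 * t ^ 2 ≤ 0 := by
      linarith [sq_nonneg (u * -x - (u + t) * (c - x)), sq_nonneg (u * -y - (u + t) * (h - y))]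
    rcases hst with hs | ht
    · have : 0 < z ^ 2 * s ^ 2 := by positivity
      linarith
    · have : 0 < z ^ 2 * t ^ 2 := by positivity
      linarith
  -- rescale the solution
  obtain ⟨κ, κpos, hκ⟩ : ∃ κ : ℝ, 0 < κ ∧ k = κ ^ 2 :=
    ⟨√k, Real.sqrt_pos.2 kpos, (Real.sq_sqrt kpos.le).symm⟩
  obtain ⟨u', hu⟩ : ∃ u', u = κ * u' := ⟨u / κ, (mul_div_cancel₀ _ κpos.ne').symm⟩
  obtain ⟨v, hv⟩ : ∃ v, u + s = κ * v := ⟨(u + s) / κ, (mul_div_cancel₀ _ κpos.ne').symm⟩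
  obtain ⟨w, hw⟩ : ∃ w, u + t = κ * w := ⟨(u + t) / κ, (mul_div_cancel₀ _ κpos.ne').symm⟩
  have hs : s = κ * (v - u') := by linarith
  have ht : t = κ * (w - u') := by linarith
  rw [hv, hu, hκ] at k1
  rw [hw, hu, hκ] at k2
  rw [hv, hw, hκ] at k3
  have κ2 : κ ^ 2 ≠ 0 := by positivity
  clear hu hv hw hκ kpos hd
  subst hs ht
  have q1 : u' ^ 2 * gAA x y z + v ^ 2 * gBB b x y z - 2 * u' * v * gAB b x y z =
      gAA x y z + gBB b x y z - 2 * gAB b x y z :=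
    mul_left_cancel₀ κ2 (by linear_combination k1)
  have q2 : u' ^ 2 * gAA x y z + w ^ 2 * gCC c h x y z - 2 * u' * w * gAC c h x y z =
      gAA x y z + gCC c h x y z - 2 * gAC c h x y z :=
    mul_left_cancel₀ κ2 (by linear_combination k2)
  have q3 : v ^ 2 * gBB b x y z + w ^ 2 * gCC c h x y z - 2 * v * w * gBC b c h x y z =
      gBB b x y z + gCC c h x y z - 2 * gBC b c h x y z :=
    mul_left_cancel₀ κ2 (by linear_combination k3)
  clear k1 k2 k3
  have d1 := gram_deriv_s u' v w q1 q2 q3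
  have d2 := gram_deriv_t u' v w q1 q2 q3
  have hne : v - u' ≠ 0 ∨ w - u' ≠ 0 := by
    rcases hst with h0 | h0
    · exact Or.inl (right_ne_zero_of_mul h0)
    · exact Or.inr (right_ne_zero_of_mul h0)
  -- The gradient of the cubic at (v - u', w - u') is zero, and by the gradient formula it is
  -- `gramDet` times a nonzero vector.
  have hdet : gramDet (gAA x y z) (gBB b x y z) (gCC c h x y z)
      (gAB b x y z) (gAC c h x y z) (gBC b c h x y z) u' v w = 0 := by
    rcases hne with h0 | h0
    · have : gramDet (gAA x y z) (gBB b x y z) (gCC c h x y z)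
          (gAB b x y z) (gAC c h x y z) (gBC b c h x y z) u' v w * (κ ^ 2 * (v - u')) = 0 := by
        linear_combination (-1 / 2) * h2 + (κ ^ 2 / 2) * d2
      exact (mul_eq_zero.1 this).resolve_right (mul_ne_zero κ2 h0)
    · have : gramDet (gAA x y z) (gBB b x y z) (gCC c h x y z)
          (gAB b x y z) (gAC c h x y z) (gBC b c h x y z) u' v w * (κ ^ 2 * (w - u')) = 0 := by
        linear_combination (1 / 2) * h1 - (κ ^ 2 / 2) * d1
      exact (mul_eq_zero.1 this).resolve_right (mul_ne_zero κ2 h0)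
  clear h1 h2 d1 d2 hst
  -- the squared distances of the vertices of the second triangle
  have s1 : (u' * -x - v * (b - x)) ^ 2 + (u' * -y - v * -y) ^ 2 + z ^ 2 * (u' - v) ^ 2 = b ^ 2 := by
    simp only [gAA, gBB, gAB] at q1; linear_combination q1
  have s2 : (u' * -x - w * (c - x)) ^ 2 + (u' * -y - w * (h - y)) ^ 2 + z ^ 2 * (u' - w) ^ 2 =
      c ^ 2 + h ^ 2 := by
    simp only [gAA, gCC, gAC] at q2; linear_combination q2
  have s3 : (v * (b - x) - w * (c - x)) ^ 2 + (v * -y - w * (h - y)) ^ 2 + z ^ 2 * (v - w) ^ 2 =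
      (b - c) ^ 2 + h ^ 2 := by
    simp only [gBB, gCC, gBC] at q3; linear_combination q3
  obtain ⟨puv, puw, pvw⟩ := same_sign_of_high hz0 (H := H) (by linarith) (by linarith)
    (by linarith) s1 s2 s3 (lt_of_lt_of_eq hz (by ring))
  exact mem_complementarySet_of_solution hb hh (by rintro rfl; simp at hz0) puv puw pvw q1 q2 q3
    hdet hne

/-! ### The surface on the danger cylinder -/

/-- The discriminant of the product of a linear and a quadratic form. -/
lemma cubicDisc_mul {R : Type*} [CommRing R] (k l₀ l₁ q₀ q₁ q₂ : R) :
    cubicDisc (k * (l₀ * q₀)) (k * (l₀ * q₁ + l₁ * q₀)) (k * (l₀ * q₂ + l₁ * q₁))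
      (k * (l₁ * q₂)) =
    k ^ 4 * (q₁ ^ 2 - 4 * q₀ * q₂) * (q₀ * l₁ ^ 2 - q₁ * l₁ * l₀ + q₂ * l₀ ^ 2) ^ 2 := by
  simp only [cubicDisc]; ring

section Trig

/-! In this section, `(A, a)`, `(B, b)`, `(C, c)` are points of the unit circle: cosine and sine of
the half angles under which the vertices are seen from the centre of the circumcircle, measured
from the foot of the generatrix. -/

variable (a A b B c C r Z : ℝ)

/-- The product of the sines of the angle differences. -/
def sinProd : ℝ := (a * B - A * b) * (b * C - B * c) * (c * A - C * a)

/-- The cosine of the sum of the three angles. -/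
def cosSum : ℝ := A * B * C - A * b * c - a * B * c - a * b * C

/-- The form `quadSS` s² + `quadST` st + `quadTT` t² is the cofactor of the linear form (cA - Ca) b
s + (aB - Ab) c t in `gram_cubic_factor`. -/
def quadSS : ℝ := (b * C - B * c) * (c * A - C * a) * C * (Z + r * (a * b * (A * B + a * b))) +
  (a * B - A * b) * (c * A - C * a) * A * (Z + r * (b * c * (B * C + b * c)))

def quadST : ℝ := -2 * ((a * B - A * b) * (c * A - C * a) * A * (Z + r * (b * c * (B * C + b * c))))

def quadTT : ℝ := (a * B - A * b) * (b * C - B * c) * B * (Z + r * (a * c * (A * C + a * c))) +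
  (a * B - A * b) * (c * A - C * a) * A * (Z + r * (b * c * (B * C + b * c)))

variable {a A b B c C} (hA : A ^ 2 + a ^ 2 = 1) (hB : B ^ 2 + b ^ 2 = 1) (hC : C ^ 2 + c ^ 2 = 1)

include hA hB hC in
-- The resultant of the linear and the quadratic factor. It enters the discriminant squared, and
-- this is the source of the tangency where the cosine of the angle sum vanishes.
lemma quad_root : quadSS a A b B c C r Z * ((a * B - A * b) * c) ^ 2 -
    quadST a A b B c C r Z * ((a * B - A * b) * c) * ((c * A - C * a) * b) +
    quadTT a A b B c C r Z * ((c * A - C * a) * b) ^ 2 =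
    -Z * sinProd a A b B c C ^ 2 * cosSum a A b B c C := by
  have hU : C * c ^ 2 * (a * B - A * b) + A * a ^ 2 * (b * C - B * c) + B * b ^ 2 * (c * A - C * a) =
      -(sinProd a A b B c C * cosSum a A b B c C) := by
    simp only [sinProd, cosSum]
    linear_combination (a * b ^ 2 * B * C ^ 3 - a * B ^ 3 * c ^ 2 * C + A * b ^ 3 * c ^ 2 * C - A * b ^ 2 * B * c
        ^ 3 - A * b ^ 2 * B * c * C ^ 2 + A * b * B ^ 2 * c ^ 2 * C) * hA +
      (-a ^ 2 * A * b * c ^ 2 * C - a ^ 2 * A * b * C ^ 3 + a ^ 2 * A * B * c ^ 3 + a ^ 2 * A *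
        B * c * C ^ 2 - a * B * c ^ 2 * C + A * b * c ^ 2 * C) * hB +
      (-a ^ 2 * A * b * C + a ^ 2 * A * B * c + a * b ^ 2 * B * C - A * b ^ 2 * B * c) * hC
  have hV : A * a * ((b * C - B * c) * (B * C + b * c)) + B * b * ((c * A - C * a) * (A * C + a * c)) +
      C * c * ((a * B - A * b) * (A * B + a * b)) = 0 := by ring
  have e : quadSS a A b B c C r Z * ((a * B - A * b) * c) ^ 2 -
      quadST a A b B c C r Z * ((a * B - A * b) * c) * ((c * A - C * a) * b) +
      quadTT a A b B c C r Z * ((c * A - C * a) * b) ^ 2 = sinProd a A b B c C *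
      (Z * (C * c ^ 2 * (a * B - A * b) + A * a ^ 2 * (b * C - B * c) + B * b ^ 2 * (c * A - C * a)) +
        r * a * b * c * (A * a * ((b * C - B * c) * (B * C + b * c)) + B * b * ((c * A - C * a) * (A * C + a * c)) +
          C * c * ((a * B - A * b) * (A * B + a * b)))) := by
    simp only [quadSS, quadST, quadTT, sinProd]; ring
  rw [e, hU, hV]; ring

include hA hB hC in
-- The other way to obtain a double root: the quadratic factor itself degenerates.
lemma quad_disc : quadST a A b B c C r Z ^ 2 -
    4 * quadSS a A b B c C r Z * quadTT a A b B c C r Z =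
    4 * sinProd a A b B c C ^ 2 *
      (Z ^ 2 + r * (a ^ 2 + b ^ 2 + c ^ 2 - 1) * Z + r ^ 2 * (a * b * c) ^ 2) := by
  have h2 : (b * C - B * c) * B * C + (c * A - C * a) * C * A + (a * B - A * b) * A * B = -sinProd a A b B c C := by
    simp only [sinProd]
    linear_combination (-b ^ 2 * c * C + b * B * c ^ 2 - b * B + c * C) * hA +
      (a ^ 2 * c * C - a * A * c ^ 2 + a * A - c * C) * hB +
      (-a ^ 2 * b * B + a * A * b ^ 2 - a * A + b * B) * hC
  have h1 : (b * C - B * c) * B * C * a * (b * (A * B + a * b) + c * (A * C + a * c)) +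
      (c * A - C * a) * C * A * b * (c * (B * C + b * c) + a * (A * B + a * b)) +
      (a * B - A * b) * A * B * c * (a * (A * C + a * c) + b * (B * C + b * c)) =
      -(sinProd a A b B c C * (a ^ 2 + b ^ 2 + c ^ 2 - 1)) := by
    simp only [sinProd]
    linear_combination (-a ^ 2 * b * B * C ^ 2 + a ^ 2 * B ^ 2 * c * C - b ^ 4 * c * C - b ^ 2 * B ^ 2 * c * C +
        b ^ 2 * c * C + b * B * c ^ 4 + b * B * c ^ 2 * C ^ 2 - b * B * c ^ 2) * hA +
      (a ^ 2 * b ^ 2 * c * C + a * A * b ^ 2 * C ^ 2 - a * A * c ^ 4 - a * A * c ^ 2 * C ^ 2 + a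
        * A * c ^ 2 - b ^ 2 * c * C) * hB +
      (-a ^ 2 * b * B * c ^ 2 + a * A * b ^ 2 * c ^ 2 - a * A * c ^ 2 + b * B * c ^ 2) * hC
  have e : quadST a A b B c C r Z ^ 2 - 4 * quadSS a A b B c C r Z * quadTT a A b B c C r Z =
      -4 * sinProd a A b B c C * (Z ^ 2 * ((b * C - B * c) * B * C + (c * A - C * a) * C * A + (a * B - A * b) * A * B) +
        r * Z * ((b * C - B * c) * B * C * a * (b * (A * B + a * b) + c * (A * C + a * c)) +
          (c * A - C * a) * C * A * b * (c * (B * C + b * c) + a * (A * B + a * b)) +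
          (a * B - A * b) * A * B * c * (a * (A * C + a * c) + b * (B * C + b * c))) -
        r ^ 2 * sinProd a A b B c C * (a * b * c) ^ 2) := by
    simp only [quadSS, quadST, quadTT, sinProd]; ring
  rw [e, h2, h1]; ring

include hA hB hC in
/-- On the danger cylinder, the cubic splits. -/
lemma gram_cubic_factor :
    gramS3 (Z + r * a ^ 2) (Z + r * b ^ 2) (Z + r * c ^ 2) (Z + r * (a * b * (A * B + a * b)))
      (Z + r * (a * c * (A * C + a * c))) (Z + r * (b * c * (B * C + b * c))) =
      r ^ 2 * (((c * A - C * a) * b) * quadSS a A b B c C r Z) ∧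
    gramS2T (Z + r * a ^ 2) (Z + r * b ^ 2) (Z + r * c ^ 2) (Z + r * (a * b * (A * B + a * b)))
      (Z + r * (a * c * (A * C + a * c))) (Z + r * (b * c * (B * C + b * c))) =
      r ^ 2 * (((c * A - C * a) * b) * quadST a A b B c C r Z +
        ((a * B - A * b) * c) * quadSS a A b B c C r Z) ∧
    gramST2 (Z + r * a ^ 2) (Z + r * b ^ 2) (Z + r * c ^ 2) (Z + r * (a * b * (A * B + a * b)))
      (Z + r * (a * c * (A * C + a * c))) (Z + r * (b * c * (B * C + b * c))) =
      r ^ 2 * (((c * A - C * a) * b) * quadTT a A b B c C r Z +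
        ((a * B - A * b) * c) * quadST a A b B c C r Z) ∧
    gramT3 (Z + r * a ^ 2) (Z + r * b ^ 2) (Z + r * c ^ 2) (Z + r * (a * b * (A * B + a * b)))
      (Z + r * (a * c * (A * C + a * c))) (Z + r * (b * c * (B * C + b * c))) =
      r ^ 2 * (((a * B - A * b) * c) * quadTT a A b B c C r Z) := by
  have e : ∀ {a A b B : ℝ}, A ^ 2 + a ^ 2 = 1 → B ^ 2 + b ^ 2 = 1 →
      a ^ 2 - a * b * (A * B + a * b) = a * B * (a * B - A * b) := by
    intro a A b B _ hB
    linear_combination (-a ^ 2) * hB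
  have xAB : (Z + r * a ^ 2) - (Z + r * (a * b * (A * B + a * b))) =
      r * (a * B * (a * B - A * b)) := by linear_combination r * e hA hB
  have xBA : (Z + r * b ^ 2) - (Z + r * (a * b * (A * B + a * b))) =
      r * (b * A * (b * A - B * a)) := by linear_combination r * e hB hA
  have xAC : (Z + r * a ^ 2) - (Z + r * (a * c * (A * C + a * c))) =
      r * (a * C * (a * C - A * c)) := by linear_combination r * e hA hC
  have xCA : (Z + r * c ^ 2) - (Z + r * (a * c * (A * C + a * c))) =
      r * (c * A * (c * A - C * a)) := by linear_combination r * e hC hA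
  have xBC : (Z + r * b ^ 2) - (Z + r * (b * c * (B * C + b * c))) =
      r * (b * C * (b * C - B * c)) := by linear_combination r * e hB hC
  have xCB : (Z + r * c ^ 2) - (Z + r * (b * c * (B * C + b * c))) =
      r * (c * B * (c * B - C * b)) := by linear_combination r * e hC hB
  have cAB : (Z + r * a ^ 2) + (Z + r * b ^ 2) - 2 * (Z + r * (a * b * (A * B + a * b))) =
      r * (a * B - A * b) ^ 2 := by linear_combination xAB + xBA
  have cAC : (Z + r * a ^ 2) + (Z + r * c ^ 2) - 2 * (Z + r * (a * c * (A * C + a * c))) =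
      r * (c * A - C * a) ^ 2 := by linear_combination xAC + xCA
  have cBC : (Z + r * b ^ 2) + (Z + r * c ^ 2) - 2 * (Z + r * (b * c * (B * C + b * c))) =
      r * (b * C - B * c) ^ 2 := by linear_combination xBC + xCB
  have sB : b ^ 2 * ((a * B - A * b) * A + (b * C - B * c) * C) =
      (b * C - B * c) * C * (a * b * (A * B + a * b)) +
        (a * B - A * b) * A * (b * c * (B * C + b * c)) := by
    linear_combination (b * C - B * c) * C * e hB hA + (a * B - A * b) * A * e hB hC
  have sC : c ^ 2 * ((b * C - B * c) * B + (c * A - C * a) * A) =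
      (b * C - B * c) * B * (a * c * (A * C + a * c)) +
        (c * A - C * a) * A * (b * c * (B * C + b * c)) := by
    linear_combination (b * C - B * c) * B * e hC hA + (c * A - C * a) * A * e hC hB
  simp only [gramS3, gramS2T, gramST2, gramT3, xBA, xCA, xBC, xCB, cAB, cAC, cBC, quadSS, quadST,
    quadTT]
  refine ⟨?_, ?_, ?_, ?_⟩
  · linear_combination (r ^ 3 * (c * A - C * a) ^ 2 * b) * sB
  · linear_combination (r ^ 3 * (a * B - A * b) * (c * A - C * a) * c) * sB
  · linear_combination (r ^ 3 * (a * B - A * b) * (c * A - C * a) * b) * sC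
  · linear_combination (r ^ 3 * (a * B - A * b) ^ 2 * c) * sC

include hA hB hC in
lemma gram_disc_cylinder :
    cubicDisc
      (gramS3 (Z + r * a ^ 2) (Z + r * b ^ 2) (Z + r * c ^ 2) (Z + r * (a * b * (A * B + a * b)))
        (Z + r * (a * c * (A * C + a * c))) (Z + r * (b * c * (B * C + b * c))))
      (gramS2T (Z + r * a ^ 2) (Z + r * b ^ 2) (Z + r * c ^ 2) (Z + r * (a * b * (A * B + a * b)))
        (Z + r * (a * c * (A * C + a * c))) (Z + r * (b * c * (B * C + b * c))))
      (gramST2 (Z + r * a ^ 2) (Z + r * b ^ 2) (Z + r * c ^ 2) (Z + r * (a * b * (A * B + a * b)))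
        (Z + r * (a * c * (A * C + a * c))) (Z + r * (b * c * (B * C + b * c))))
      (gramT3 (Z + r * a ^ 2) (Z + r * b ^ 2) (Z + r * c ^ 2) (Z + r * (a * b * (A * B + a * b)))
        (Z + r * (a * c * (A * C + a * c))) (Z + r * (b * c * (B * C + b * c)))) =
    4 * r ^ 8 * sinProd a A b B c C ^ 6 * Z ^ 2 * cosSum a A b B c C ^ 2 *
      (Z ^ 2 + r * (a ^ 2 + b ^ 2 + c ^ 2 - 1) * Z + r ^ 2 * (a * b * c) ^ 2) := by
  obtain ⟨h0, h1, h2, h3⟩ := gram_cubic_factor r Z hA hB hC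
  rw [h0, h1, h2, h3, cubicDisc_mul, quad_disc r Z hA hB hC, quad_root r Z hA hB hC]
  ring

end Trig

/-! ### Inscribed triangles seen from a point of the danger cylinder -/

section Circle

variable {a A b B c C : ℝ} (hA : A ^ 2 + a ^ 2 = 1) (hB : B ^ 2 + b ^ 2 = 1)
  (hC : C ^ 2 + c ^ 2 = 1)

include hA hB hC in
/-- The equation of the deltoidal surface at a point of the danger cylinder, in terms of the half
angles. -/
lemma delt_circle_unit (R z : ℝ) :
    delt (2 * R * (b * A - a * B)) (2 * R * ((c * A - C * a) * (C * B + c * b)))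
      (2 * R * ((c * A - C * a) * (c * B - C * b))) (-2 * R * (a * B)) (2 * R * (a * b)) (z ^ 2) =
    4 * (4 * R ^ 2) ^ 8 * sinProd a A b B c C ^ 6 * (z ^ 2) ^ 2 * cosSum a A b B c C ^ 2 *
      ((z ^ 2) ^ 2 + 4 * R ^ 2 * (a ^ 2 + b ^ 2 + c ^ 2 - 1) * z ^ 2 +
        (4 * R ^ 2) ^ 2 * (a * b * c) ^ 2) := by
  have vx : 2 * R * ((c * A - C * a) * (C * B + c * b)) - -2 * R * (a * B) =
      2 * R * c * (A * C * B + c * A * b + c * a * B - C * a * b) := by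
    linear_combination (-2 * R * a * B) * hC
  have vy : 2 * R * ((c * A - C * a) * (c * B - C * b)) - 2 * R * (a * b) =
      2 * R * c * (c * A * B - C * A * b - C * a * B - c * a * b) := by
    linear_combination (2 * R * a * b) * hC
  have ux : 2 * R * (b * A - a * B) - -2 * R * (a * B) = 2 * R * b * A := by ring
  -- The two brackets are the cosine and the sine of the third half angle minus the first two, that
  -- is, a unit vector along the chord to the third vertex.
  have n1 : (A * C * B + c * A * b + c * a * B - C * a * b) ^ 2 +
      (c * A * B - C * A * b - C * a * B - c * a * b) ^ 2 = 1 := by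
    linear_combination (B ^ 2 + b ^ 2) * (C ^ 2 + c ^ 2) * hA + (C ^ 2 + c ^ 2) * hB + hC
  have n2 : B * (A * C * B + c * A * b + c * a * B - C * a * b) -
      b * (c * A * B - C * A * b - C * a * B - c * a * b) = A * C + a * c := by
    linear_combination (A * C + a * c) * hB
  have n3 : A * (A * C * B + c * A * b + c * a * B - C * a * b) -
      a * (c * A * B - C * A * b - C * a * B - c * a * b) = B * C + b * c := by
    linear_combination (B * C + b * c) * hA
  rw [delt, coeffS3_eq_gram, coeffS2T_eq_gram, coeffST2_eq_gram, coeffT3_eq_gram,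
    ← gram_disc_cylinder (4 * R ^ 2) (z ^ 2) hA hB hC]
  simp only [gAA, gBB, gCC, gAB, gAC, gBC, vx, vy, ux]
  have e1 : (-2 * R * (a * B)) ^ 2 + (2 * R * (a * b)) ^ 2 + z ^ 2 =
      z ^ 2 + 4 * R ^ 2 * a ^ 2 := by linear_combination (4 * R ^ 2 * a ^ 2) * hB
  have e2 : (2 * R * b * A) ^ 2 + (2 * R * (a * b)) ^ 2 + z ^ 2 =
      z ^ 2 + 4 * R ^ 2 * b ^ 2 := by linear_combination (4 * R ^ 2 * b ^ 2) * hA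
  have e3 : (2 * R * c * (A * C * B + c * A * b + c * a * B - C * a * b)) ^ 2 +
      (2 * R * c * (c * A * B - C * A * b - C * a * B - c * a * b)) ^ 2 + z ^ 2 =
      z ^ 2 + 4 * R ^ 2 * c ^ 2 := by linear_combination (4 * R ^ 2 * c ^ 2) * n1
  have e4 : -(-2 * R * (a * B)) * (2 * R * b * A) + (2 * R * (a * b)) ^ 2 + z ^ 2 =
      z ^ 2 + 4 * R ^ 2 * (a * b * (A * B + a * b)) := by ring
  have e5 : -(-2 * R * (a * B)) * (2 * R * c * (A * C * B + c * A * b + c * a * B - C * a * b)) -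
      2 * R * (a * b) * (2 * R * c * (c * A * B - C * A * b - C * a * B - c * a * b)) + z ^ 2 =
      z ^ 2 + 4 * R ^ 2 * (a * c * (A * C + a * c)) := by
    linear_combination (4 * R ^ 2 * a * c) * n2
  have e6 : 2 * R * b * A * (2 * R * c * (A * C * B + c * A * b + c * a * B - C * a * b)) -
      2 * R * (a * b) * (2 * R * c * (c * A * B - C * A * b - C * a * B - c * a * b)) + z ^ 2 =
      z ^ 2 + 4 * R ^ 2 * (b * c * (B * C + b * c)) := by
    linear_combination (4 * R ^ 2 * b * c) * n3
  rw [e1, e2, e3, e4, e5, e6]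

end Circle

open Real in
/-- The equation of the deltoidal surface at the points of the danger cylinder, for the triangle
with circumradius `R` and angles `α`, `π - α - γ`, `γ`. -/
lemma delt_circle (R α γ u z : ℝ) :
    delt (2 * R * sin γ) (2 * R * (sin (α + γ) * cos α)) (2 * R * (sin (α + γ) * sin α))
      (R * sin γ - R * sin (2 * u + γ)) (R * cos γ - R * cos (2 * u + γ)) (z ^ 2) =
    4 * (4 * R ^ 2) ^ 8 * (sin α * sin γ * sin (α + γ)) ^ 6 * (z ^ 2) ^ 2 *
      cos (3 * u + 2 * γ + α) ^ 2 *
      ((z ^ 2) ^ 2 + 4 * R ^ 2 * (sin u ^ 2 + sin (u + γ) ^ 2 + sin (u + γ + α) ^ 2 - 1) * z ^ 2 +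
        (4 * R ^ 2) ^ 2 * (sin u * sin (u + γ) * sin (u + γ + α)) ^ 2) := by
  have h := delt_circle_unit (cos_sq_add_sin_sq u) (cos_sq_add_sin_sq (u + γ))
    (cos_sq_add_sin_sq (u + γ + α)) R z
  have e1 : sin (u + γ) * cos u - sin u * cos (u + γ) = sin γ := by
    rw [show γ = (u + γ) - u by ring, sin_sub]; ring_nf
  have e2 : sin (u + γ + α) * cos u - cos (u + γ + α) * sin u = sin (α + γ) := by
    rw [show α + γ = (u + γ + α) - u by ring, sin_sub]
  have e3 : cos (u + γ + α) * cos (u + γ) + sin (u + γ + α) * sin (u + γ) = cos α := by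
    rw [← cos_sub]; ring_nf
  have e4 : sin (u + γ + α) * cos (u + γ) - cos (u + γ + α) * sin (u + γ) = sin α := by
    rw [← sin_sub]; ring_nf
  have e5 : -2 * R * (sin u * cos (u + γ)) = R * sin γ - R * sin (2 * u + γ) := by
    have : sin (2 * u + γ) = sin u * cos (u + γ) + cos u * sin (u + γ) := by
      rw [← sin_add]; ring_nf
    rw [this, ← e1]; ring
  have e6 : 2 * R * (sin u * sin (u + γ)) = R * cos γ - R * cos (2 * u + γ) := by
    have h1 : cos (2 * u + γ) = cos u * cos (u + γ) - sin u * sin (u + γ) := by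
      rw [← cos_add]; ring_nf
    have h2 : cos γ = cos (u + γ) * cos u + sin (u + γ) * sin u := by
      rw [← cos_sub]; ring_nf
    rw [h1, h2]; ring
  have e7 : sinProd (sin u) (cos u) (sin (u + γ)) (cos (u + γ)) (sin (u + γ + α))
      (cos (u + γ + α)) = sin α * sin γ * sin (α + γ) := by
    rw [← e1, ← e2, ← e4, sinProd]; ring
  have e8 : cosSum (sin u) (cos u) (sin (u + γ)) (cos (u + γ)) (sin (u + γ + α))
      (cos (u + γ + α)) = cos (3 * u + 2 * γ + α) := by
    have k : ∀ p q s : ℝ, cos (p + q + s) =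
        cosSum (sin p) (cos p) (sin q) (cos q) (sin s) (cos s) := by
      intro p q s
      rw [cos_add, cos_add, sin_add, cosSum]; ring
    rw [← k]; ring_nf
  rw [e1, e2, e3, e4, e5, e6, e7, e8] at h
  exact h

open Real in
/-- For a non-obtuse triangle, the sum of the squared distances of a point of the circumcircle from
the vertices is at least the squared diameter. -/
lemma one_le_sum_sin_sq {α γ : ℝ} (hcos : cos α * cos (α + γ) * cos γ ≤ 0) (u : ℝ) :
    1 ≤ sin u ^ 2 + sin (u + γ) ^ 2 + sin (u + γ + α) ^ 2 := by
  have h1 : ∀ t : ℝ, sin t ^ 2 = (1 - cos (2 * t)) / 2 := by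
    intro t; rw [cos_two_mul, cos_sq']; ring
  -- The squared modulus of a sum of three unit vectors, which is at most 1 by assumption. So the
  -- sum of the three cosines is at most 1, and the sum of the squared sines at least (3 - 1) / 2.
  have h2 : (cos (2 * u) + cos (2 * (u + γ)) + cos (2 * (u + γ + α))) ^ 2 +
      (sin (2 * u) + sin (2 * (u + γ)) + sin (2 * (u + γ + α))) ^ 2 =
      1 + 8 * (cos α * cos (α + γ) * cos γ) := by
    have c1 : cos (2 * u) * cos (2 * (u + γ)) + sin (2 * u) * sin (2 * (u + γ)) =
        2 * cos γ ^ 2 - 1 := by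
      rw [← cos_sub, ← cos_neg, ← cos_two_mul]; ring_nf
    have c2 : cos (2 * u) * cos (2 * (u + γ + α)) + sin (2 * u) * sin (2 * (u + γ + α)) =
        2 * cos (α + γ) ^ 2 - 1 := by
      rw [← cos_sub, ← cos_neg, ← cos_two_mul]; ring_nf
    have c3 : cos (2 * (u + γ)) * cos (2 * (u + γ + α)) +
        sin (2 * (u + γ)) * sin (2 * (u + γ + α)) = 2 * cos α ^ 2 - 1 := by
      rw [← cos_sub, ← cos_neg, ← cos_two_mul]; ring_nf
    have s1 := sin_sq_add_cos_sq (2 * u)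
    have s2 := sin_sq_add_cos_sq (2 * (u + γ))
    have s3 := sin_sq_add_cos_sq (2 * (u + γ + α))
    have k : cos γ ^ 2 + cos (α + γ) ^ 2 + cos α ^ 2 =
        1 + 2 * (cos α * cos (α + γ) * cos γ) := by
      rw [cos_add]
      linear_combination (1 - cos α ^ 2 - 0) * sin_sq_add_cos_sq γ + sin γ ^ 2 * sin_sq_add_cos_sq α
    linear_combination s1 + s2 + s3 + 2 * c1 + 2 * c2 + 2 * c3 + 4 * k
  rw [h1, h1, h1]
  nlinarith [sq_nonneg (sin (2 * u) + sin (2 * (u + γ)) + sin (2 * (u + γ + α)))]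

/-! ### Polynomials in two variables of small degree -/

/-- A polynomial function of degree at most four that vanishes identically has zero coefficients. -/
lemma quartic_coeffs_eq_zero {a₀ a₁ a₂ a₃ a₄ : ℝ}
    (H : ∀ t : ℝ, a₀ + a₁ * t + a₂ * t ^ 2 + a₃ * t ^ 3 + a₄ * t ^ 4 = 0) :
    a₀ = 0 ∧ a₁ = 0 ∧ a₂ = 0 ∧ a₃ = 0 ∧ a₄ = 0 := by
  have h0 := H 0
  have h1 := H 1
  have h2 := H (-1)
  have h3 := H 2
  have h4 := H (-2)
  norm_num at h0 h1 h2 h3 h4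
  refine ⟨h0, ?_, ?_, ?_, ?_⟩ <;> linarith

/-- A polynomial of degree at most two in two variables is given by six coefficients. -/
lemma exists_eval_eq_quadratic {p : MvPolynomial (Fin 2) ℝ} (hp : p.totalDegree ≤ 2) :
    ∃ a b c d e f : ℝ, ∀ x y : ℝ,
      eval ![x, y] p = a * x ^ 2 + b * x * y + c * y ^ 2 + d * x + e * y + f := by
  rw [← support_sum_monomial_coeff p]
  refine Finset.sum_induction _ (fun q : MvPolynomial (Fin 2) ℝ => ∃ a b c d e f : ℝ,
      ∀ x y : ℝ, eval ![x, y] q = a * x ^ 2 + b * x * y + c * y ^ 2 + d * x + e * y + f)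
    ?_ ⟨0, 0, 0, 0, 0, 0, by simp⟩ ?_
  · rintro q r ⟨a, b, c, d, e, f, h⟩ ⟨a', b', c', d', e', f', h'⟩
    refine ⟨a + a', b + b', c + c', d + d', e + e', f + f', fun x y => ?_⟩
    rw [map_add, h, h']
    ring
  · intro m hm
    have hm2 : m 0 + m 1 ≤ 2 := by
      have h1 := (le_totalDegree hm).trans hp
      rw [Finsupp.sum_fintype _ _ (by simp), Fin.sum_univ_two] at h1
      exact h1
    have key : ∀ x y : ℝ, eval ![x, y] (monomial m (coeff m p)) =
        coeff m p * (x ^ m 0 * y ^ m 1) := fun x y => by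
      rw [eval_monomial, Finsupp.prod_fintype _ _ (by simp), Fin.prod_univ_two]
      rfl
    simp only [key]
    generalize coeff m p = r
    generalize m 0 = i at hm2 ⊢
    generalize m 1 = j at hm2 ⊢
    have hi : i ≤ 2 := by omega
    have hj : j ≤ 2 := by omega
    interval_cases i <;> interval_cases j <;> first
      | omega
      | exact ⟨0, 0, 0, 0, 0, r, fun x y => by ring1⟩
      | exact ⟨0, 0, 0, 0, r, 0, fun x y => by ring1⟩
      | exact ⟨0, 0, 0, r, 0, 0, fun x y => by ring1⟩
      | exact ⟨0, 0, r, 0, 0, 0, fun x y => by ring1⟩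
      | exact ⟨0, r, 0, 0, 0, 0, fun x y => by ring1⟩
      | exact ⟨r, 0, 0, 0, 0, 0, fun x y => by ring1⟩

/-- A polynomial of degree at most one in two variables is given by three coefficients. -/
lemma exists_eval_eq_linear {p : MvPolynomial (Fin 2) ℝ} (hp : p.totalDegree ≤ 1) :
    ∃ d e f : ℝ, ∀ x y : ℝ, eval ![x, y] p = d * x + e * y + f := by
  rw [← support_sum_monomial_coeff p]
  refine Finset.sum_induction _ (fun q : MvPolynomial (Fin 2) ℝ => ∃ d e f : ℝ,
      ∀ x y : ℝ, eval ![x, y] q = d * x + e * y + f) ?_ ⟨0, 0, 0, by simp⟩ ?_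
  · rintro q r ⟨d, e, f, h⟩ ⟨d', e', f', h'⟩
    refine ⟨d + d', e + e', f + f', fun x y => ?_⟩
    rw [map_add, h, h']
    ring
  · intro m hm
    have hm2 : m 0 + m 1 ≤ 1 := by
      have h1 := (le_totalDegree hm).trans hp
      rw [Finsupp.sum_fintype _ _ (by simp), Fin.sum_univ_two] at h1
      exact h1
    have key : ∀ x y : ℝ, eval ![x, y] (monomial m (coeff m p)) =
        coeff m p * (x ^ m 0 * y ^ m 1) := fun x y => by
      rw [eval_monomial, Finsupp.prod_fintype _ _ (by simp), Fin.prod_univ_two]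
      rfl
    simp only [key]
    generalize coeff m p = r
    generalize m 0 = i at hm2 ⊢
    generalize m 1 = j at hm2 ⊢
    have hi : i ≤ 1 := by omega
    have hj : j ≤ 1 := by omega
    interval_cases i <;> interval_cases j <;> first
      | omega
      | exact ⟨0, 0, r, fun x y => by ring1⟩
      | exact ⟨0, r, 0, fun x y => by ring1⟩
      | exact ⟨r, 0, 0, fun x y => by ring1⟩

/-- The restriction of a polynomial to a line has at most its degree. -/
lemma natDegree_aeval_line_le {σ : Type*} (p : MvPolynomial σ ℝ) (v w : σ → ℝ) :
    (aeval (fun i => Polynomial.C (v i) + Polynomial.C (w i) * Polynomial.X) p).natDegree ≤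
      p.totalDegree := by
  have h := MvPolynomial.aeval_natDegree_le (m := p.totalDegree) (n := 1) p le_rfl
    (fun i => Polynomial.C (v i) + Polynomial.C (w i) * Polynomial.X) (fun i => by
      compute_degree)
  simpa using h

lemma eval_aeval_line {σ : Type*} (p : MvPolynomial σ ℝ) (v w : σ → ℝ) (t : ℝ) :
    (aeval (fun i => Polynomial.C (v i) + Polynomial.C (w i) * Polynomial.X) p).eval t =
      eval (fun i => v i + w i * t) p := by
  have h : (Polynomial.evalRingHom t).comp
      (aeval (fun i => Polynomial.C (v i) + Polynomial.C (w i) * Polynomial.X)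
        : MvPolynomial σ ℝ →ₐ[ℝ] Polynomial ℝ).toRingHom = eval (fun i => v i + w i * t) := by
    refine ringHom_ext (fun r => ?_) (fun i => ?_) <;> simp
  exact congrArg (fun φ => φ p) h

/-! ### The leading coefficient in `Z` -/

section Lead

variable {R : Type*} [CommRing R]

/-- The part of `coeffS3` that is linear in `Z`. -/
def leadS3 (b c h x y : R) : R :=
  -(c ^ 2 + h ^ 2) * (b * (b - x) - ((b - x) * (b - c) + y * h))

/-- The part of `coeffS2T` that is linear in `Z`. -/
def leadS2T (b c h x y : R) : R :=
  b ^ 2 * (c * (c - x) + h * (h - y)) +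
  (c ^ 2 + h ^ 2) * (2 * (b * (b - x)) + ((c - x) * (c - b) + (h - y) * h)) -
  ((b - c) ^ 2 + h ^ 2) * (c * (c - x) + h * (h - y))

/-- The part of `coeffST2` that is linear in `Z`. -/
def leadST2 (b c h x y : R) : R :=
  b ^ 2 * (-2 * (c * (c - x) + h * (h - y)) - ((b - x) * (b - c) + y * h)) -
  (c ^ 2 + h ^ 2) * (b * (b - x)) + ((b - c) ^ 2 + h ^ 2) * (b * (b - x))

/-- The part of `coeffT3` that is linear in `Z`. -/
def leadT3 (b c h x y : R) : R :=
  b ^ 2 * ((c * (c - x) + h * (h - y)) - ((c - x) * (c - b) + (h - y) * h))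

/-- The coefficient of `Z⁴` in the equation of the deltoidal surface. -/
def deltLead (b c h x y : R) : R :=
  cubicDisc (leadS3 b c h x y) (leadS2T b c h x y) (leadST2 b c h x y) (leadT3 b c h x y)

/-- Grouped by degree: irreducibility only uses the quartic part, a multiple of (x² + y²)², and the
cubic part. -/
lemma deltLead_eq (b c h x y : R) : deltLead b c h x y = b ^ 6 * h ^ 5 *
    (-4 * h * (x ^ 2 + y ^ 2) ^ 2 + ((24 * b * h - 32 * c * h) * x ^ 3 +
      (56 * c ^ 2 - 56 * b * c - 40 * h ^ 2) * x ^ 2 * y + (96 * c * h - 40 * b * h) * x * y ^ 2 +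
      (8 * b * c - 8 * c ^ 2 + 24 * h ^ 2) * y ^ 3)) + b ^ 6 * h ^ 2 * (
      (-44 * b ^ 2 * c ^ 2 * h ^ 2 - 48 * b ^ 2 * h ^ 4 + 88 * b * c ^ 3 * h ^ 2 + 88 * b *
        c * h ^ 4 - 44 * c ^ 4 * h ^ 2 - 40 * c ^ 2 * h ^ 4 + 4 * h ^ 6) * x ^ 2 +
      (8 * b ^ 2 * c * h ^ 3 + 88 * b * c ^ 2 * h ^ 3 + 88 * b * h ^ 5 - 96 * c ^ 3 * h ^ 3
        - 96 * c * h ^ 5) * x * y +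
      (4 * b ^ 2 * h ^ 4 - 48 * c ^ 2 * h ^ 4 - 48 * h ^ 6) * y ^ 2 +
      (32 * b ^ 3 * c ^ 2 * h ^ 2 + 32 * b ^ 3 * h ^ 4 - 40 * b ^ 2 * c ^ 3 * h ^ 2 - 40 * b
        ^ 2 * c * h ^ 4 - 16 * b * c ^ 4 * h ^ 2 - 32 * b * c ^ 2 * h ^ 4 - 16 * b * h ^ 6 +
        24 * c ^ 5 * h ^ 2 + 48 * c ^ 3 * h ^ 4 + 24 * c * h ^ 6) * x +
      (-8 * b ^ 3 * c ^ 3 * h - 8 * b ^ 3 * c * h ^ 3 + 24 * b ^ 2 * c ^ 4 * h + 8 * b ^ 2 *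
        c ^ 2 * h ^ 3 - 16 * b ^ 2 * h ^ 5 - 24 * b * c ^ 5 * h - 48 * b * c ^ 3 * h ^ 3 -
        24 * b * c * h ^ 5 + 8 * c ^ 6 * h + 48 * c ^ 4 * h ^ 3 + 72 * c ^ 2 * h ^ 5 + 32 *
        h ^ 7) * y +
      (4 * b ^ 4 * c ^ 4 + 4 * b ^ 4 * c ^ 2 * h ^ 2 - 16 * b ^ 3 * c ^ 5 - 32 * b ^ 3 * c ^
        3 * h ^ 2 - 16 * b ^ 3 * c * h ^ 4 + 24 * b ^ 2 * c ^ 6 + 64 * b ^ 2 * c ^ 4 * h ^ 2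
        + 56 * b ^ 2 * c ^ 2 * h ^ 4 + 16 * b ^ 2 * h ^ 6 - 16 * b * c ^ 7 - 48 * b * c ^ 5
        * h ^ 2 - 48 * b * c ^ 3 * h ^ 4 - 16 * b * c * h ^ 6 + 4 * c ^ 8 + 12 * c ^ 6 * h ^
        2 + 12 * c ^ 4 * h ^ 4 + 4 * c ^ 2 * h ^ 6)) := by
  simp only [deltLead, cubicDisc, leadS3, leadS2T, leadST2, leadT3]
  ring

lemma coeffS3_eq (b c h x y Z : R) :
    coeffS3 b c h x y Z = coeffS3 b c h x y 0 + leadS3 b c h x y * Z := by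
  simp only [coeffS3, leadS3]; ring

lemma coeffS2T_eq (b c h x y Z : R) :
    coeffS2T b c h x y Z = coeffS2T b c h x y 0 + leadS2T b c h x y * Z := by
  simp only [coeffS2T, leadS2T]; ring

lemma coeffST2_eq (b c h x y Z : R) :
    coeffST2 b c h x y Z = coeffST2 b c h x y 0 + leadST2 b c h x y * Z := by
  simp only [coeffST2, leadST2]; ring

lemma coeffT3_eq (b c h x y Z : R) :
    coeffT3 b c h x y Z = coeffT3 b c h x y 0 + leadT3 b c h x y * Z := by
  simp only [coeffT3, leadT3]; ring

variable {S F : Type*} [CommRing S] [FunLike F R S] [RingHomClass F R S] (φ : F)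

lemma map_deltLead (b c h x y : R) :
    φ (deltLead b c h x y) = deltLead (φ b) (φ c) (φ h) (φ x) (φ y) := by
  simp [deltLead, map_cubicDisc, leadS3, leadS2T, leadST2, leadT3, map_ofNat]

end Lead

/-! ### Irreducibility of the leading coefficient -/

/-- The discriminant is homogeneous of degree four in the coefficients of the cubic. -/
lemma totalDegree_cubicDisc_le {σ : Type*} {n : ℕ} {p q r s : MvPolynomial σ ℝ}
    (hp : p.totalDegree ≤ n) (hq : q.totalDegree ≤ n) (hr : r.totalDegree ≤ n)
    (hs : s.totalDegree ≤ n) : (cubicDisc p q r s).totalDegree ≤ 4 * n := by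
  have key : ∀ {p q r s : MvPolynomial σ ℝ}, p.totalDegree ≤ n → q.totalDegree ≤ n →
      r.totalDegree ≤ n → s.totalDegree ≤ n → p * q * r * s ∈ restrictTotalDegree σ ℝ (4 * n) := by
    intro p q r s hp hq hr hs
    rw [mem_restrictTotalDegree]
    have h1 := totalDegree_mul (p * q * r) s
    have h2 := totalDegree_mul (p * q) r
    have h3 := totalDegree_mul p q
    omega
  have hk : ∀ k : ℝ, (C k : MvPolynomial σ ℝ) = k • 1 := fun k => by rw [C_eq_smul_one]
  have h : cubicDisc p q r s = q * q * r * r + (-4 : ℝ) • (p * r * r * r) +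
      (-4 : ℝ) • (q * q * q * s) + (-27 : ℝ) • (p * p * s * s) + (18 : ℝ) • (p * q * r * s) := by
    simp only [cubicDisc, smul_eq_C_mul, C_neg, map_ofNat]
    ring
  rw [← mem_restrictTotalDegree, h]
  exact add_mem (add_mem (add_mem (add_mem (key hq hq hr hr)
    (Submodule.smul_mem _ _ (key hp hr hr hr))) (Submodule.smul_mem _ _ (key hq hq hq hs)))
    (Submodule.smul_mem _ _ (key hp hp hs hs))) (Submodule.smul_mem _ _ (key hp hq hr hs))

lemma totalDegree_affine_le {σ : Type*} (u v w : ℝ) (i j : σ) :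
    (C u + C v * X i + C w * X j : MvPolynomial σ ℝ).totalDegree ≤ 1 := by
  refine (totalDegree_add _ _).trans (max_le ((totalDegree_add _ _).trans (max_le (by simp) ?_)) ?_)
  all_goals
    refine (totalDegree_mul _ _).trans ?_
    simp [totalDegree_X]

lemma totalDegree_deltLead_le (b c h : ℝ) :
    (deltLead (C b) (C c) (C h) (X 0) (X 1) : MvPolynomial (Fin 2) ℝ).totalDegree ≤ 4 := by
  refine totalDegree_cubicDisc_le (n := 1) ?_ ?_ ?_ ?_
  · convert totalDegree_affine_le (leadS3 b c h 0 0) (leadS3 b c h 1 0 - leadS3 b c h 0 0)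
      (leadS3 b c h 0 1 - leadS3 b c h 0 0) (0 : Fin 2) 1 using 2
    simp only [leadS3, C_add, C_sub, C_mul, C_neg, C_pow, C_0, C_1]; ring
  · convert totalDegree_affine_le (leadS2T b c h 0 0) (leadS2T b c h 1 0 - leadS2T b c h 0 0)
      (leadS2T b c h 0 1 - leadS2T b c h 0 0) (0 : Fin 2) 1 using 2
    simp only [leadS2T, C_add, C_sub, C_mul, C_pow, C_0, C_1, map_ofNat]; ring
  · convert totalDegree_affine_le (leadST2 b c h 0 0) (leadST2 b c h 1 0 - leadST2 b c h 0 0)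
      (leadST2 b c h 0 1 - leadST2 b c h 0 0) (0 : Fin 2) 1 using 2
    simp only [leadST2, C_add, C_sub, C_mul, C_neg, C_pow, C_0, C_1, map_ofNat]; ring
  · convert totalDegree_affine_le (leadT3 b c h 0 0) (leadT3 b c h 1 0 - leadT3 b c h 0 0)
      (leadT3 b c h 0 1 - leadT3 b c h 0 0) (0 : Fin 2) 1 using 2
    simp only [leadT3, C_add, C_sub, C_mul, C_pow, C_0, C_1]; ring

/-- The product of two quadratic polynomials is not the leading coefficient. -/
lemma not_quadratic_mul_quadratic_eq_deltLead {b c h : ℝ} (hb : 0 < b) (hh : 0 < h)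
    {a₁ b₁ c₁ d₁ e₁ f₁ a₂ b₂ c₂ d₂ e₂ f₂ : ℝ}
    (H : ∀ x y : ℝ, (a₁ * x ^ 2 + b₁ * x * y + c₁ * y ^ 2 + d₁ * x + e₁ * y + f₁) *
      (a₂ * x ^ 2 + b₂ * x * y + c₂ * y ^ 2 + d₂ * x + e₂ * y + f₂) = deltLead b c h x y) :
    False := by
  simp only [deltLead_eq] at H
  obtain ⟨K, hK⟩ : ∃ K, K = b ^ 6 * h ^ 5 := ⟨_, rfl⟩
  have hKpos : 0 < K := by rw [hK]; positivity
  rw [← hK] at H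
  generalize b ^ 6 * h ^ 2 = K' at H
  -- The quartic and the cubic homogeneous parts are isolated by the values at 0 and at ±1, ±2 times
  -- (x, y).
  have H4 : ∀ x y : ℝ, (a₁ * x ^ 2 + b₁ * x * y + c₁ * y ^ 2) *
      (a₂ * x ^ 2 + b₂ * x * y + c₂ * y ^ 2) + 4 * h * K * (x ^ 2 + y ^ 2) ^ 2 = 0 ∧
      (a₁ * x ^ 2 + b₁ * x * y + c₁ * y ^ 2) * (d₂ * x + e₂ * y) +
      (a₂ * x ^ 2 + b₂ * x * y + c₂ * y ^ 2) * (d₁ * x + e₁ * y) -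
      K * ((24 * b * h - 32 * c * h) * x ^ 3 +
      (56 * c ^ 2 - 56 * b * c - 40 * h ^ 2) * x ^ 2 * y + (96 * c * h - 40 * b * h) * x * y ^ 2 +
      (8 * b * c - 8 * c ^ 2 + 24 * h ^ 2) * y ^ 3) = 0 := by
    intro x y
    have h1 := H x y
    have h2 := H (-x) (-y)
    have h3 := H (2 * x) (2 * y)
    have h4 := H (-(2 * x)) (-(2 * y))
    have h0 := H 0 0
    constructor
    · linear_combination (h3 + h4 - 4 * h1 - 4 * h2 + 6 * h0) / 24
    · linear_combination (h3 - h4 - 2 * h1 + 2 * h2) / 12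
  have T := quartic_coeffs_eq_zero (a₀ := c₁ * c₂ + 4 * h * K) (a₁ := b₁ * c₂ + c₁ * b₂)
    (a₂ := a₁ * c₂ + b₁ * b₂ + c₁ * a₂ + 8 * h * K) (a₃ := a₁ * b₂ + b₁ * a₂)
    (a₄ := a₁ * a₂ + 4 * h * K) (fun t => by linear_combination (H4 t 1).1)
  obtain ⟨t0, t1, t2, t3, t4⟩ := T
  have S := quartic_coeffs_eq_zero (a₀ := c₁ * e₂ + c₂ * e₁ - K * (8 * b * c - 8 * c ^ 2 + 24 * h ^ 2))
    (a₁ := b₁ * e₂ + c₁ * d₂ + b₂ * e₁ + c₂ * d₁ - K * (96 * c * h - 40 * b * h))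
    (a₂ := a₁ * e₂ + b₁ * d₂ + a₂ * e₁ + b₂ * d₁ - K * (56 * c ^ 2 - 56 * b * c - 40 * h ^ 2))
    (a₃ := a₁ * d₂ + a₂ * d₁ - K * (24 * b * h - 32 * c * h))
    (a₄ := 0) (fun t => by linear_combination (H4 t 1).2)
  obtain ⟨s0, s1, s2, s3, -⟩ := S
  have hN : 0 < 4 * h * K := by positivity
  have ha1 : a₁ ≠ 0 := by rintro rfl; linarith
  -- Over ℝ, the only splitting of a multiple of (x² + y²)² into two quadratic forms is into
  -- multiples of x² + y².
  have hb1 : b₁ = 0 := by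
    by_contra hb1
    have e1 : b₂ * a₁ = -(b₁ * a₂) := by linear_combination t3
    have e2 : a₁ * c₂ = a₂ * c₁ := by
      refine mul_left_cancel₀ hb1 ?_
      linear_combination a₁ * t1 - c₁ * e1
    have e3 : (a₁ * c₂) ^ 2 = (4 * h * K) ^ 2 := by
      linear_combination (c₂ * a₁) * e2 + (c₁ * c₂ - 4 * h * K) * t4 + 4 * h * K * t4 +
        (- 4 * h * K) * t0
    have e4 : a₁ ^ 2 * (2 * (a₁ * c₂) + 8 * h * K) = -(4 * h * K) * b₁ ^ 2 := by
      linear_combination a₁ ^ 2 * t2 + a₁ ^ 2 * e2 - b₁ * a₁ * e1 + b₁ ^ 2 * t4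
    have e5 : 0 < b₁ ^ 2 := by positivity
    have e6 : 0 < a₁ ^ 2 := by positivity
    have e7 : 2 * (a₁ * c₂) + 8 * h * K < 0 := by
      by_contra! hcon
      have := mul_nonneg e6.le hcon
      nlinarith [mul_pos hN e5]
    nlinarith [sq_nonneg (a₁ * c₂)]
  rw [hb1] at t1 t2 t3 s1 s2
  have hb2 : b₂ = 0 := by
    have : a₁ * b₂ = 0 := by linear_combination t3
    exact (mul_eq_zero.1 this).resolve_left ha1
  rw [hb2] at t1 t2 t3 s1 s2
  have e1 : a₁ * c₂ = -(4 * h * K) := by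
    have : (a₁ * c₂ - c₁ * a₂) ^ 2 = 0 := by
      linear_combination (a₁ * c₂ + c₁ * a₂ - 8 * h * K) * t2 - 4 * c₁ * c₂ * t4 + 16 * h * K * t0
    have := pow_eq_zero_iff (two_ne_zero) |>.1 this
    linarith
  have e2 : c₂ = a₂ := mul_left_cancel₀ ha1 (by linarith)
  have e3 : c₁ = a₁ := by
    have ha2 : a₂ ≠ 0 := by rintro rfl; linarith
    refine mul_right_cancel₀ ha2 ?_
    rw [e2] at t0
    linarith
  rw [e2, e3] at s0 s1
  -- The cubic part must now be divisible by x² + y²: the coefficients of xy² and x³ agree, and so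
  -- do those of y³ and x²y. The two conditions together give c² + h² = 0.
  have k1 : K * h * (64 * (b - 2 * c)) = 0 := by linear_combination s1 - s3
  have k2 : K * (64 * (c ^ 2 - b * c - h ^ 2)) = 0 := by linear_combination s0 - s2
  have k3 : b = 2 * c := by
    have := (mul_eq_zero.1 k1).resolve_left (by positivity)
    linarith
  have k4 : c ^ 2 - b * c - h ^ 2 = 0 := by
    have := (mul_eq_zero.1 k2).resolve_left (by positivity)
    linarith
  rw [k3] at k4
  nlinarith [sq_nonneg c, pow_pos hh 2]

/-- A nonconstant linear factor does not divide the leading coefficient. -/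
lemma eq_zero_of_linear_mul_eq_deltLead {b c h : ℝ} (hb : 0 < b) (hh : 0 < h) {d e f : ℝ}
    {q : MvPolynomial (Fin 2) ℝ} (hq : q.totalDegree ≤ 3)
    (H : ∀ x y : ℝ, (d * x + e * y + f) * eval ![x, y] q = deltLead b c h x y) :
    d = 0 ∧ e = 0 := by
  by_contra hde
  have hpos : 0 < e ^ 2 + d ^ 2 := by
    rcases not_and_or.1 hde with h1 | h1 <;> positivity
  -- On the line through the origin in direction (e, -d) the linear factor is constant, so the
  -- product has degree at most three there, whereas the quartic part of `deltLead` does not vanish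
  -- in any real direction.
  set Q := aeval (fun i => Polynomial.C (![0, 0] i) + Polynomial.C (![e, -d] i) * Polynomial.X) q
    with hQ
  have hdeg : Q.natDegree ≤ 3 := (natDegree_aeval_line_le q _ _).trans hq
  have hev : ∀ t, f * Q.eval t = deltLead b c h (e * t) (-d * t) := fun t => by
    rw [← H, hQ, eval_aeval_line]
    have : (fun i => ![0, 0] i + ![e, -d] i * t) = ![e * t, -d * t] := by
      ext i; fin_cases i <;> simp
    rw [this]; ring
  simp only [Polynomial.eval_eq_sum_range' (Nat.lt_succ_of_le hdeg), Finset.sum_range_succ,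
    Finset.sum_range_zero, deltLead_eq] at hev
  have h1 := hev 1
  have h2 := hev (-1)
  have h3 := hev 2
  have h4 := hev (-2)
  have h0 := hev 0
  have : b ^ 6 * h ^ 5 * (4 * h) * (e ^ 2 + d ^ 2) ^ 2 = 0 := by
    linear_combination (h3 + h4 - 4 * h1 - 4 * h2 + 6 * h0) / 24
  have : 0 < b ^ 6 * h ^ 5 * (4 * h) * (e ^ 2 + d ^ 2) ^ 2 := by positivity
  linarith

/-- In degree at most four, the smaller factor is constant, linear, or one of two at most quadratic
factors; the last two cases are excluded by the preceding lemmas, except for constants. -/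
lemma irreducible_deltLead {b c h : ℝ} (hb : 0 < b) (hh : 0 < h) :
    Irreducible (deltLead (C b) (C c) (C h) (X 0) (X 1) : MvPolynomial (Fin 2) ℝ) := by
  have hev : ∀ x y : ℝ, eval ![x, y] (deltLead (C b) (C c) (C h) (X 0) (X 1) :
      MvPolynomial (Fin 2) ℝ) = deltLead b c h x y := fun x y => by
    rw [map_deltLead]; simp
  have hzero : (deltLead (C b) (C c) (C h) (X 0) (X 1) : MvPolynomial (Fin 2) ℝ) ≠ 0 := fun h0 => by
    refine not_quadratic_mul_quadratic_eq_deltLead (c := c) hb hh (a₁ := 0) (b₁ := 0) (c₁ := 0)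
      (d₁ := 0) (e₁ := 0) (f₁ := 0) (a₂ := 0) (b₂ := 0) (c₂ := 0) (d₂ := 0) (e₂ := 0) (f₂ := 0)
      fun x y => ?_
    rw [← hev, h0]; simp
  have small : ∀ p q : MvPolynomial (Fin 2) ℝ, p * q = deltLead (C b) (C c) (C h) (X 0) (X 1) →
      p.totalDegree ≤ q.totalDegree → IsUnit p := by
    intro p q hpq hle
    have hp0 : p ≠ 0 := by rintro rfl; simp at hpq; exact hzero hpq.symm
    have hq0 : q ≠ 0 := by rintro rfl; simp at hpq; exact hzero hpq.symm
    have hdeg : p.totalDegree + q.totalDegree ≤ 4 := by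
      rw [← totalDegree_mul_of_isDomain hp0 hq0, hpq]
      exact totalDegree_deltLead_le b c h
    have hH : ∀ x y, eval ![x, y] p * eval ![x, y] q = deltLead b c h x y := fun x y => by
      rw [← map_mul, hpq, hev]
    have hcases : p.totalDegree = 0 ∨ p.totalDegree = 1 ∨
        (p.totalDegree ≤ 2 ∧ q.totalDegree ≤ 2) := by omega
    have hconst : ∀ k : ℝ, (∀ x y, eval ![x, y] p = k) → IsUnit p := by
      intro k hk
      have hpk : p = C k := by
        refine funext fun v => ?_
        have : v = ![v 0, v 1] := by ext i; fin_cases i <;> rfl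
        rw [this, hk, eval_C]
      rw [hpk] at hp0 ⊢
      exact (IsUnit.mk0 k (by rintro rfl; simp at hp0)).map C
    rcases hcases with h0 | h1 | ⟨h2, h3⟩
    · rw [totalDegree_eq_zero_iff_eq_C] at h0
      exact hconst (coeff 0 p) fun x y => by rw [h0]; simp
    · obtain ⟨d, e, f, hp⟩ := exists_eval_eq_linear h1.le
      obtain ⟨rfl, rfl⟩ := eq_zero_of_linear_mul_eq_deltLead (q := q) hb hh (by omega)
        fun x y => by rw [← hp, hH x y]
      exact hconst f fun x y => by rw [hp]; ring
    · obtain ⟨a₁, b₁, c₁, d₁, e₁, f₁, hp⟩ := exists_eval_eq_quadratic h2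
      obtain ⟨a₂, b₂, c₂, d₂, e₂, f₂, hq⟩ := exists_eval_eq_quadratic h3
      simp only [hp, hq] at hH
      exact (not_quadratic_mul_quadratic_eq_deltLead hb hh hH).elim
  refine ⟨fun hu => ?_, fun p q hpq => ?_⟩
  · obtain ⟨k, -, hk⟩ := (MvPolynomial.isUnit_iff_eq_C_of_isReduced).1 hu
    refine not_quadratic_mul_quadratic_eq_deltLead (c := c) hb hh (a₁ := 0) (b₁ := 0) (c₁ := 0)
      (d₁ := 0) (e₁ := 0) (f₁ := 1) (a₂ := 0) (b₂ := 0) (c₂ := 0) (d₂ := 0) (e₂ := 0) (f₂ := k)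
      fun x y => ?_
    rw [← hev, hk, eval_C]; ring
  · rcases le_total p.totalDegree q.totalDegree with hle | hle
    · exact Or.inl (small p q hpq.symm hle)
    · exact Or.inr (small q p (by rw [mul_comm, hpq]) hle)

/-! ### Discriminants of cubics with affine coefficients -/

section Affine

variable {R : Type*} [CommRing R]

/-- Homogeneity again: the top coefficient of the discriminant is the discriminant of the top
coefficients, which may be zero. -/
lemma natDegree_cubicDisc_le {n : ℕ} {p q r s : Polynomial R} (hp : p.natDegree ≤ n)
    (hq : q.natDegree ≤ n) (hr : r.natDegree ≤ n) (hs : s.natDegree ≤ n) :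
    (cubicDisc p q r s).natDegree ≤ 4 * n ∧ (cubicDisc p q r s).coeff (4 * n) =
      cubicDisc (p.coeff n) (q.coeff n) (r.coeff n) (s.coeff n) := by
  have key : ∀ {p q r s : Polynomial R}, p.natDegree ≤ n → q.natDegree ≤ n →
      r.natDegree ≤ n → s.natDegree ≤ n → (p * q * r * s).natDegree ≤ 4 * n ∧
      (p * q * r * s).coeff (4 * n) = p.coeff n * q.coeff n * r.coeff n * s.coeff n := by
    intro p q r s hp hq hr hs
    have h2 : (p * q).natDegree ≤ n + n := Polynomial.natDegree_mul_le_of_le hp hq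
    have h3 : (p * q * r).natDegree ≤ n + n + n := Polynomial.natDegree_mul_le_of_le h2 hr
    have h4 : (p * q * r * s).natDegree ≤ n + n + n + n := Polynomial.natDegree_mul_le_of_le h3 hs
    have e : 4 * n = n + n + n + n := by ring
    rw [e]
    exact ⟨h4, by rw [Polynomial.coeff_mul_add_eq_of_natDegree_le h3 hs,
      Polynomial.coeff_mul_add_eq_of_natDegree_le h2 hr,
      Polynomial.coeff_mul_add_eq_of_natDegree_le hp hq]⟩
  have h : cubicDisc p q r s = q * q * r * r + (Polynomial.C (-4) * (p * r * r * r) +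
      Polynomial.C (-4) * (q * q * q * s) + Polynomial.C (-27) * (p * p * s * s) +
      Polynomial.C 18 * (p * q * r * s)) := by
    simp only [cubicDisc, Polynomial.C_neg, map_ofNat]
    ring
  obtain ⟨d1, c1⟩ := key hq hq hr hr
  obtain ⟨d2, c2⟩ := key hp hr hr hr
  obtain ⟨d3, c3⟩ := key hq hq hq hs
  obtain ⟨d4, c4⟩ := key hp hp hs hs
  obtain ⟨d5, c5⟩ := key hp hq hr hs
  have hC : ∀ (a : R) {u : Polynomial R}, u.natDegree ≤ 4 * n →
      (Polynomial.C a * u).natDegree ≤ 4 * n := fun a u hu =>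
    (Polynomial.natDegree_C_mul_le a u).trans hu
  rw [h]
  refine ⟨?_, ?_⟩
  · exact Polynomial.natDegree_add_le_of_degree_le d1 (Polynomial.natDegree_add_le_of_degree_le
      (Polynomial.natDegree_add_le_of_degree_le (Polynomial.natDegree_add_le_of_degree_le
      (hC _ d2) (hC _ d3)) (hC _ d4)) (hC _ d5))
  · simp only [Polynomial.coeff_add, Polynomial.coeff_C_mul, c1, c2, c3, c4, c5, cubicDisc]
    ring

lemma natDegree_C_add_C_mul_X_le (u v : R) :
    (Polynomial.C u + Polynomial.C v * Polynomial.X).natDegree ≤ 1 := by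
  compute_degree

/-- The coefficients of the cubic are affine along the altitude through `A` if `Z` is chosen so
that the distance to the foot is fixed. -/
lemma natDegree_delt_altitudeA_le (b c h W : R) :
    (delt (Polynomial.C b) (Polynomial.C c) (Polynomial.C h) (Polynomial.C h * Polynomial.X)
      (Polynomial.C (b - c) * Polynomial.X)
      (Polynomial.C W - Polynomial.C (h ^ 2 + (b - c) ^ 2) * Polynomial.X ^ 2 +
        Polynomial.C (2 * b * h) * Polynomial.X)).natDegree ≤ 4 := by
  refine (natDegree_cubicDisc_le (n := 1) ?_ ?_ ?_ ?_).1
  · convert natDegree_C_add_C_mul_X_le (coeffS3 b c h 0 0 W)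
      (coeffS3 b c h h (b - c) (W - (h ^ 2 + (b - c) ^ 2) + 2 * b * h) - coeffS3 b c h 0 0 W) using 2
    simp only [map_add, map_sub, map_mul, map_pow, map_ofNat, map_neg, map_zero, coeffS3]
    ring
  · convert natDegree_C_add_C_mul_X_le (coeffS2T b c h 0 0 W)
      (coeffS2T b c h h (b - c) (W - (h ^ 2 + (b - c) ^ 2) + 2 * b * h) - coeffS2T b c h 0 0 W)
      using 2
    simp only [map_add, map_sub, map_mul, map_pow, map_ofNat, map_zero, coeffS2T]
    ring
  · convert natDegree_C_add_C_mul_X_le (coeffST2 b c h 0 0 W)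
      (coeffST2 b c h h (b - c) (W - (h ^ 2 + (b - c) ^ 2) + 2 * b * h) - coeffST2 b c h 0 0 W)
      using 2
    simp only [map_add, map_sub, map_mul, map_pow, map_ofNat, map_neg, map_zero, coeffST2]
    ring
  · convert natDegree_C_add_C_mul_X_le (coeffT3 b c h 0 0 W)
      (coeffT3 b c h h (b - c) (W - (h ^ 2 + (b - c) ^ 2) + 2 * b * h) - coeffT3 b c h 0 0 W) using 2
    simp only [map_add, map_sub, map_mul, map_pow, map_ofNat, map_zero, coeffT3]
    ring

/-- The analogue of `natDegree_delt_altitudeA_le` for the altitude through `B`. -/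
lemma natDegree_delt_altitudeB_le {b c h m e W : R} (hm : m = -c) (he : e = -2 * b * h) :
    (delt (Polynomial.C b) (Polynomial.C c) (Polynomial.C h)
      (Polynomial.C b + Polynomial.C h * Polynomial.X) (Polynomial.C m * Polynomial.X)
      (Polynomial.C W - Polynomial.C (h ^ 2 + c ^ 2) * Polynomial.X ^ 2 +
        Polynomial.C e * Polynomial.X)).natDegree ≤ 4 := by
  subst hm he
  refine (natDegree_cubicDisc_le (n := 1) ?_ ?_ ?_ ?_).1
  · convert natDegree_C_add_C_mul_X_le (coeffS3 b c h b 0 W)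
      (coeffS3 b c h (b + h) (-c) (W - (h ^ 2 + c ^ 2) - 2 * b * h) - coeffS3 b c h b 0 W) using 2
    simp only [map_add, map_sub, map_mul, map_pow, map_ofNat, map_neg, map_zero, coeffS3]
    ring
  · convert natDegree_C_add_C_mul_X_le (coeffS2T b c h b 0 W)
      (coeffS2T b c h (b + h) (-c) (W - (h ^ 2 + c ^ 2) - 2 * b * h) - coeffS2T b c h b 0 W) using 2
    simp only [map_add, map_sub, map_mul, map_pow, map_ofNat, map_neg, map_zero, coeffS2T]
    ring
  · convert natDegree_C_add_C_mul_X_le (coeffST2 b c h b 0 W)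
      (coeffST2 b c h (b + h) (-c) (W - (h ^ 2 + c ^ 2) - 2 * b * h) - coeffST2 b c h b 0 W) using 2
    simp only [map_add, map_sub, map_mul, map_pow, map_ofNat, map_neg, map_zero, coeffST2]
    ring
  · convert natDegree_C_add_C_mul_X_le (coeffT3 b c h b 0 W)
      (coeffT3 b c h (b + h) (-c) (W - (h ^ 2 + c ^ 2) - 2 * b * h) - coeffT3 b c h b 0 W) using 2
    simp only [map_add, map_sub, map_mul, map_pow, map_ofNat, map_neg, map_zero, coeffT3]
    ring

/-- The analogue of `natDegree_delt_altitudeA_le` for the altitude through `C`. -/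
lemma natDegree_delt_altitudeC_le (b c h W : R) :
    (delt (Polynomial.C b) (Polynomial.C c) (Polynomial.C h) (Polynomial.C c) Polynomial.X
      (Polynomial.C W - Polynomial.X ^ 2)).natDegree ≤ 4 := by
  refine (natDegree_cubicDisc_le (n := 1) ?_ ?_ ?_ ?_).1
  · convert natDegree_C_add_C_mul_X_le (coeffS3 b c h c 0 W)
      (coeffS3 b c h c 1 (W - 1) - coeffS3 b c h c 0 W) using 2
    simp only [map_add, map_sub, map_mul, map_pow, map_ofNat, map_neg, map_zero, map_one, coeffS3]
    ring
  · convert natDegree_C_add_C_mul_X_le (coeffS2T b c h c 0 W)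
      (coeffS2T b c h c 1 (W - 1) - coeffS2T b c h c 0 W) using 2
    simp only [map_add, map_sub, map_mul, map_pow, map_ofNat, map_zero, map_one, coeffS2T]
    ring
  · convert natDegree_C_add_C_mul_X_le (coeffST2 b c h c 0 W)
      (coeffST2 b c h c 1 (W - 1) - coeffST2 b c h c 0 W) using 2
    simp only [map_add, map_sub, map_mul, map_pow, map_ofNat, map_neg, map_zero, map_one, coeffST2]
    ring
  · convert natDegree_C_add_C_mul_X_le (coeffT3 b c h c 0 W)
      (coeffT3 b c h c 1 (W - 1) - coeffT3 b c h c 0 W) using 2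
    simp only [map_add, map_sub, map_mul, map_pow, map_ofNat, map_zero, map_one, coeffT3]
    ring

/-- The second coefficient of a Taylor shift. -/
lemma coeff_taylor_of_natDegree_eq_succ {n : ℕ} {p : Polynomial R} (hp : p.natDegree = n + 1)
    (r : R) : (Polynomial.taylor r p).coeff n = p.coeff n + (n + 1) * r * p.coeff (n + 1) := by
  rw [Polynomial.taylor_coeff]
  have hd : (Polynomial.hasseDeriv n p).natDegree ≤ 1 :=
    (Polynomial.natDegree_hasseDeriv_le p n).trans (by omega)
  rw [Polynomial.eval_eq_sum_range' (Nat.lt_succ_of_le hd)]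
  simp only [Finset.sum_range_succ, Finset.sum_range_zero, Polynomial.hasseDeriv_coeff, zero_add,
    Nat.choose_self, add_comm 1 n, Nat.choose_succ_self_right]
  push_cast
  ring

open Polynomial.Bivariate in
lemma coeff_coeff_swap (F : Polynomial (Polynomial R)) (i j : ℕ) :
    ((swap F).coeff i).coeff j = (F.coeff j).coeff i := by
  induction F using Polynomial.induction_on' with
  | add p q hp hq => simp [hp, hq]
  | monomial n p =>
    induction p using Polynomial.induction_on' with
    | add p q hp hq => simp only [map_add, Polynomial.coeff_add, hp, hq]
    | monomial m r =>
      rw [swap_monomial_monomial]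
      simp only [Polynomial.coeff_monomial]
      split_ifs <;> simp_all [Polynomial.coeff_monomial]

end Affine

/-! ### Irreducibility of the equation in `ℝ[x, y][Z]` -/

lemma natDegree_delt_le {R : Type*} [CommRing R] (b c h x y : R) :
    (delt (Polynomial.C b) (Polynomial.C c) (Polynomial.C h) (Polynomial.C x) (Polynomial.C y)
      Polynomial.X).natDegree ≤ 4 ∧
    (delt (Polynomial.C b) (Polynomial.C c) (Polynomial.C h) (Polynomial.C x) (Polynomial.C y)
      Polynomial.X).coeff 4 = deltLead b c h x y := by
  have hk : ∀ {p : Polynomial R} (u v : R),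
      p = Polynomial.C u + Polynomial.C v * Polynomial.X → p.natDegree ≤ 1 ∧ p.coeff 1 = v := by
    rintro p u v rfl
    exact ⟨natDegree_C_add_C_mul_X_le u v, by simp⟩
  obtain ⟨d0, e0⟩ := hk (p := coeffS3 (Polynomial.C b) (Polynomial.C c) (Polynomial.C h)
    (Polynomial.C x) (Polynomial.C y) Polynomial.X) (coeffS3 b c h x y 0) (leadS3 b c h x y) (by
      rw [coeffS3_eq, map_coeffS3, map_zero]; simp [leadS3])
  obtain ⟨d1, e1⟩ := hk (p := coeffS2T (Polynomial.C b) (Polynomial.C c) (Polynomial.C h)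
    (Polynomial.C x) (Polynomial.C y) Polynomial.X) (coeffS2T b c h x y 0) (leadS2T b c h x y) (by
      rw [coeffS2T_eq, map_coeffS2T, map_zero]; simp [leadS2T, map_ofNat])
  obtain ⟨d2, e2⟩ := hk (p := coeffST2 (Polynomial.C b) (Polynomial.C c) (Polynomial.C h)
    (Polynomial.C x) (Polynomial.C y) Polynomial.X) (coeffST2 b c h x y 0) (leadST2 b c h x y) (by
      rw [coeffST2_eq, map_coeffST2, map_zero]; simp [leadST2, map_ofNat])
  obtain ⟨d3, e3⟩ := hk (p := coeffT3 (Polynomial.C b) (Polynomial.C c) (Polynomial.C h)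
    (Polynomial.C x) (Polynomial.C y) Polynomial.X) (coeffT3 b c h x y 0) (leadT3 b c h x y) (by
      rw [coeffT3_eq, map_coeffT3, map_zero]; simp [leadT3])
  obtain ⟨h1, h2⟩ := natDegree_cubicDisc_le d0 d1 d2 d3
  rw [e0, e1, e2, e3] at h2
  exact ⟨h1, h2⟩

/-- The equation of the deltoidal surface as a polynomial in `Z = z²`. -/
def deltPoly (b c h : ℝ) : Polynomial (MvPolynomial (Fin 2) ℝ) :=
  delt (Polynomial.C (C b)) (Polynomial.C (C c)) (Polynomial.C (C h)) (Polynomial.C (X 0))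
    (Polynomial.C (X 1)) Polynomial.X

lemma natDegree_deltPoly_le (b c h : ℝ) : (deltPoly b c h).natDegree ≤ 4 ∧
    (deltPoly b c h).coeff 4 = deltLead (C b) (C c) (C h) (X 0) (X 1) :=
  natDegree_delt_le _ _ _ _ _

/-- The substitution of a point of a line for `(x, y)`. -/
def onLine (v w : Fin 2 → ℝ) : MvPolynomial (Fin 2) ℝ →+* Polynomial ℝ :=
  (aeval (fun i => Polynomial.C (v i) + Polynomial.C (w i) * Polynomial.X) :
    MvPolynomial (Fin 2) ℝ →ₐ[ℝ] Polynomial ℝ).toRingHom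

lemma onLine_C (v w : Fin 2 → ℝ) (r : ℝ) : onLine v w (C r) = Polynomial.C r := by
  simp [onLine]

lemma onLine_X (v w : Fin 2 → ℝ) (i : Fin 2) :
    onLine v w (X i) = Polynomial.C (v i) + Polynomial.C (w i) * Polynomial.X := by
  simp [onLine]

/-- The quartic part is a multiple of (x² + y²)², so the restriction to every real line keeps degree
exactly four. -/
lemma coeff_onLine_deltLead (b c h : ℝ) (v w : Fin 2 → ℝ) :
    (onLine v w (deltLead (C b) (C c) (C h) (X 0) (X 1))).coeff 4 =
      -4 * b ^ 6 * h ^ 6 * (w 0 ^ 2 + w 1 ^ 2) ^ 2 := by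
  rw [map_deltLead, onLine_C, onLine_C, onLine_C, onLine_X, onLine_X]
  obtain ⟨-, h2⟩ := natDegree_cubicDisc_le (n := 1)
    (p := leadS3 (Polynomial.C b) (Polynomial.C c) (Polynomial.C h)
      (Polynomial.C (v 0) + Polynomial.C (w 0) * Polynomial.X)
      (Polynomial.C (v 1) + Polynomial.C (w 1) * Polynomial.X))
    (q := leadS2T (Polynomial.C b) (Polynomial.C c) (Polynomial.C h)
      (Polynomial.C (v 0) + Polynomial.C (w 0) * Polynomial.X)
      (Polynomial.C (v 1) + Polynomial.C (w 1) * Polynomial.X))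
    (r := leadST2 (Polynomial.C b) (Polynomial.C c) (Polynomial.C h)
      (Polynomial.C (v 0) + Polynomial.C (w 0) * Polynomial.X)
      (Polynomial.C (v 1) + Polynomial.C (w 1) * Polynomial.X))
    (s := leadT3 (Polynomial.C b) (Polynomial.C c) (Polynomial.C h)
      (Polynomial.C (v 0) + Polynomial.C (w 0) * Polynomial.X)
      (Polynomial.C (v 1) + Polynomial.C (w 1) * Polynomial.X))
    (by convert natDegree_C_add_C_mul_X_le (leadS3 b c h (v 0) (v 1))
          (leadS3 b c h (v 0 + w 0) (v 1 + w 1) - leadS3 b c h (v 0) (v 1)) using 2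
        simp only [map_add, map_sub, map_mul, map_pow, map_neg, leadS3]; ring)
    (by convert natDegree_C_add_C_mul_X_le (leadS2T b c h (v 0) (v 1))
          (leadS2T b c h (v 0 + w 0) (v 1 + w 1) - leadS2T b c h (v 0) (v 1)) using 2
        simp only [map_add, map_sub, map_mul, map_pow, map_ofNat, leadS2T]; ring)
    (by convert natDegree_C_add_C_mul_X_le (leadST2 b c h (v 0) (v 1))
          (leadST2 b c h (v 0 + w 0) (v 1 + w 1) - leadST2 b c h (v 0) (v 1)) using 2
        simp only [map_add, map_sub, map_mul, map_pow, map_ofNat, map_neg, leadST2]; ring)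
    (by convert natDegree_C_add_C_mul_X_le (leadT3 b c h (v 0) (v 1))
          (leadT3 b c h (v 0 + w 0) (v 1 + w 1) - leadT3 b c h (v 0) (v 1)) using 2
        simp only [map_add, map_sub, map_mul, map_pow, leadT3]; ring)
  refine h2.trans ?_
  have h4 : ∀ (p : Polynomial ℝ) (u v : ℝ), p = Polynomial.C u + Polynomial.C v * Polynomial.X →
      p.coeff 1 = v := by
    rintro p u v rfl
    simp
  rw [h4 _ (leadS3 b c h (v 0) (v 1))
      (leadS3 b c h (v 0 + w 0) (v 1 + w 1) - leadS3 b c h (v 0) (v 1)) (by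
        simp only [map_add, map_sub, map_mul, map_pow, map_neg, leadS3]; ring),
    h4 _ (leadS2T b c h (v 0) (v 1))
      (leadS2T b c h (v 0 + w 0) (v 1 + w 1) - leadS2T b c h (v 0) (v 1)) (by
        simp only [map_add, map_sub, map_mul, map_pow, map_ofNat, leadS2T]; ring),
    h4 _ (leadST2 b c h (v 0) (v 1))
      (leadST2 b c h (v 0 + w 0) (v 1 + w 1) - leadST2 b c h (v 0) (v 1)) (by
        simp only [map_add, map_sub, map_mul, map_pow, map_ofNat, map_neg, leadST2]; ring),
    h4 _ (leadT3 b c h (v 0) (v 1))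
      (leadT3 b c h (v 0 + w 0) (v 1 + w 1) - leadT3 b c h (v 0) (v 1)) (by
        simp only [map_add, map_sub, map_mul, map_pow, leadT3]; ring)]
  simp only [cubicDisc, leadS3, leadS2T, leadST2, leadT3]
  ring

open Polynomial.Bivariate in
/-- If the equation has degree at most four along a line on which `Z` is replaced by
`Z - N σ² + ε σ`, then the second coefficient of a factor whose leading coefficient is constant is
quadratic on that line. -/
lemma eval_coeff_of_mul_eq_deltPoly {b c h : ℝ} (hb : 0 < b) (hh : 0 < h)
    {p q : Polynomial (MvPolynomial (Fin 2) ℝ)} (hpq : p * q = deltPoly b c h) {n : ℕ} {k : ℝ}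
    (hn : q.natDegree = n + 1) (hk : q.coeff (n + 1) = C k) (hk0 : k ≠ 0) (v w : Fin 2 → ℝ)
    (N ε : ℝ) (hw : w 0 ^ 2 + w 1 ^ 2 ≠ 0)
    (hdeg : (delt (Polynomial.C (Polynomial.C b)) (Polynomial.C (Polynomial.C c))
      (Polynomial.C (Polynomial.C h))
      (Polynomial.C (Polynomial.C (v 0)) + Polynomial.C (Polynomial.C (w 0)) * Polynomial.X)
      (Polynomial.C (Polynomial.C (v 1)) + Polynomial.C (Polynomial.C (w 1)) * Polynomial.X)
      (Polynomial.C Polynomial.X - Polynomial.C (Polynomial.C N) * Polynomial.X ^ 2 +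
        Polynomial.C (Polynomial.C ε) * Polynomial.X) :
          Polynomial (Polynomial ℝ)).natDegree ≤ 4) :
    ∃ m : ℝ, ∀ t : ℝ, eval ![v 0 + w 0 * t, v 1 + w 1 * t] (q.coeff n) =
      (n + 1) * k * (N * t ^ 2 - ε * t) + m := by
  -- The Taylor shift by r substitutes Z + r for Z over the line. After `swap` the outer variable is
  -- the parameter of the line, and degrees in it can be compared.
  set r : Polynomial ℝ := -(Polynomial.C N * Polynomial.X ^ 2) + Polynomial.C ε * Polynomial.X
    with hr
  set Ψ : Polynomial (MvPolynomial (Fin 2) ℝ) → Polynomial (Polynomial ℝ) :=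
    fun p => Polynomial.taylor r (p.map (onLine v w)) with hΨ
  have hΨmul : Ψ p * Ψ q = Ψ (deltPoly b c h) := by
    rw [← hpq, hΨ]
    simp only [Polynomial.map_mul, Polynomial.taylor_mul]
  have hΨf : swap (Ψ (deltPoly b c h)) = delt (Polynomial.C (Polynomial.C b))
      (Polynomial.C (Polynomial.C c)) (Polynomial.C (Polynomial.C h))
      (Polynomial.C (Polynomial.C (v 0)) + Polynomial.C (Polynomial.C (w 0)) * Polynomial.X)
      (Polynomial.C (Polynomial.C (v 1)) + Polynomial.C (Polynomial.C (w 1)) * Polynomial.X)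
      (Polynomial.C Polynomial.X - Polynomial.C (Polynomial.C N) * Polynomial.X ^ 2 +
        Polynomial.C (Polynomial.C ε) * Polynomial.X) := by
    have e1 : Ψ (deltPoly b c h) = Polynomial.taylorAlgHom r
        (Polynomial.mapRingHom (onLine v w) (deltPoly b c h)) := rfl
    rw [e1, deltPoly, map_delt, map_delt, map_delt]
    simp only [Polynomial.coe_mapRingHom, Polynomial.map_C, Polynomial.map_X, onLine_C, onLine_X,
      Polynomial.taylorAlgHom_apply, Polynomial.taylor_C, Polynomial.taylor_X, hr, map_add, map_mul,
      map_neg, map_pow, swap_C_C, swap_X, swap_Y]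
    congr 1
    ring
  have hf0 : deltLead (C b) (C c) (C h) (X 0) (X 1) ≠ (0 : MvPolynomial (Fin 2) ℝ) :=
    (irreducible_deltLead hb hh).ne_zero
  have hfdeg : (deltPoly b c h).natDegree = 4 :=
    le_antisymm (natDegree_deltPoly_le b c h).1 (Polynomial.le_natDegree_of_ne_zero (by
      rw [(natDegree_deltPoly_le b c h).2]; exact hf0))
  have hlead : p.leadingCoeff * C k = deltLead (C b) (C c) (C h) (X 0) (X 1) := by
    rw [← hk, ← hn, Polynomial.coeff_natDegree, ← Polynomial.leadingCoeff_mul, hpq,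
      Polynomial.leadingCoeff, hfdeg, (natDegree_deltPoly_le b c h).2]
  have hlp : (onLine v w p.leadingCoeff).coeff 4 ≠ 0 := by
    intro h0
    have := coeff_onLine_deltLead b c h v w
    rw [← hlead, map_mul, onLine_C, Polynomial.coeff_mul_C, h0, zero_mul] at this
    have h1 : b ^ 6 * h ^ 6 * (w 0 ^ 2 + w 1 ^ 2) ^ 2 ≠ 0 := by positivity
    exact h1 (by linarith)
  have hlp0 : onLine v w p.leadingCoeff ≠ 0 := fun h0 => hlp (by rw [h0]; simp)
  have hΨp : (Ψ p).coeff p.natDegree = onLine v w p.leadingCoeff := by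
    have hd : (p.map (onLine v w)).natDegree = p.natDegree :=
      Polynomial.natDegree_map_of_leadingCoeff_ne_zero _ hlp0
    have := Polynomial.coeff_taylor_natDegree (p.map (onLine v w)) (r := r)
    rw [hd] at this
    rw [hΨ]
    simp only
    rw [this, Polynomial.leadingCoeff, hd, Polynomial.coeff_map, Polynomial.coeff_natDegree]
  -- The leading coefficient of p is not changed by the shift. It equals `deltLead` up to a
  -- constant, so it already has degree four along the line and leaves no degree for q.
  have hpdeg : 4 ≤ (swap (Ψ p)).natDegree := by
    refine Polynomial.le_natDegree_of_ne_zero fun h0 => hlp ?_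
    rw [← hΨp, ← coeff_coeff_swap, h0, Polynomial.coeff_zero]
  have hqmap : (q.map (onLine v w)).natDegree = n + 1 := by
    rw [Polynomial.natDegree_map_of_leadingCoeff_ne_zero, hn]
    rw [Polynomial.leadingCoeff, hn, hk, onLine_C]
    simpa using hk0
  have hΨq : (Ψ q).coeff n = onLine v w (q.coeff n) + (n + 1) * r * Polynomial.C k := by
    rw [hΨ]
    simp only
    rw [coeff_taylor_of_natDegree_eq_succ hqmap, Polynomial.coeff_map, Polynomial.coeff_map, hk,
      onLine_C]
  have hp0 : swap (Ψ p) ≠ 0 := by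
    intro h0
    rw [h0] at hpdeg
    simp at hpdeg
  have hq0 : swap (Ψ q) ≠ 0 := by
    rw [Ne, EmbeddingLike.map_eq_zero_iff]
    rw [hΨ]
    simp only
    rw [Polynomial.taylor_eq_zero]
    intro h0
    rw [h0] at hqmap
    simp at hqmap
  have hqdeg : (swap (Ψ q)).natDegree = 0 := by
    have := Polynomial.natDegree_mul hp0 hq0
    rw [← map_mul, hΨmul, hΨf] at this
    omega
  have hconst : ∀ i, 0 < i → ((Ψ q).coeff n).coeff i = 0 := fun i hi => by
    have h0 : (swap (Ψ q)).coeff i = 0 := Polynomial.coeff_eq_zero_of_natDegree_lt (by omega)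
    rw [← coeff_coeff_swap, h0, Polynomial.coeff_zero]
  obtain ⟨m, hm⟩ : ∃ m : ℝ, (Ψ q).coeff n = Polynomial.C m := by
    refine ⟨((Ψ q).coeff n).coeff 0, Polynomial.eq_C_of_natDegree_eq_zero ?_⟩
    refine Nat.eq_zero_of_not_pos fun hpos => ?_
    have h1 := hconst _ hpos
    rw [Polynomial.coeff_natDegree, Polynomial.leadingCoeff_eq_zero] at h1
    rw [h1] at hpos
    simp at hpos
  refine ⟨m, fun t => ?_⟩
  have h1 := congrArg (Polynomial.eval t) (hΨq.symm.trans hm)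
  simp only [Polynomial.eval_add, Polynomial.eval_mul, Polynomial.eval_C, Polynomial.eval_natCast,
    Polynomial.eval_one, hr, Polynomial.eval_neg, Polynomial.eval_pow, Polynomial.eval_X] at h1
  have h2 := eval_aeval_line (q.coeff n) v w t
  have h3 : (fun i => v i + w i * t) = ![v 0 + w 0 * t, v 1 + w 1 * t] := by
    ext i; fin_cases i <;> rfl
  rw [h3] at h2
  rw [← h2]
  have h4 : (onLine v w (q.coeff n)).eval t =
    (aeval (fun i => Polynomial.C (v i) + Polynomial.C (w i) * Polynomial.X) (q.coeff n)).eval t :=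
    rfl
  rw [← h4]
  linear_combination h1

/-! ### Total degrees -/

/-- The equation of the deltoidal surface has degree at most twelve, if `x`, `y` have degree one and
`Z` has degree two. -/
lemma totalDegree_delt_le {σ : Type*} (b c h : ℝ) {x y Z : MvPolynomial σ ℝ}
    (hx : x.totalDegree ≤ 1) (hy : y.totalDegree ≤ 1) (hZ : Z.totalDegree ≤ 2) :
    (delt (C b) (C c) (C h) x y Z).totalDegree ≤ 12 := by
  have hC : ∀ (r : ℝ) (n : ℕ), C r ∈ restrictTotalDegree σ ℝ n := fun r n => by
    rw [mem_restrictTotalDegree]; simp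
  have hmono : ∀ {p : MvPolynomial σ ℝ}, p ∈ restrictTotalDegree σ ℝ 1 →
      p ∈ restrictTotalDegree σ ℝ 2 := fun {p} hp => by
    rw [mem_restrictTotalDegree] at hp ⊢; omega
  have hlin : ∀ u v w : ℝ, C u + v • x + w • y ∈ restrictTotalDegree σ ℝ 1 := fun u v w =>
    add_mem (add_mem (hC u 1) (Submodule.smul_mem _ _ ((mem_restrictTotalDegree _ _ _).2 hx)))
      (Submodule.smul_mem _ _ ((mem_restrictTotalDegree _ _ _).2 hy))
  have hsq : ∀ {p : MvPolynomial σ ℝ}, p.totalDegree ≤ 1 → p ^ 2 ∈ restrictTotalDegree σ ℝ 2 :=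
    fun {p} hp => by
      rw [mem_restrictTotalDegree]
      have := totalDegree_pow p 2
      omega
  have hmul : ∀ u v w u' v' w' : ℝ, (x ^ 2 + y ^ 2 + Z + (C u' + v' • x + w' • y)) *
      (C u + v • x + w • y) ∈ restrictTotalDegree σ ℝ 3 := fun u v w u' v' w' => by
    have h1 := (mem_restrictTotalDegree _ _ _).1 (hlin u v w)
    have h2 := (mem_restrictTotalDegree _ _ _).1 (add_mem (add_mem (add_mem (hsq hx) (hsq hy))
      ((mem_restrictTotalDegree _ _ _).2 hZ)) (hmono (hlin u' v' w')))
    rw [mem_restrictTotalDegree]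
    have h3 := totalDegree_mul (x ^ 2 + y ^ 2 + Z + (C u' + v' • x + w' • y)) (C u + v • x + w • y)
    omega
  refine totalDegree_cubicDisc_le (n := 3) ?_ ?_ ?_ ?_ <;> rw [← mem_restrictTotalDegree]
  · convert Submodule.smul_mem _ (-(c ^ 2 + h ^ 2)) (hmul (b * c) (-c) (-h) (b ^ 2) (-2 * b) 0)
      using 1
    simp only [coeffS3, smul_eq_C_mul, map_add, map_mul, map_neg, map_pow, map_zero,
      map_ofNat]
    ring
  · convert add_mem (add_mem (Submodule.smul_mem _ (b ^ 2 - ((b - c) ^ 2 + h ^ 2))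
      (hmul (c ^ 2 + h ^ 2) (-c) (-h) (b ^ 2) (-2 * b) 0))
      (Submodule.smul_mem _ (c ^ 2 + h ^ 2) (hmul (2 * b ^ 2) (-2 * b) 0 (b * c) (-(b + c)) (-h))))
      (Submodule.smul_mem _ (c ^ 2 + h ^ 2)
        (hmul (c ^ 2 - b * c + h ^ 2) (b - c) (-h) (b ^ 2) (-2 * b) 0)) using 1
    simp only [coeffS2T, smul_eq_C_mul, map_add, map_sub, map_mul, map_neg, map_pow, map_zero,
      map_ofNat]
    ring
  · convert add_mem (add_mem (Submodule.smul_mem _ (-2 * b ^ 2)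
      (hmul (c ^ 2 + h ^ 2) (-c) (-h) (b * c) (-(b + c)) (-h)))
      (Submodule.smul_mem _ (-b ^ 2)
        (hmul (b ^ 2 - b * c) (c - b) h (c ^ 2 + h ^ 2) (-2 * c) (-2 * h))))
      (Submodule.smul_mem _ ((b - c) ^ 2 + h ^ 2 - (c ^ 2 + h ^ 2))
        (hmul (b ^ 2) (-b) 0 (c ^ 2 + h ^ 2) (-2 * c) (-2 * h))) using 1
    simp only [coeffST2, smul_eq_C_mul, map_add, map_sub, map_mul, map_neg, map_pow, map_zero,
      map_ofNat]
    ring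
  · convert Submodule.smul_mem _ (b ^ 2) (hmul (b * c) (-b) 0 (c ^ 2 + h ^ 2) (-2 * c) (-2 * h))
      using 1
    simp only [coeffT3, smul_eq_C_mul, map_add, map_mul, map_neg, map_pow, map_zero,
      map_ofNat]
    ring

/-- The substitution `Z = z²`, the new variable being the first one. -/
def squareSubst : Polynomial (MvPolynomial (Fin 2) ℝ) →ₐ[ℝ] MvPolynomial (Fin 3) ℝ :=
  ((finSuccEquiv ℝ 2).symm : Polynomial (MvPolynomial (Fin 2) ℝ) →ₐ[ℝ] MvPolynomial (Fin 3) ℝ).comp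
    ((Polynomial.expand (MvPolynomial (Fin 2) ℝ) 2).restrictScalars ℝ)

lemma finSuccEquiv_squareSubst (p : Polynomial (MvPolynomial (Fin 2) ℝ)) :
    finSuccEquiv ℝ 2 (squareSubst p) = Polynomial.expand _ 2 p := by
  simp [squareSubst]

/-- Since Z stands for z², its powers count twice in the total degree. -/
lemma totalDegree_coeff_add_le (p : Polynomial (MvPolynomial (Fin 2) ℝ)) {i : ℕ}
    (hi : p.coeff i ≠ 0) : (p.coeff i).totalDegree + 2 * i ≤ (squareSubst p).totalDegree := by
  have h := totalDegree_coeff_finSuccEquiv_add_le (squareSubst p) (2 * i)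
  rw [finSuccEquiv_squareSubst, mul_comm 2 i, Polynomial.coeff_expand_mul (by norm_num)] at h
  have := h hi
  omega

lemma squareSubst_deltPoly (b c h : ℝ) :
    squareSubst (deltPoly b c h) = delt (C b) (C c) (C h) (X 1) (X 2) (X 0 ^ 2) := by
  apply (finSuccEquiv ℝ 2).injective
  have h1 : (X 1 : MvPolynomial (Fin 3) ℝ) = X (Fin.succ 0) := rfl
  have h2 : (X 2 : MvPolynomial (Fin 3) ℝ) = X (Fin.succ 1) := rfl
  rw [finSuccEquiv_squareSubst, deltPoly, map_delt, map_delt, h1, h2]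
  simp only [map_pow, finSuccEquiv_X_zero, finSuccEquiv_X_succ, Polynomial.expand_C,
    Polynomial.expand_X]
  simp [finSuccEquiv_apply]

lemma totalDegree_deltLead {b c h : ℝ} (hb : 0 < b) (hh : 0 < h) :
    (deltLead (C b) (C c) (C h) (X 0) (X 1) : MvPolynomial (Fin 2) ℝ).totalDegree = 4 := by
  refine le_antisymm (totalDegree_deltLead_le b c h) ?_
  refine le_trans ?_ (natDegree_aeval_line_le _ ![0, 0] ![1, 0])
  refine Polynomial.le_natDegree_of_ne_zero fun h0 => ?_
  have h1 := coeff_onLine_deltLead b c h ![0, 0] ![1, 0]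
  rw [show (onLine ![0, 0] ![1, 0] (deltLead (C b) (C c) (C h) (X 0) (X 1))).coeff 4 = 0 from h0] at h1
  simp at h1
  rcases h1 with h1 | h1 <;> simp [h1] at hb hh

/-- A factor of the equation with constant leading coefficient is a unit. -/
lemma isUnit_of_mul_eq_deltPoly {b c h : ℝ} (hb : 0 < b) (hh : 0 < h)
    {p q : Polynomial (MvPolynomial (Fin 2) ℝ)} (hpq : p * q = deltPoly b c h)
    (hq : IsUnit q.leadingCoeff) : IsUnit q := by
  obtain ⟨k, hk0, hk⟩ := (MvPolynomial.isUnit_iff_eq_C_of_isReduced).1 hq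
  obtain hn | ⟨n, hn⟩ : q.natDegree = 0 ∨ ∃ n, q.natDegree = n + 1 := by
    rcases q.natDegree with _ | n
    · exact Or.inl rfl
    · exact Or.inr ⟨n, rfl⟩
  · rw [Polynomial.leadingCoeff, hn] at hq
    rw [Polynomial.eq_C_of_natDegree_eq_zero hn]
    exact hq.map Polynomial.C
  exfalso
  have hk1 : k ≠ 0 := hk0.ne_zero
  have hqk : q.coeff (n + 1) = C k := by rw [← hn, Polynomial.coeff_natDegree, hk]
  have hf0 : deltLead (C b) (C c) (C h) (X 0) (X 1) ≠ (0 : MvPolynomial (Fin 2) ℝ) :=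
    (irreducible_deltLead hb hh).ne_zero
  have hfdeg : (deltPoly b c h).natDegree = 4 :=
    le_antisymm (natDegree_deltPoly_le b c h).1 (Polynomial.le_natDegree_of_ne_zero (by
      rw [(natDegree_deltPoly_le b c h).2]; exact hf0))
  have hfne : deltPoly b c h ≠ 0 := by
    intro h0
    rw [h0] at hfdeg
    simp at hfdeg
  have hp0 : p ≠ 0 := by rintro rfl; exact hfne (by rw [← hpq, zero_mul])
  have hq0 : q ≠ 0 := by rintro rfl; exact hfne (by rw [← hpq, mul_zero])
  have hpn : p.natDegree + (n + 1) = 4 := by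
    rw [← hfdeg, ← hpq, Polynomial.natDegree_mul hp0 hq0, hn]
  have hlead : p.leadingCoeff * C k = deltLead (C b) (C c) (C h) (X 0) (X 1) := by
    rw [← hk, ← Polynomial.leadingCoeff_mul, hpq, Polynomial.leadingCoeff, hfdeg,
      (natDegree_deltPoly_le b c h).2]
  have hplead : p.leadingCoeff.totalDegree = 4 := by
    have h1 := totalDegree_deltLead (c := c) hb hh
    rw [← hlead, totalDegree_mul_of_isDomain (by simpa using hp0) (by simpa using hk1),
      totalDegree_C] at h1
    exact h1
  have hsub0 : ∀ {u : Polynomial (MvPolynomial (Fin 2) ℝ)}, u ≠ 0 → squareSubst u ≠ 0 := by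
    intro u hu h0
    have := finSuccEquiv_squareSubst u
    rw [h0, map_zero] at this
    exact hu ((Polynomial.expand_eq_zero (by norm_num)).1 this.symm)
  have hdeg : (squareSubst p).totalDegree + (squareSubst q).totalDegree ≤ 12 := by
    rw [← totalDegree_mul_of_isDomain (hsub0 hp0) (hsub0 hq0), ← map_mul, hpq, squareSubst_deltPoly]
    refine totalDegree_delt_le b c h (by simp [totalDegree_X]) (by simp [totalDegree_X]) ?_
    exact (totalDegree_pow _ _).trans (by simp [totalDegree_X])
  have hpd := totalDegree_coeff_add_le p (i := p.natDegree) (by simpa using hp0)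
  rw [Polynomial.coeff_natDegree, hplead] at hpd
  -- Degree count: p uses at least 4 + 2(3 - n) of the 12, which leaves 2 + 2n for q, and Zⁿ
  -- accounts for 2n of this.
  have hκ : (q.coeff n).totalDegree ≤ 2 := by
    by_cases h0 : q.coeff n = 0
    · rw [h0]; simp
    · have := totalDegree_coeff_add_le q h0
      omega
  obtain ⟨a₂, b₂, c₂, d₂, e₂, f₂, hval⟩ := exists_eval_eq_quadratic hκ
  -- On each altitude the quadratic polynomial `q.coeff n` is K = (n + 1)k times the squared
  -- distance from the foot of the altitude, plus a constant.
  obtain ⟨mC, hC⟩ := eval_coeff_of_mul_eq_deltPoly hb hh hpq hn hqk hk1 ![c, 0] ![0, 1] 1 0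
    (by simp) (by
      convert natDegree_delt_altitudeC_le (Polynomial.C b) (Polynomial.C c) (Polynomial.C h)
        (Polynomial.X : Polynomial ℝ) using 1
      simp)
  obtain ⟨mA, hA⟩ := eval_coeff_of_mul_eq_deltPoly hb hh hpq hn hqk hk1 ![0, 0] ![h, b - c]
    (h ^ 2 + (b - c) ^ 2) (2 * b * h)
    (by have : 0 < h ^ 2 + (b - c) ^ 2 := by positivity
        simpa using this.ne') (by
      convert natDegree_delt_altitudeA_le (Polynomial.C b) (Polynomial.C c) (Polynomial.C h)
        (Polynomial.X : Polynomial ℝ) using 1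
      simp [map_ofNat])
  obtain ⟨mB, hB⟩ := eval_coeff_of_mul_eq_deltPoly hb hh hpq hn hqk hk1 ![b, 0] ![h, -c]
    (h ^ 2 + c ^ 2) (-2 * b * h)
    (by have : 0 < h ^ 2 + c ^ 2 := by positivity
        simpa using this.ne') (by
      convert natDegree_delt_altitudeB_le (b := Polynomial.C b) (c := Polynomial.C c)
        (h := Polynomial.C h) (W := (Polynomial.X : Polynomial ℝ)) (m := Polynomial.C (-c))
        (e := Polynomial.C (-2 * b * h)) (by simp) (by simp [map_ofNat]) using 1
      simp only [Matrix.cons_val_zero, Matrix.cons_val_one, map_zero, zero_add,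
        map_add, map_pow])
  simp only [hval, Matrix.cons_val_zero, Matrix.cons_val_one] at hA hB hC
  have hs : ∀ {u v m : ℝ}, (∀ t : ℝ, u * t ^ 2 + v * t + m = 0) → u = 0 ∧ v = 0 := by
    intro u v m H
    have := quartic_coeffs_eq_zero (a₀ := m) (a₁ := v) (a₂ := u) (a₃ := 0) (a₄ := 0)
      (fun t => by linear_combination H t)
    exact ⟨this.2.2.1, this.2.1⟩
  set K : ℝ := (n + 1) * k with hKdef
  have hK0 : K ≠ 0 := mul_ne_zero (by positivity) hk1
  obtain ⟨c1, c2⟩ := hs (u := c₂ - K) (v := b₂ * c + e₂) (m := a₂ * c ^ 2 + d₂ * c + f₂ - mC)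
    (fun t => by linear_combination hC t)
  obtain ⟨a1, a2⟩ := hs (u := a₂ * h ^ 2 + b₂ * h * (b - c) + c₂ * (b - c) ^ 2 -
    K * (h ^ 2 + (b - c) ^ 2)) (v := d₂ * h + e₂ * (b - c) + K * (2 * b * h)) (m := f₂ - mA)
    (fun t => by linear_combination hA t)
  obtain ⟨b1, b2⟩ := hs (u := a₂ * h ^ 2 - b₂ * h * c + c₂ * c ^ 2 - K * (h ^ 2 + c ^ 2))
    (v := 2 * a₂ * b * h - b₂ * b * c + d₂ * h - e₂ * c - K * (2 * b * h))
    (m := a₂ * b ^ 2 + d₂ * b + f₂ - mB) (fun t => by linear_combination hB t)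
  -- The quadratic part is K(x² + y²), so the polynomial is K|P - M|² plus a constant for some point
  -- M. On each altitude its critical point is the foot, hence M lies on all three side lines, which
  -- is impossible for a non-degenerate triangle.
  have hB0 : b₂ = 0 := by
    have : h * b * b₂ = 0 := by
      linear_combination a1 - b1 - ((b - c) ^ 2 - c ^ 2) * c1
    exact (mul_eq_zero.1 this).resolve_left (by positivity)
  have hA0 : a₂ = K := by
    have : h ^ 2 * (a₂ - K) = 0 := by
      linear_combination b1 + h * c * hB0 - c ^ 2 * c1
    have := (mul_eq_zero.1 this).resolve_left (by positivity)
    linarith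
  have hE0 : e₂ = 0 := by rw [hB0] at c2; linarith
  have hD0 : h * d₂ = 0 := by
    linear_combination b2 - 2 * b * h * hA0 + b * c * hB0 + c * hE0
  have : K * (2 * b * h) = 0 := by
    linear_combination a2 - hD0 - (b - c) * hE0
  have h2 : K * (2 * b * h) ≠ 0 := mul_ne_zero hK0 (by positivity)
  exact h2 this

/-- The leading coefficients of two factors multiply to the irreducible `deltLead`, so one of them
is a unit, and then so is the factor. -/
lemma irreducible_deltPoly {b c h : ℝ} (hb : 0 < b) (hh : 0 < h) :
    Irreducible (deltPoly b c h) := by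
  have hδ := irreducible_deltLead (c := c) hb hh
  have hfdeg : (deltPoly b c h).natDegree = 4 :=
    le_antisymm (natDegree_deltPoly_le b c h).1 (Polynomial.le_natDegree_of_ne_zero (by
      rw [(natDegree_deltPoly_le b c h).2]; exact hδ.ne_zero))
  refine ⟨fun hu => ?_, fun p q hpq => ?_⟩
  · have := Polynomial.natDegree_eq_zero_of_isUnit hu
    omega
  · have hlead : p.leadingCoeff * q.leadingCoeff = deltLead (C b) (C c) (C h) (X 0) (X 1) := by
      rw [← Polynomial.leadingCoeff_mul, ← hpq, Polynomial.leadingCoeff, hfdeg,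
        (natDegree_deltPoly_le b c h).2]
    rcases hδ.isUnit_or_isUnit hlead.symm with h1 | h1
    · exact Or.inl (isUnit_of_mul_eq_deltPoly hb hh (by rw [mul_comm, hpq]) h1)
    · exact Or.inr (isUnit_of_mul_eq_deltPoly hb hh hpq.symm h1)

/-! ### Elimination -/

/-- An irreducible polynomial and a polynomial that it does not divide have a nonzero constant
combination. -/
lemma exists_mul_add_mul_eq_C {R : Type*} [CommRing R] [IsDomain R] [UniqueFactorizationMonoid R]
    {f q : Polynomial R} (hf : Irreducible f) (hfq : ¬ f ∣ q) :
    ∃ r : R, r ≠ 0 ∧ ∃ a b : Polynomial R, f * a + q * b = Polynomial.C r := by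
  by_cases hdeg : f.natDegree = 0
  · refine ⟨f.coeff 0, fun h0 => hf.ne_zero ?_, 1, 0, ?_⟩
    · rw [Polynomial.eq_C_of_natDegree_eq_zero hdeg, h0, Polynomial.C_0]
    · rw [mul_one, mul_zero, add_zero, ← Polynomial.eq_C_of_natDegree_eq_zero hdeg]
  · have hprim := hf.isPrimitive hdeg
    have hirr := (hprim.irreducible_iff_irreducible_map_fraction_map (K := FractionRing R)).1 hf
    -- By Gauss's lemma f stays irreducible over the fraction field and still does not divide q. So
    -- the resultant is nonzero, and it is a combination of f and q over R.
    have hcop : IsCoprime (f.map (algebraMap R (FractionRing R)))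
        (q.map (algebraMap R (FractionRing R))) :=
      (hirr.coprime_iff_not_dvd).2 fun h => hfq (hprim.dvd_of_fraction_map_dvd_fraction_map h)
    have hres := Polynomial.resultant_ne_zero _ _ hcop
    have hinj := IsFractionRing.injective R (FractionRing R)
    rw [Polynomial.natDegree_map_eq_of_injective hinj, Polynomial.natDegree_map_eq_of_injective hinj,
      Polynomial.resultant_map_map] at hres
    obtain ⟨a, b, -, -, h⟩ := Polynomial.exists_mul_add_mul_eq_C_resultant f q le_rfl le_rfl
      (Or.inl hdeg)
    exact ⟨_, fun h0 => hres (by rw [h0, map_zero]), a, b, h⟩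

/-- A polynomial in two variables that vanishes for infinitely many values of the second and then
infinitely many values of the first variable is zero. -/
lemma eq_zero_of_infinite {r : MvPolynomial (Fin 2) ℝ} {S : Set ℝ} (hS : S.Infinite)
    (h : ∀ y ∈ S, {Z : ℝ | eval ![Z, y] r = 0}.Infinite) : r = 0 := by
  have line : ∀ (v w : Fin 2 → ℝ), {t : ℝ | eval (fun i => v i + w i * t) r = 0}.Infinite →
      ∀ t, eval (fun i => v i + w i * t) r = 0 := fun v w hinf t => by
    have h0 : aeval (fun i => Polynomial.C (v i) + Polynomial.C (w i) * Polynomial.X) r = 0 := by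
      refine Polynomial.eq_zero_of_infinite_isRoot _ (hinf.mono fun t ht => ?_)
      simp only [Set.mem_ofPred_eq, Polynomial.IsRoot.def]
      rw [eval_aeval_line]
      exact ht
    rw [← eval_aeval_line, h0, Polynomial.eval_zero]
  have h1 : ∀ y ∈ S, ∀ Z : ℝ, eval ![Z, y] r = 0 := by
    intro y hy Z
    have e : ∀ t : ℝ, (fun i => ![0, y] i + ![1, 0] i * t) = ![t, y] := fun t => by
      ext i; fin_cases i <;> simp
    have := line ![0, y] ![1, 0] (by simpa only [e] using h y hy) Z
    rwa [e] at this
  refine funext fun v => ?_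
  have e : ∀ t : ℝ, (fun i => ![v 0, 0] i + ![0, 1] i * t) = ![v 0, t] := fun t => by
    ext i; fin_cases i <;> simp
  have := line ![v 0, 0] ![0, 1] (by
    simp only [e]
    exact hS.mono fun y hy => h1 y hy (v 0)) (v 1)
  rw [e] at this
  rw [map_zero, ← this]
  congr 1
  congr 1
  ext i; fin_cases i <;> rfl

/-- The value of a polynomial in `x, y` and `Z`. -/
def evalXYZ (x y Z : ℝ) : Polynomial (MvPolynomial (Fin 2) ℝ) →+* ℝ :=
  Polynomial.eval₂RingHom (eval ![x, y]) Z

lemma evalXYZ_deltPoly (b c h x y Z : ℝ) : evalXYZ x y Z (deltPoly b c h) = delt b c h x y Z := by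
  rw [deltPoly, map_delt]
  simp [evalXYZ]

/-- The exchange of `x` and `Z`. -/
def exchange : Polynomial (MvPolynomial (Fin 2) ℝ) ≃ₐ[ℝ] Polynomial (MvPolynomial (Fin 2) ℝ) :=
  ((finSuccEquiv ℝ 2).symm.trans (renameEquiv ℝ (Equiv.swap 0 1))).trans (finSuccEquiv ℝ 2)

lemma evalXYZ_exchange (x y Z : ℝ) (q : Polynomial (MvPolynomial (Fin 2) ℝ)) :
    evalXYZ Z y x (exchange q) = evalXYZ x y Z q := by
  have hX : (finSuccEquiv ℝ 2).symm Polynomial.X = X 0 := by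
    rw [AlgEquiv.symm_apply_eq, finSuccEquiv_X_zero]
  have hC : ∀ i, (finSuccEquiv ℝ 2).symm (Polynomial.C (X i)) = X i.succ := fun i => by
    rw [AlgEquiv.symm_apply_eq, finSuccEquiv_X_succ]
  have hCC : ∀ a : ℝ, (finSuccEquiv ℝ 2).symm (Polynomial.C (C a)) = C a := fun a => by
    rw [AlgEquiv.symm_apply_eq]
    simp [finSuccEquiv_apply]
  have h1 : (X 1 : MvPolynomial (Fin 3) ℝ) = X (Fin.succ 0) := rfl
  have h2 : (X 2 : MvPolynomial (Fin 3) ℝ) = X (Fin.succ 1) := rfl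
  have h : (evalXYZ Z y x).comp (exchange : _ →ₐ[ℝ] _).toRingHom = evalXYZ x y Z := by
    refine Polynomial.ringHom_ext' (ringHom_ext (fun a => ?_) fun i => ?_) ?_
    · simp only [RingHom.comp_apply, AlgHom.toRingHom_eq_coe, RingHom.coe_coe, exchange,
        AlgEquiv.coe_toAlgHom, AlgEquiv.trans_apply, hCC, renameEquiv_apply, rename_C]
      simp [finSuccEquiv_apply, evalXYZ]
    · simp only [RingHom.comp_apply, AlgHom.toRingHom_eq_coe, RingHom.coe_coe, exchange,
        AlgEquiv.coe_toAlgHom, AlgEquiv.trans_apply, hC, renameEquiv_apply, rename_X]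
      fin_cases i
      · have : (Equiv.swap (0 : Fin 3) 1) (Fin.succ 0) = 0 := by decide
        simp only [Fin.zero_eta, this, finSuccEquiv_X_zero]
        simp [evalXYZ]
      · have : (Equiv.swap (0 : Fin 3) 1) (Fin.succ 1) = Fin.succ 1 := by decide
        simp only [Fin.mk_one, this, finSuccEquiv_X_succ]
        simp [evalXYZ]
    · simp only [RingHom.comp_apply, AlgHom.toRingHom_eq_coe, RingHom.coe_coe, exchange,
        AlgEquiv.coe_toAlgHom, AlgEquiv.trans_apply, hX, renameEquiv_apply, rename_X]
      have : (Equiv.swap (0 : Fin 3) 1) 0 = Fin.succ 0 := by decide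
      rw [this, finSuccEquiv_X_succ]
      simp [evalXYZ]
  exact congrArg (fun φ => φ q) h

/-- The equation divides every polynomial that vanishes at sufficiently many of its zeros. -/
lemma deltPoly_dvd_of_infinite {b c h : ℝ} (hb : 0 < b) (hh : 0 < h) {S : Set ℝ} (hS : S.Infinite)
    {q : Polynomial (MvPolynomial (Fin 2) ℝ)}
    (hq : ∀ y ∈ S, {Z : ℝ | ∃ x, delt b c h x y Z = 0 ∧ evalXYZ x y Z q = 0}.Infinite) :
    deltPoly b c h ∣ q := by
  by_contra hdvd
  -- The variable to eliminate is x: the hypothesis controls infinitely many pairs (Z, y), but gives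
  -- only the existence of x.
  have hirr : Irreducible (exchange (deltPoly b c h)) :=
    (MulEquiv.irreducible_iff exchange).2 (irreducible_deltPoly hb hh)
  have hndvd : ¬ exchange (deltPoly b c h) ∣ exchange q := fun h1 =>
    hdvd ((map_dvd_iff exchange).1 h1)
  obtain ⟨r, hr0, u, v, huv⟩ := exists_mul_add_mul_eq_C hirr hndvd
  refine hr0 (eq_zero_of_infinite hS fun y hy => (hq y hy).mono ?_)
  rintro Z ⟨x, hx1, hx2⟩
  have h1 := congrArg (evalXYZ Z y x) huv
  rw [map_add, map_mul, map_mul, evalXYZ_exchange, evalXYZ_exchange, evalXYZ_deltPoly, hx1, hx2,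
    zero_mul, zero_mul, add_zero] at h1
  simpa [evalXYZ] using h1.symm

/-! ### The angles of the triangle -/

/-- The triangle `(0,0)`, `(b,0)`, `(c,h)` in terms of its angles and the radius of its
circumcircle. -/
lemma exists_angles {b c h : ℝ} (hb : 0 < b) (hh : 0 < h) :
    ∃ R α γ : ℝ, 0 < R ∧ 0 < α ∧ 0 < γ ∧ α + γ < Real.pi ∧ b = 2 * R * Real.sin γ ∧
      c = 2 * R * Real.sin (α + γ) * Real.cos α ∧ h = 2 * R * Real.sin (α + γ) * Real.sin α := by
  have arg : ∀ a : ℝ, ∃ r θ : ℝ, 0 < r ∧ 0 < θ ∧ θ < Real.pi ∧ a = r * Real.cos θ ∧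
      h = r * Real.sin θ := by
    intro a
    set w : ℂ := ⟨a, h⟩ with hw
    have hw0 : w ≠ 0 := fun h0 => hh.ne' (by simpa [hw] using congrArg Complex.im h0)
    have hr : 0 < ‖w‖ := norm_pos_iff.2 hw0
    have hre : a = ‖w‖ * Real.cos w.arg := by rw [Complex.norm_mul_cos_arg]
    have him : h = ‖w‖ * Real.sin w.arg := by rw [Complex.norm_mul_sin_arg]
    refine ⟨‖w‖, w.arg, hr, ?_, ?_, hre, him⟩
    · have hnn : 0 ≤ w.arg := Complex.arg_nonneg_iff.2 hh.le
      rcases hnn.eq_or_lt with h0 | h0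
      · rw [← h0] at him; simp at him; linarith
      · exact h0
    · rcases (Complex.arg_le_pi w).eq_or_lt with h0 | h0
      · rw [h0] at him; simp at him; linarith
      · exact h0
  obtain ⟨r, α, hr, hα, hαπ, hc, hh1⟩ := arg c
  obtain ⟨s, β, hs, hβ, hβπ, hbc, hh2⟩ := arg (b - c)
  have hsinα : 0 < Real.sin α := Real.sin_pos_of_pos_of_lt_pi hα hαπ
  have hsinβ : 0 < Real.sin β := Real.sin_pos_of_pos_of_lt_pi hβ hβπ
  have hsum : α + β < Real.pi := by
    by_contra! hcon
    have h1 : Real.sin (α + β) ≤ 0 := by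
      have := Real.sin_nonneg_of_nonneg_of_le_pi (x := α + β - Real.pi) (by linarith) (by linarith)
      rw [Real.sin_sub_pi] at this
      linarith
    have h2 : r * s * Real.sin (α + β) = h * b := by
      rw [Real.sin_add]
      linear_combination (-(s * Real.cos β) - r * Real.cos α) * hh1 + r * Real.cos α * (hh1 - hh2) -
        h * hbc - h * hc
    have : 0 < h * b := by positivity
    have : r * s * Real.sin (α + β) ≤ 0 := mul_nonpos_of_nonneg_of_nonpos (by positivity) h1
    linarith
  have hγ : α + (Real.pi - α - β) = Real.pi - β := by ring
  -- Here r = |AC| and β is the angle at B, so the radius comes from the law of sines; γ is the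
  -- angle at C.
  refine ⟨r / (2 * Real.sin β), α, Real.pi - α - β, by positivity, hα, by linarith, by linarith,
    ?_, ?_, ?_⟩
  · rw [show Real.pi - α - β = Real.pi - (α + β) by ring, Real.sin_pi_sub, Real.sin_add]
    have : b = r * Real.cos α + s * Real.cos β := by linarith
    rw [this]
    field_simp
    linear_combination Real.cos β * (hh1 - hh2)
  · rw [hγ, Real.sin_pi_sub, hc]
    field_simp
  · rw [hγ, Real.sin_pi_sub, hh1]
    field_simp

/-! ### Complementary points over a line -/

lemma tendsto_eval_atBot {p : Polynomial ℝ} (hd : p.natDegree ≤ 4) (hc : p.coeff 4 < 0) :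
    Filter.Tendsto (fun x => p.eval x) Filter.atTop Filter.atBot := by
  have h4 : p.natDegree = 4 := le_antisymm hd (Polynomial.le_natDegree_of_ne_zero hc.ne)
  refine Polynomial.tendsto_atBot_of_leadingCoeff_nonpos p ?_ ?_
  · exact Polynomial.natDegree_pos_iff_degree_pos.1 (by omega)
  · rw [Polynomial.leadingCoeff, h4]
    exact hc.le

/-- Along a horizontal line the leading coefficient is -4b⁶h⁶. The resulting negative values are
played off against the positive values of `delt` on the cylinder. -/
lemma tendsto_deltLead (b c h y : ℝ) (hb : 0 < b) (hh : 0 < h) :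
    Filter.Tendsto (fun x => deltLead b c h x y) Filter.atTop Filter.atBot := by
  have h1 : (onLine ![0, y] ![1, 0] (deltLead (C b) (C c) (C h) (X 0) (X 1))).natDegree ≤ 4 :=
    (natDegree_aeval_line_le _ _ _).trans (totalDegree_deltLead_le b c h)
  have h2 := tendsto_eval_atBot h1 (by
    rw [coeff_onLine_deltLead]
    have : 0 < b ^ 6 * h ^ 6 := by positivity
    simp
    linarith)
  refine h2.congr fun x => ?_
  rw [map_deltLead, onLine_C, onLine_C, onLine_C, onLine_X, onLine_X, ← Polynomial.coe_evalRingHom,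
    map_deltLead]
  simp

lemma tendsto_delt (b c h x y : ℝ) (hl : deltLead b c h x y < 0) :
    Filter.Tendsto (fun Z => delt b c h x y Z) Filter.atTop Filter.atBot := by
  obtain ⟨h1, h2⟩ := natDegree_delt_le b c h x y
  refine (tendsto_eval_atBot h1 (by rw [h2]; exact hl)).congr fun Z => ?_
  rw [← Polynomial.coe_evalRingHom, map_delt]
  simp

/-- If the equation is positive for large `Z` over a point on the right half of the circumcircle,
then there are complementary points of every large height to the right of this point. -/
lemma infinite_setOf_complementary {b c h x₀ y : ℝ} (hb : 0 < b) (hh : 0 < h)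
    (hx : b ≤ 2 * x₀) (hc : circ b c h x₀ y = 0)
    (hpos : ∀ᶠ Z in Filter.atTop, 0 < delt b c h x₀ y Z) :
    {Z : ℝ | ∃ x, delt b c h x y Z = 0 ∧ ∃ z, z ≠ 0 ∧ z ^ 2 = Z ∧
      !₂[x, y, z] ∈ complementarySet b c h ∧ !₂[x, y, -z] ∈ complementarySet b c h}.Infinite := by
  -- For every large Z the equation is positive at x₀ and negative at x₁, hence has a zero in
  -- between; H bounds all horizontal squared distances uniformly, so that a large Z is high enough.
  obtain ⟨x₁, hx₁, hl⟩ : ∃ x₁, x₀ < x₁ ∧ deltLead b c h x₁ y < 0 :=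
    ((Filter.eventually_gt_atTop x₀).and
      ((tendsto_deltLead b c h y hb hh).eventually_lt_atBot 0)).exists
  set m : ℝ := |x₀| + |x₁| + b + |c| with hm
  set H : ℝ := m ^ 2 + (|y| + h) ^ 2 with hH
  have hev : ∀ᶠ Z : ℝ in Filter.atTop, 0 < delt b c h x₀ y Z ∧ delt b c h x₁ y Z < 0 ∧ 0 < Z ∧
      72 * (2 * (b ^ 2 + (c ^ 2 + h ^ 2) + ((b - c) ^ 2 + h ^ 2))) ^ 2 * H < Z * (4 * b ^ 2 * h ^ 2) :=
    hpos.and (((tendsto_delt b c h x₁ y hl).eventually_lt_atBot 0).and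
      ((Filter.eventually_gt_atTop 0).and
        ((Filter.tendsto_id.atTop_mul_const (by positivity)).eventually_gt_atTop _)))
  have hfreq : ∃ᶠ Z : ℝ in Filter.cofinite, 0 < delt b c h x₀ y Z ∧ delt b c h x₁ y Z < 0 ∧
      0 < Z ∧ 72 * (2 * (b ^ 2 + (c ^ 2 + h ^ 2) + ((b - c) ^ 2 + h ^ 2))) ^ 2 * H <
        Z * (4 * b ^ 2 * h ^ 2) :=
    hev.frequently.filter_mono Filter.atTop_le_cofinite
  rw [Filter.frequently_cofinite_iff_infinite] at hfreq
  refine hfreq.mono ?_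
  rintro Z ⟨hp, hn, hZ, hhigh⟩
  have hcont : ContinuousOn (fun x => delt b c h x y Z) (Set.Icc x₀ x₁) := by
    simp only [delt, cubicDisc, coeffS3, coeffS2T, coeffST2, coeffT3]
    fun_prop
  obtain ⟨x, ⟨hx0, hx1⟩, hx2⟩ := intermediate_value_Icc' hx₁.le hcont ⟨hn.le, hp.le⟩
  simp only at hx2
  have hx0' : x₀ < x := lt_of_le_of_ne hx0 (by rintro rfl; linarith)
  have hxm : |x| ≤ |x₀| + |x₁| := by
    rw [abs_le]
    constructor
    · linarith [neg_abs_le x₀, abs_nonneg x₁]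
    · linarith [le_abs_self x₁, abs_nonneg x₀]
  have hxm' := abs_le.1 hxm
  have habs : ∀ u v : ℝ, |u| ≤ v → u ^ 2 ≤ v ^ 2 := fun u v huv => by
    rw [← sq_abs u]
    exact pow_le_pow_left₀ (abs_nonneg u) huv 2
  have hc1 := abs_nonneg c
  have hc2 := neg_abs_le c
  have hc3 := le_abs_self c
  have hy2 := neg_abs_le y
  have hy3 := le_abs_self y
  have hA : x ^ 2 + y ^ 2 ≤ H := add_le_add (habs _ _ (by linarith)) (habs _ _ (by linarith))
  have hB : (b - x) ^ 2 + y ^ 2 ≤ H :=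
    add_le_add (habs _ _ (abs_le.2 ⟨by linarith, by linarith⟩)) (habs _ _ (by linarith))
  have hC : (c - x) ^ 2 + (h - y) ^ 2 ≤ H :=
    add_le_add (habs _ _ (abs_le.2 ⟨by linarith, by linarith⟩))
      (habs _ _ (abs_le.2 ⟨by linarith, by linarith⟩))
  -- The line meets the circumcircle only at x₀ and b - x₀ ≤ x₀, and x lies to the right of both.
  have hcirc : circ b c h x y ≠ 0 := by
    have h1 : circ b c h x y = h * ((x - x₀) * (x + x₀ - b)) + circ b c h x₀ y := by
      simp only [circ]; ring
    rw [h1, hc, add_zero]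
    have h2 : 0 < x - x₀ := by linarith
    have h3 : 0 < x + x₀ - b := by linarith
    positivity
  have hz : (Real.sqrt Z) ^ 2 = Z := Real.sq_sqrt hZ.le
  refine ⟨x, hx2, Real.sqrt Z, (Real.sqrt_pos.2 hZ).ne', hz, ?_, ?_⟩
  · exact mem_complementarySet_of_high hb hh hA hB hC (by rw [hz]; exact hhigh) hcirc
      (by rw [hz]; exact hx2)
  · exact mem_complementarySet_of_high hb hh hA hB hC (by rw [neg_sq, hz]; exact hhigh) hcirc
      (by rw [neg_sq, hz]; exact hx2)

/-- The equation of the circumcircle in terms of its centre and radius. -/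
lemma circ_eq {b c h R α γ : ℝ} (hb : b = 2 * R * Real.sin γ)
    (hc : c = 2 * R * Real.sin (α + γ) * Real.cos α)
    (hh : h = 2 * R * Real.sin (α + γ) * Real.sin α) (x y : ℝ) :
    circ b c h x y = h * ((x - R * Real.sin γ) ^ 2 + (y - R * Real.cos γ) ^ 2 - R ^ 2) := by
  have e1 := Real.sin_sq_add_cos_sq γ
  have e2 := Real.sin_sq_add_cos_sq α
  have e3 : b * c - c ^ 2 - h ^ 2 = -(2 * R * Real.cos γ * h) := by
    rw [hb, hc, hh]
    linear_combination 4 * R ^ 2 * Real.sin (α + γ) * (-Real.sin (α + γ)) * e2 +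
      4 * R ^ 2 * Real.sin (α + γ) * (-Real.sin_add α γ)
  rw [circ, e3]
  linear_combination (-x) * h * hb - h * R ^ 2 * e1

/-- There are complementary points of every large height over infinitely many lines. -/
lemma exists_infinite_complementary {b c h : ℝ} (hb : 0 < b) (hh : 0 < h) :
    ∃ S : Set ℝ, S.Infinite ∧ ∀ y ∈ S, {Z : ℝ | ∃ x, delt b c h x y Z = 0 ∧
      ∃ z, z ≠ 0 ∧ z ^ 2 = Z ∧ !₂[x, y, z] ∈ complementarySet b c h ∧
        !₂[x, y, -z] ∈ complementarySet b c h}.Infinite := by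
  obtain ⟨R, α, γ, hR, hα, hγ, hαγ, hbe, hce, hhe⟩ := exists_angles (c := c) hb hh
  -- The interval parametrizes the right half of the circumcircle, where y determines φ; the
  -- condition on the cosine avoids the generatrices of contact, over which `delt` vanishes.
  set V : Set ℝ := {φ | φ ∈ Set.Ioo (-Real.pi) 0 ∧ Real.cos (3 * φ / 2 + γ / 2 + α) ≠ 0} with hV
  have hVopen : IsOpen V := isOpen_Ioo.inter (isOpen_ne_fun (by fun_prop) continuous_const)
  have hVne : V.Nonempty := by
    -- The arguments of the cosine for φ = -π/2 and φ = -π/6 differ by π/2, so one of the two values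
    -- is nonzero.
    by_cases h0 : Real.cos (3 * (-(Real.pi / 2)) / 2 + γ / 2 + α) = 0
    · refine ⟨-(Real.pi / 6), ⟨by linarith [Real.pi_pos], by linarith [Real.pi_pos]⟩, fun h1 => ?_⟩
      rw [show 3 * (-(Real.pi / 6)) / 2 + γ / 2 + α =
        (3 * (-(Real.pi / 2)) / 2 + γ / 2 + α) + Real.pi / 2 by ring, Real.cos_add_pi_div_two] at h1
      have := Real.sin_sq_add_cos_sq (3 * (-(Real.pi / 2)) / 2 + γ / 2 + α)
      rw [h0, neg_eq_zero.1 h1] at this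
      norm_num at this
    · exact ⟨-(Real.pi / 2), ⟨by linarith [Real.pi_pos], by linarith [Real.pi_pos]⟩, h0⟩
  have hVinf : V.Infinite := infinite_of_mem_nhds _ (hVopen.mem_nhds hVne.some_mem)
  refine ⟨(fun φ => R * Real.cos γ - R * Real.cos φ) '' V, hVinf.image ?_, ?_⟩
  · intro φ hφ ψ hψ h1
    simp only at h1
    have h2 : Real.cos (-φ) = Real.cos (-ψ) := by
      rw [Real.cos_neg, Real.cos_neg]
      exact mul_left_cancel₀ hR.ne' (by linarith)
    have := Real.injOn_cos ⟨by linarith [hφ.1.2], by linarith [hφ.1.1]⟩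
      ⟨by linarith [hψ.1.2], by linarith [hψ.1.1]⟩ h2
    linarith
  · rintro _ ⟨φ, ⟨⟨h1, h2⟩, h3⟩, rfl⟩
    have hsin : Real.sin φ < 0 := Real.sin_neg_of_neg_of_neg_pi_lt h2 h1
    have hsα : 0 < Real.sin α := Real.sin_pos_of_pos_of_lt_pi hα (by linarith)
    have hsγ : 0 < Real.sin γ := Real.sin_pos_of_pos_of_lt_pi hγ (by linarith)
    have hsβ : 0 < Real.sin (α + γ) := Real.sin_pos_of_pos_of_lt_pi (by linarith) hαγ
    refine infinite_setOf_complementary (x₀ := R * Real.sin γ - R * Real.sin φ) hb hh ?_ ?_ ?_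
    · rw [hbe]
      nlinarith
    · rw [circ_eq hbe hce hhe]
      have e1 := Real.sin_sq_add_cos_sq φ
      linear_combination h * R ^ 2 * e1
    · have hk : 0 < 4 * (4 * R ^ 2) ^ 8 *
          (Real.sin α * Real.sin γ * Real.sin (α + γ)) ^ 6 *
          Real.cos (3 * φ / 2 + γ / 2 + α) ^ 2 := by positivity
      obtain ⟨u, hu⟩ : ∃ u, u = (φ - γ) / 2 := ⟨_, rfl⟩
      set T : ℝ := 4 * R ^ 2 *
        (Real.sin u ^ 2 + Real.sin (u + γ) ^ 2 + Real.sin (u + γ + α) ^ 2 - 1) with hT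
      filter_upwards [Filter.eventually_gt_atTop 0, Filter.eventually_gt_atTop (-T)] with Z hZ hZT
      have key := delt_circle R α γ u (Real.sqrt Z)
      rw [Real.sq_sqrt hZ.le, show 2 * u + γ = φ by rw [hu]; ring,
        show 3 * u + 2 * γ + α = 3 * φ / 2 + γ / 2 + α by rw [hu]; ring, ← hT] at key
      rw [hbe, hce, hhe, mul_assoc (2 * R) _ (Real.cos α), mul_assoc (2 * R) _ (Real.sin α), key]
      have h4 : 0 < Z ^ 2 + T * Z +
          (4 * R ^ 2) ^ 2 * (Real.sin u * Real.sin (u + γ) * Real.sin (u + γ + α)) ^ 2 := by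
        have : 0 < Z * (Z + T) := mul_pos hZ (by linarith)
        have : 0 ≤ (4 * R ^ 2) ^ 2 *
          (Real.sin u * Real.sin (u + γ) * Real.sin (u + γ + α)) ^ 2 := by positivity
        linarith
      have h5 := mul_pos (mul_pos hk (pow_pos hZ 2)) h4
      linarith

/-! ### The ideal of the deltoidal surface -/

/-- The equation of the deltoidal surface. -/
def deltoidalPoly (b c h : ℝ) : MvPolynomial (Fin 3) ℝ :=
  delt (C b) (C c) (C h) (X 0) (X 1) (X 2 ^ 2)

lemma evalAt_deltoidalPoly (b c h : ℝ) (P : Space) :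
    evalAt (deltoidalPoly b c h) P = delt b c h (P 0) (P 1) (P 2 ^ 2) := by
  rw [evalAt, deltoidalPoly, map_delt]
  simp

/-- A polynomial in three variables as a polynomial in the last one. -/
def lastVariable : MvPolynomial (Fin 3) ℝ ≃ₐ[ℝ] Polynomial (MvPolynomial (Fin 2) ℝ) :=
  (renameEquiv ℝ (finRotate 3)).trans (finSuccEquiv ℝ 2)

lemma lastVariable_X_zero : lastVariable (X 0) = Polynomial.C (X 0) := by
  rw [lastVariable, AlgEquiv.trans_apply, renameEquiv_apply, rename_X,
    show finRotate 3 0 = Fin.succ 0 from rfl, finSuccEquiv_X_succ]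

lemma lastVariable_X_one : lastVariable (X 1) = Polynomial.C (X 1) := by
  rw [lastVariable, AlgEquiv.trans_apply, renameEquiv_apply, rename_X,
    show finRotate 3 1 = Fin.succ 1 from rfl, finSuccEquiv_X_succ]

lemma lastVariable_X_two : lastVariable (X 2) = Polynomial.X := by
  rw [lastVariable, AlgEquiv.trans_apply, renameEquiv_apply, rename_X,
    show finRotate 3 2 = 0 from rfl, finSuccEquiv_X_zero]

lemma lastVariable_C (r : ℝ) : lastVariable (C r) = Polynomial.C (C r) := by
  rw [lastVariable, AlgEquiv.trans_apply, renameEquiv_apply, rename_C]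
  simp [finSuccEquiv_apply]

lemma lastVariable_deltoidalPoly (b c h : ℝ) :
    lastVariable (deltoidalPoly b c h) = Polynomial.expand _ 2 (deltPoly b c h) := by
  rw [deltoidalPoly, deltPoly, map_delt, map_delt, map_pow, lastVariable_C, lastVariable_C,
    lastVariable_C, lastVariable_X_zero, lastVariable_X_one, lastVariable_X_two]
  simp

lemma evalXYZ_lastVariable (x y z : ℝ) (p : MvPolynomial (Fin 3) ℝ) :
    evalXYZ x y z (lastVariable p) = eval ![x, y, z] p := by
  have h : (evalXYZ x y z).comp (lastVariable : _ →ₐ[ℝ] _).toRingHom = eval ![x, y, z] := by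
    refine ringHom_ext (fun a => ?_) fun i => ?_
    · simp [lastVariable_C, evalXYZ]
    · fin_cases i
      · simp [lastVariable_X_zero, evalXYZ]
      · simp [lastVariable_X_one, evalXYZ]
      · simp [lastVariable_X_two, evalXYZ]
  exact congrArg (fun φ => φ p) h

lemma evalXYZ_expand (x y z : ℝ) (p : Polynomial (MvPolynomial (Fin 2) ℝ)) :
    evalXYZ x y z (Polynomial.expand _ 2 p) = evalXYZ x y (z ^ 2) p := by
  have h : (evalXYZ x y z).comp (Polynomial.expand (MvPolynomial (Fin 2) ℝ) 2).toRingHom =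
      evalXYZ x y (z ^ 2) :=
    Polynomial.ringHom_ext (fun a => by simp [evalXYZ]) (by simp [evalXYZ])
  exact congrArg (fun φ => φ p) h

/-- Even and odd part of a polynomial. -/
lemma expand_contract_add {R : Type*} [CommRing R] (p : Polynomial R) :
    Polynomial.expand R 2 (p.contract 2) + Polynomial.X * Polynomial.expand R 2 (p.divX.contract 2) =
      p := by
  ext n
  rw [Polynomial.coeff_add]
  obtain ⟨k, rfl | rfl⟩ := n.even_or_odd'
  · rw [Polynomial.coeff_expand_mul' (by norm_num), Polynomial.coeff_contract (by norm_num)]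
    rcases k with _ | k
    · simp
    · rw [show 2 * (k + 1) = 2 * k + 1 + 1 by ring, Polynomial.coeff_X_mul,
        Polynomial.coeff_expand (by norm_num), if_neg (by omega), add_zero,
        show (k + 1) * 2 = 2 * k + 1 + 1 by ring]
  · rw [Polynomial.coeff_X_mul, Polynomial.coeff_expand_mul' (by norm_num),
      Polynomial.coeff_contract (by norm_num), Polynomial.coeff_divX,
      Polynomial.coeff_expand (by norm_num), if_neg (by omega), zero_add, mul_comm k 2]

lemma mem_deltoidalIdeal_iff {b c h : ℝ} {p : MvPolynomial (Fin 3) ℝ} :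
    p ∈ deltoidalIdeal b c h ↔ ∀ P ∈ complementarySet b c h, evalAt p P = 0 := by
  rw [deltoidalIdeal, mem_vanishingIdeal_iff, Set.forall_mem_image]
  rfl

/-- The ideal of the deltoidal surface is generated by its equation. -/
theorem deltoidalIdeal_eq_span {b c h : ℝ} (hb : 0 < b) (hh : 0 < h) :
    deltoidalIdeal b c h = Ideal.span {deltoidalPoly b c h} := by
  refine le_antisymm (fun p hp => ?_) ?_
  · rw [mem_deltoidalIdeal_iff] at hp
    rw [Ideal.mem_span_singleton]
    obtain ⟨S, hS, hSc⟩ := exists_infinite_complementary (c := c) hb hh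
    -- Split p = u(x, y, z²) + z v(x, y, z²). The complementary points come in pairs ±z with z ≠ 0,
    -- so u and v vanish there separately.
    set u := (lastVariable p).contract 2
    set v := (lastVariable p).divX.contract 2
    have huv : Polynomial.expand _ 2 u + Polynomial.X * Polynomial.expand _ 2 v = lastVariable p :=
      expand_contract_add _
    have hval : ∀ x y z : ℝ, !₂[x, y, z] ∈ complementarySet b c h →
        evalXYZ x y (z ^ 2) u + z * evalXYZ x y (z ^ 2) v = 0 := fun x y z hmem => by
      have h1 := hp _ hmem
      have h2 : (fun i => (!₂[x, y, z] : Space) i) = ![x, y, z] := rfl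
      rw [evalAt, h2, ← evalXYZ_lastVariable, ← huv, map_add, map_mul, evalXYZ_expand,
        evalXYZ_expand] at h1
      simpa [evalXYZ] using h1
    have hzero : ∀ x y z : ℝ, z ≠ 0 → !₂[x, y, z] ∈ complementarySet b c h →
        !₂[x, y, -z] ∈ complementarySet b c h →
        evalXYZ x y (z ^ 2) u = 0 ∧ evalXYZ x y (z ^ 2) v = 0 := fun x y z hz h1 h2 => by
      have e1 := hval x y z h1
      have e2 := hval x y (-z) h2
      rw [neg_sq] at e2
      refine ⟨by linarith, ?_⟩
      have : z * evalXYZ x y (z ^ 2) v = 0 := by linarith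
      exact (mul_eq_zero.1 this).resolve_left hz
    have hu : deltPoly b c h ∣ u := deltPoly_dvd_of_infinite hb hh hS fun y hy =>
      (hSc y hy).mono fun Z => by
        rintro ⟨x, hx, z, hz, rfl, h1, h2⟩
        exact ⟨x, hx, (hzero x y z hz h1 h2).1⟩
    have hv : deltPoly b c h ∣ v := deltPoly_dvd_of_infinite hb hh hS fun y hy =>
      (hSc y hy).mono fun Z => by
        rintro ⟨x, hx, z, hz, rfl, h1, h2⟩
        exact ⟨x, hx, (hzero x y z hz h1 h2).2⟩
    rw [← map_dvd_iff lastVariable, lastVariable_deltoidalPoly, ← huv]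
    exact dvd_add (map_dvd _ hu) ((map_dvd _ hv).mul_left _)
  · rw [Ideal.span_singleton_le_iff_mem, mem_deltoidalIdeal_iff]
    rintro P ⟨O, hO, hc⟩
    rw [evalAt_deltoidalPoly]
    exact delt_eq_zero_of_isComplementary hb hh hO hc

theorem deltoidalSurface_eq {b c h : ℝ} (hb : 0 < b) (hh : 0 < h) :
    deltoidalSurface b c h = {P | evalAt (deltoidalPoly b c h) P = 0} := by
  ext P
  refine ⟨fun hP => hP _ ?_, fun hP p hp => ?_⟩
  · rw [deltoidalIdeal_eq_span hb hh]
    exact Ideal.mem_span_singleton_self _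
  · rw [deltoidalIdeal_eq_span hb hh, Ideal.mem_span_singleton] at hp
    obtain ⟨q, rfl⟩ := hp
    have : evalAt (deltoidalPoly b c h) P = 0 := hP
    rw [evalAt] at this ⊢
    rw [map_mul, this, zero_mul]

/-- The lower bound comes from the term in Z⁴ = z⁸, whose coefficient `deltLead` has degree four. -/
theorem totalDegree_deltoidalPoly {b c h : ℝ} (hb : 0 < b) (hh : 0 < h) :
    (deltoidalPoly b c h).totalDegree = 12 := by
  refine le_antisymm (totalDegree_delt_le b c h (by simp [totalDegree_X]) (by simp [totalDegree_X])
    ((totalDegree_pow _ _).trans (by simp [totalDegree_X]))) ?_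
  have h1 : squareSubst (deltPoly b c h) = rename (finRotate 3) (deltoidalPoly b c h) := by
    rw [squareSubst_deltPoly, deltoidalPoly, map_delt, map_pow, rename_C, rename_C, rename_C,
      rename_X, rename_X, rename_X]
    rfl
  have h2 := totalDegree_coeff_add_le (deltPoly b c h) (i := 4) (by
    rw [(natDegree_deltPoly_le b c h).2]
    exact (irreducible_deltLead hb hh).ne_zero)
  rw [(natDegree_deltPoly_le b c h).2, totalDegree_deltLead hb hh, h1] at h2
  exact h2.trans (totalDegree_rename_le _ _)

/-! ### Derivatives of the equation -/

/-- The chain rule for a polynomial along a curve. -/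
lemma hasDerivAt_eval {p : MvPolynomial (Fin 3) ℝ} {φ : Fin 3 → ℝ → ℝ} {φ' : Fin 3 → ℝ} {t : ℝ}
    (hφ : ∀ i, HasDerivAt (φ i) (φ' i) t) :
    HasDerivAt (fun s => eval (fun i => φ i s) p)
      (∑ i, eval (fun i => φ i t) (pderiv i p) * φ' i) t := by
  induction p using MvPolynomial.induction_on with
  | C a => simpa using hasDerivAt_const t a
  | add p q hp hq =>
    simp only [map_add, add_mul, Finset.sum_add_distrib]
    exact hp.fun_add hq
  | mul_X p n hp =>
    simp only [map_mul, eval_X]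
    refine (hp.fun_mul (hφ n)).congr_deriv ?_
    simp only [Derivation.leibniz, smul_eq_mul, map_add, map_mul, eval_X, pderiv_X, add_mul,
      Finset.sum_add_distrib]
    rw [add_comm, Finset.sum_mul]
    congr 1
    · rw [Finset.sum_eq_single n]
      · simp
      · intro i _ hi
        simp [hi.symm]
      · simp
    · exact Finset.sum_congr rfl fun i _ => by ring

lemma hasDerivAt_cubicDisc {k₀ k₁ k₂ k₃ : ℝ → ℝ} {n₀ n₁ n₂ n₃ t : ℝ} (h₀ : HasDerivAt k₀ n₀ t)
    (h₁ : HasDerivAt k₁ n₁ t) (h₂ : HasDerivAt k₂ n₂ t) (h₃ : HasDerivAt k₃ n₃ t) :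
    HasDerivAt (fun s => cubicDisc (k₀ s) (k₁ s) (k₂ s) (k₃ s))
      ((-4 * k₂ t ^ 3 - 54 * k₀ t * k₃ t ^ 2 + 18 * k₁ t * k₂ t * k₃ t) * n₀ +
        (2 * k₁ t * k₂ t ^ 2 - 12 * k₁ t ^ 2 * k₃ t + 18 * k₀ t * k₂ t * k₃ t) * n₁ +
        (2 * k₁ t ^ 2 * k₂ t - 12 * k₀ t * k₂ t ^ 2 + 18 * k₀ t * k₁ t * k₃ t) * n₂ +
        (-4 * k₁ t ^ 3 - 54 * k₀ t ^ 2 * k₃ t + 18 * k₀ t * k₁ t * k₂ t) * n₃) t := by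
  simp only [cubicDisc]
  refine ((((((h₁.fun_pow 2).fun_mul (h₂.fun_pow 2)).fun_sub
    ((h₀.const_mul 4).fun_mul (h₂.fun_pow 3))).fun_sub
    (((h₁.fun_pow 3).const_mul 4).fun_mul h₃)).fun_sub
    (((h₀.fun_pow 2).const_mul 27).fun_mul (h₃.fun_pow 2))).fun_add
    ((((h₀.const_mul 18).fun_mul h₁).fun_mul h₂).fun_mul h₃)).congr_deriv ?_
  push_cast
  ring

/-- The derivative of the discriminant at the product of a linear form and a quadratic form that
vanishes at the root of the linear form. -/
lemma cubicDisc_deriv_ne_zero {k l₀ l₁ q₀ q₁ q₂ n₀ n₁ n₂ n₃ : ℝ} (hk : k ≠ 0)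
    (hl : l₀ ≠ 0 ∨ l₁ ≠ 0) (hroot : q₀ * l₁ ^ 2 - q₁ * l₁ * l₀ + q₂ * l₀ ^ 2 = 0)
    (hdisc : q₁ ^ 2 - 4 * q₀ * q₂ ≠ 0)
    (hn : n₀ * l₁ ^ 3 - n₁ * l₁ ^ 2 * l₀ + n₂ * l₁ * l₀ ^ 2 - n₃ * l₀ ^ 3 ≠ 0)
    {k₀ k₁ k₂ k₃ : ℝ} (h₀ : k₀ = k * (l₀ * q₀)) (h₁ : k₁ = k * (l₀ * q₁ + l₁ * q₀))
    (h₂ : k₂ = k * (l₀ * q₂ + l₁ * q₁)) (h₃ : k₃ = k * (l₁ * q₂)) :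
    (-4 * k₂ ^ 3 - 54 * k₀ * k₃ ^ 2 + 18 * k₁ * k₂ * k₃) * n₀ +
      (2 * k₁ * k₂ ^ 2 - 12 * k₁ ^ 2 * k₃ + 18 * k₀ * k₂ * k₃) * n₁ +
      (2 * k₁ ^ 2 * k₂ - 12 * k₀ * k₂ ^ 2 + 18 * k₀ * k₁ * k₃) * n₂ +
      (-4 * k₁ ^ 3 - 54 * k₀ ^ 2 * k₃ + 18 * k₀ * k₁ * k₂) * n₃ ≠ 0 := by
  -- The quadratic form has the linear form l as a factor; the cofactor m gives the simple root of
  -- the cubic.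
  obtain ⟨m₀, m₁, e0, e1, e2⟩ : ∃ m₀ m₁, q₀ = l₀ * m₀ ∧ q₁ = l₀ * m₁ + l₁ * m₀ ∧ q₂ = l₁ * m₁ := by
    by_cases h0 : l₀ = 0
    · have h1 : l₁ ≠ 0 := hl.resolve_left (by simpa using h0)
      subst h0
      have hq0 : q₀ = 0 := by
        have : q₀ * l₁ ^ 2 = 0 := by linear_combination hroot
        exact (mul_eq_zero.1 this).resolve_right (by positivity)
      exact ⟨q₁ / l₁, q₂ / l₁, by simpa using hq0, by field_simp; ring, by field_simp⟩
    · refine ⟨q₀ / l₀, (q₁ - l₁ * (q₀ / l₀)) / l₀, by field_simp, by field_simp; ring, ?_⟩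
      field_simp
      linear_combination hroot
  subst e0 e1 e2 h₀ h₁ h₂ h₃
  have hd : l₀ * m₁ - l₁ * m₀ ≠ 0 := fun h0 => hdisc (by
    linear_combination (l₀ * m₁ - l₁ * m₀) * h0)
  -- The derivative of the discriminant at a cubic with one double root is, up to a nonzero factor,
  -- the value of the perturbation n at that root.
  have key : -4 * k ^ 3 * (l₁ * m₀ - l₀ * m₁) ^ 3 *
      (n₀ * l₁ ^ 3 - n₁ * l₁ ^ 2 * l₀ + n₂ * l₁ * l₀ ^ 2 - n₃ * l₀ ^ 3) ≠ 0 := by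
    refine mul_ne_zero (mul_ne_zero (mul_ne_zero (by norm_num) (pow_ne_zero 3 hk))
      (pow_ne_zero 3 fun h0 => hd (by linarith))) hn
  intro h0
  apply key
  rw [← h0]
  ring

/-! ### The derivative of the cubic along curves -/

section GramDeriv

variable {p q r l m n : ℝ → ℝ} {p' q' r' l' m' n' x : ℝ}

/-- The derivative of the cubic along a curve of camera centres. -/
lemma exists_hasDerivAt_gram (hp : HasDerivAt p p' x) (hq : HasDerivAt q q' x)
    (hr : HasDerivAt r r' x) (hl : HasDerivAt l l' x) (hm : HasDerivAt m m' x)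
    (hn : HasDerivAt n n' x) (hAB : p' + q' - 2 * l' = 0) (hAC : p' + r' - 2 * m' = 0)
    (hBC : q' + r' - 2 * n' = 0) :
    ∃ n₀ n₁ n₂ n₃ : ℝ,
      HasDerivAt (fun t => gramS3 (p t) (q t) (r t) (l t) (m t) (n t)) n₀ x ∧
      HasDerivAt (fun t => gramS2T (p t) (q t) (r t) (l t) (m t) (n t)) n₁ x ∧
      HasDerivAt (fun t => gramST2 (p t) (q t) (r t) (l t) (m t) (n t)) n₂ x ∧
      HasDerivAt (fun t => gramT3 (p t) (q t) (r t) (l t) (m t) (n t)) n₃ x ∧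
      ∀ s t : ℝ, n₀ * s ^ 3 + n₁ * s ^ 2 * t + n₂ * s * t ^ 2 + n₃ * t ^ 3 =
        (p x + q x - 2 * l x) *
          (t * (r' - m') * (q x * s ^ 2 + r x * t ^ 2 - 2 * n x * s * t) -
            (s * (q' - n') + t * (r' - n')) * (r x * t ^ 2)) -
        (p x + r x - 2 * m x) *
          (s * (q' - l') * (q x * s ^ 2 + r x * t ^ 2 - 2 * n x * s * t) -
            (s * (q' - n') + t * (r' - n')) * (q x * s ^ 2)) +
        (q x + r x - 2 * n x) *
          (s * (q' - l') * (r x * t ^ 2) - t * (r' - m') * (q x * s ^ 2)) +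
        ((p x + q x - 2 * l x) *
          (t * (r x - m x) * (q' * s ^ 2 + r' * t ^ 2 - 2 * n' * s * t) -
            (s * (q x - n x) + t * (r x - n x)) * (r' * t ^ 2)) -
        (p x + r x - 2 * m x) *
          (s * (q x - l x) * (q' * s ^ 2 + r' * t ^ 2 - 2 * n' * s * t) -
            (s * (q x - n x) + t * (r x - n x)) * (q' * s ^ 2)) +
        (q x + r x - 2 * n x) *
          (s * (q x - l x) * (r' * t ^ 2) - t * (r x - m x) * (q' * s ^ 2))) := by
  -- The squared sides do not change along the curve. So in the cubic det(c, b, q) only b and q are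
  -- differentiated, which gives the two determinants in the formula.
  have cAB := (hp.fun_add hq).fun_sub (hl.const_mul 2)
  have cAC := (hp.fun_add hr).fun_sub (hm.const_mul 2)
  have cBC := (hq.fun_add hr).fun_sub (hn.const_mul 2)
  rw [hAB] at cAB
  rw [hAC] at cAC
  rw [hBC] at cBC
  refine ⟨_, _, _, _,
    (cAC.fun_neg.fun_mul hq).fun_mul ((hq.fun_sub hl).fun_sub (hq.fun_sub hn)),
    (((cAB.fun_mul (hr.fun_sub hm)).fun_mul hq).fun_add (cAC.fun_mul
      ((((hq.fun_sub hl).const_mul 2).fun_mul hn).fun_add (hq.fun_mul (hr.fun_sub hn))))).fun_sub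
      ((cBC.fun_mul hq).fun_mul (hr.fun_sub hm)),
    ((cAB.fun_mul ((((hr.fun_sub hm).const_mul (-2)).fun_mul hn).fun_sub
      (hr.fun_mul (hq.fun_sub hn)))).fun_sub
      ((cAC.fun_mul (hq.fun_sub hl)).fun_mul hr)).fun_add
      ((cBC.fun_mul (hq.fun_sub hl)).fun_mul hr),
    (cAB.fun_mul hr).fun_mul ((hr.fun_sub hm).fun_sub (hr.fun_sub hn)), fun s t => ?_⟩
  ring

end GramDeriv

/-! ### The radial derivative at the generatrices of contact -/

section Radial

variable {a A b B c C : ℝ} (hA : A ^ 2 + a ^ 2 = 1) (hB : B ^ 2 + b ^ 2 = 1)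
  (hC : C ^ 2 + c ^ 2 = 1)

include hA hB hC in
/-- The value of the derivative of the cubic at the distinguished root. -/
lemma gram_radial_value (R r Z : ℝ) :
    ∀ s t : ℝ, s = (a * B - A * b) * c → t = -((c * A - C * a) * b) →
      (r * (a * B - A * b) ^ 2) *
          (t * (2 * R * (c ^ 2 - a ^ 2)) * ((Z + r * b ^ 2) * s ^ 2 + (Z + r * c ^ 2) * t ^ 2 -
              2 * (Z + r * (b * c * (B * C + b * c))) * s * t) -
            (s - t) * (2 * R * (b ^ 2 - c ^ 2)) * ((Z + r * c ^ 2) * t ^ 2)) -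
        (r * (c * A - C * a) ^ 2) *
          (s * (2 * R * (b ^ 2 - a ^ 2)) * ((Z + r * b ^ 2) * s ^ 2 + (Z + r * c ^ 2) * t ^ 2 -
              2 * (Z + r * (b * c * (B * C + b * c))) * s * t) -
            (s - t) * (2 * R * (b ^ 2 - c ^ 2)) * ((Z + r * b ^ 2) * s ^ 2)) +
        (r * (b * C - B * c) ^ 2) *
          (s * (2 * R * (b ^ 2 - a ^ 2)) * ((Z + r * c ^ 2) * t ^ 2) -
            t * (2 * R * (c ^ 2 - a ^ 2)) * ((Z + r * b ^ 2) * s ^ 2)) =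
      2 * R * r * Z * sinProd a A b B c C ^ 3 *
        (a * B * C + A * b * C + A * B * c - a * b * c) := by
  rintro s t rfl rfl
  have e : ∀ {a A b B : ℝ}, A ^ 2 + a ^ 2 = 1 → B ^ 2 + b ^ 2 = 1 →
      b ^ 2 - a ^ 2 = -(a * B - A * b) * (b * A + B * a) := by
    intro a A b B hA hB
    linear_combination (-b ^ 2) * hA + a ^ 2 * hB
  have hst : (a * B - A * b) * c - -((c * A - C * a) * b) = -(a * (b * C - B * c)) := by ring
  have hD : (a * B - A * b) ^ 2 + (c * A - C * a) ^ 2 +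
      2 * (a * B - A * b) * (c * A - C * a) * (B * C + b * c) = (b * C - B * c) ^ 2 := by
    linear_combination (-2 * B * b * C * c - 2 * b ^ 2 * c ^ 2 + b ^ 2 + c ^ 2) * hA +
      (2 * A * a * C * c - 2 * a ^ 2 * C ^ 2 + a ^ 2 - c ^ 2) * hB +
      (2 * A * a * B * b + 2 * a ^ 2 * b ^ 2 - a ^ 2 - b ^ 2) * hC
  have hQ : (Z + r * b ^ 2) * ((a * B - A * b) * c) ^ 2 +
      (Z + r * c ^ 2) * (-((c * A - C * a) * b)) ^ 2 -
      2 * (Z + r * (b * c * (B * C + b * c))) * ((a * B - A * b) * c) * (-((c * A - C * a) * b)) =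
      Z * (a * (b * C - B * c)) ^ 2 + r * (b * c) ^ 2 * (b * C - B * c) ^ 2 := by
    linear_combination r * (b * c) ^ 2 * hD
  have hdet : c * (b * A + B * a) * (b ^ 2 - a ^ 2) + b * (c * A + C * a) * (a ^ 2 - c ^ 2) +
      a * (b * C + B * c) * (c ^ 2 - b ^ 2) = -sinProd a A b B c C *
      (a * B * C + A * b * C + A * B * c - a * b * c) := by
    simp only [sinProd]
    linear_combination (A * B ^ 2 * b * c ^ 3 - A * b ^ 3 * C ^ 2 * c - a * B ^ 3 * c ^ 3 - a * B * b ^ 2 * c ^ 3 + a * b ^ 3 * C ^ 3 + a * b ^ 3 * C * c ^ 2) * hA +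
      (A * b * c ^ 3 + a ^ 3 * B * C ^ 2 * c + a ^ 3 * B * c ^ 3 - a ^ 3 * b * C ^ 3 - a ^ 3 * b * C * c ^ 2 - a * B * c ^ 3) * hB +
      (-A * b ^ 3 * c + a ^ 3 * B * c - a ^ 3 * b * C + a * b ^ 3 * C) * hC
  have e1 := e hA hB
  have e2 := e hA hC
  have e3 := e hC hB
  rw [hQ, hst, e1, e2, e3]
  trans -(2 * R * r * Z * sinProd a A b B c C ^ 2) * (c * (b * A + B * a) * (b ^ 2 - a ^ 2) +
    b * (c * A + C * a) * (a ^ 2 - c ^ 2) + a * (b * C + B * c) * (c ^ 2 - b ^ 2))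
  · simp only [sinProd]
    ring
  · rw [hdet]
    ring

include hA hB hC in
/-- The derivative of the equation of the deltoidal surface in the radial direction does not vanish
at the points of contact with the danger cylinder. -/
lemma exists_hasDerivAt_delt_radial {R z : ℝ} (hR : R ≠ 0) (hz : z ≠ 0)
    (hp : sinProd a A b B c C ≠ 0) (hcos : cosSum a A b B c C = 0)
    (hsin : a * B * C + A * b * C + A * B * c - a * b * c ≠ 0)
    (hY : (z ^ 2) ^ 2 + 4 * R ^ 2 * (a ^ 2 + b ^ 2 + c ^ 2 - 1) * z ^ 2 +
      (4 * R ^ 2) ^ 2 * (a * b * c) ^ 2 ≠ 0) :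
    ∃ d ≠ 0, HasDerivAt (fun t => delt (2 * R * (b * A - a * B))
      (2 * R * ((c * A - C * a) * (C * B + c * b))) (2 * R * ((c * A - C * a) * (c * B - C * b)))
      (-2 * R * (a * B) - t * (a * B + A * b)) (2 * R * (a * b) - t * (A * B - a * b)) (z ^ 2))
      d 0 := by
  have hg : ∀ k w : ℝ, HasDerivAt (fun t : ℝ => z ^ 2 + k + 2 * R * w * t + t ^ 2) (2 * R * w) 0 := by
    intro k w
    refine ((((hasDerivAt_id' (0 : ℝ)).const_mul (2 * R * w)).const_add (z ^ 2 + k)).fun_add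
      ((hasDerivAt_id' (0 : ℝ)).fun_pow 2)).congr_deriv ?_
    norm_num
  -- Moving outwards by t along the normal adds t times the inward unit normal ν to each vector from
  -- the point to a vertex. A vertex of half angle a has ν-component 2R a², so the inner products
  -- grow by 2R(a² + b²)t + t².
  obtain ⟨n₀, n₁, n₂, n₃, d₀, d₁, d₂, d₃, hval⟩ := exists_hasDerivAt_gram
    (hg (4 * R ^ 2 * a ^ 2) (a ^ 2 + a ^ 2)) (hg (4 * R ^ 2 * b ^ 2) (b ^ 2 + b ^ 2))
    (hg (4 * R ^ 2 * c ^ 2) (c ^ 2 + c ^ 2))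
    (hg (4 * R ^ 2 * (a * b * (A * B + a * b))) (a ^ 2 + b ^ 2))
    (hg (4 * R ^ 2 * (a * c * (A * C + a * c))) (a ^ 2 + c ^ 2))
    (hg (4 * R ^ 2 * (b * c * (B * C + b * c))) (b ^ 2 + c ^ 2)) (by ring) (by ring) (by ring)
  obtain ⟨f₀, f₁, f₂, f₃⟩ := gram_cubic_factor (4 * R ^ 2) (z ^ 2) hA hB hC
  have key := hasDerivAt_cubicDisc d₀ d₁ d₂ d₃
  simp only [mul_zero, add_zero, ne_eq, OfNat.ofNat_ne_zero, not_false_eq_true, zero_pow] at key hval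
  refine ⟨_, ?_, key.congr_of_eventuallyEq (Filter.Eventually.of_forall fun t => ?_)⟩
  · have hD1 : a * B - A * b ≠ 0 := fun h => hp (by simp [sinProd, h])
    have hD3 : c * A - C * a ≠ 0 := fun h => hp (by simp [sinProd, h])
    have hr : (4 * R ^ 2) ^ 2 ≠ 0 := by positivity
    refine cubicDisc_deriv_ne_zero hr ?_ ?_ ?_ ?_ f₀ f₁ f₂ f₃
    · by_contra! h
      have hb : b = 0 := (mul_eq_zero.1 h.1).resolve_left hD3
      have hc : c = 0 := (mul_eq_zero.1 h.2).resolve_left hD1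
      exact hp (by simp [sinProd, hb, hc])
    · rw [quad_root _ _ hA hB hC, hcos, mul_zero]
    · rw [quad_disc _ _ hA hB hC]
      exact mul_ne_zero (by positivity) hY
    · have h1 := hval ((a * B - A * b) * c) (-((c * A - C * a) * b))
      have h2 := gram_radial_value hA hB hC R (4 * R ^ 2) (z ^ 2) _ _ rfl rfl
      have h3 : 2 * R * (4 * R ^ 2) * z ^ 2 * sinProd a A b B c C ^ 3 *
        (a * B * C + A * b * C + A * B * c - a * b * c) ≠ 0 := by
        refine mul_ne_zero (by positivity) hsin
      have e : ∀ {a A b B : ℝ}, A ^ 2 + a ^ 2 = 1 → B ^ 2 + b ^ 2 = 1 →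
          a ^ 2 - a * b * (A * B + a * b) = a * B * (a * B - A * b) := by
        intro a A b B _ hB
        linear_combination (-a ^ 2) * hB
      have c1 : z ^ 2 + 4 * R ^ 2 * a ^ 2 + (z ^ 2 + 4 * R ^ 2 * b ^ 2) -
          2 * (z ^ 2 + 4 * R ^ 2 * (a * b * (A * B + a * b))) =
          4 * R ^ 2 * (a * B - A * b) ^ 2 := by
        linear_combination 4 * R ^ 2 * (e hA hB + e hB hA)
      have c2 : z ^ 2 + 4 * R ^ 2 * a ^ 2 + (z ^ 2 + 4 * R ^ 2 * c ^ 2) -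
          2 * (z ^ 2 + 4 * R ^ 2 * (a * c * (A * C + a * c))) =
          4 * R ^ 2 * (c * A - C * a) ^ 2 := by
        linear_combination 4 * R ^ 2 * (e hA hC + e hC hA)
      have c3 : z ^ 2 + 4 * R ^ 2 * b ^ 2 + (z ^ 2 + 4 * R ^ 2 * c ^ 2) -
          2 * (z ^ 2 + 4 * R ^ 2 * (b * c * (B * C + b * c))) =
          4 * R ^ 2 * (b * C - B * c) ^ 2 := by
        linear_combination 4 * R ^ 2 * (e hB hC + e hC hB)
      -- At the root of the linear factor the vector b of the determinant is -Abc times the vector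
      -- of the squared sides. Hence the determinant with q' drops out, and the one computed in
      -- `gram_radial_value` remains.
      have b1 : (a * B - A * b) * c * (z ^ 2 + 4 * R ^ 2 * b ^ 2 -
          (z ^ 2 + 4 * R ^ 2 * (a * b * (A * B + a * b)))) =
          -(A * b * c) * (4 * R ^ 2 * (a * B - A * b) ^ 2) := by
        linear_combination 4 * R ^ 2 * (a * B - A * b) * c * e hB hA
      have b2 : -((c * A - C * a) * b) * (z ^ 2 + 4 * R ^ 2 * c ^ 2 -
          (z ^ 2 + 4 * R ^ 2 * (a * c * (A * C + a * c)))) =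
          -(A * b * c) * (4 * R ^ 2 * (c * A - C * a) ^ 2) := by
        linear_combination -4 * R ^ 2 * (c * A - C * a) * b * e hC hA
      have b3 : (a * B - A * b) * c * (z ^ 2 + 4 * R ^ 2 * b ^ 2 -
          (z ^ 2 + 4 * R ^ 2 * (b * c * (B * C + b * c)))) +
          -((c * A - C * a) * b) * (z ^ 2 + 4 * R ^ 2 * c ^ 2 -
          (z ^ 2 + 4 * R ^ 2 * (b * c * (B * C + b * c)))) =
          -(A * b * c) * (4 * R ^ 2 * (b * C - B * c) ^ 2) := by
        linear_combination 4 * R ^ 2 * (a * B - A * b) * c * e hB hC -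
          4 * R ^ 2 * (c * A - C * a) * b * e hC hB
      rw [c1, c2, c3, b1, b2, b3] at h1
      rw [← h2] at h3
      clear h2 hval key d₀ d₁ d₂ d₃ f₀ f₁ f₂ f₃ c1 c2 c3 b1 b2 b3 hg hp hY hsin hcos
      intro h0
      apply h3
      rw [← h0]
      generalize (a * B - A * b) = D₁ at h1 ⊢
      generalize (c * A - C * a) = D₃ at h1 ⊢
      generalize (b * C - B * c) = D₂ at h1 ⊢
      generalize B * C + b * c = w at h1 ⊢
      linear_combination -h1
  · have n1 : (A * C * B + c * A * b + c * a * B - C * a * b) ^ 2 +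
        (c * A * B - C * A * b - C * a * B - c * a * b) ^ 2 = 1 := by
      linear_combination (B ^ 2 + b ^ 2) * (C ^ 2 + c ^ 2) * hA + (C ^ 2 + c ^ 2) * hB + hC
    have n2 : B * (A * C * B + c * A * b + c * a * B - C * a * b) -
        b * (c * A * B - C * A * b - C * a * B - c * a * b) = A * C + a * c := by
      linear_combination (A * C + a * c) * hB
    have n3 : A * (A * C * B + c * A * b + c * a * B - C * a * b) -
        a * (c * A * B - C * A * b - C * a * B - c * a * b) = B * C + b * c := by
      linear_combination (B * C + b * c) * hA
    have n4 : (A * C * B + c * A * b + c * a * B - C * a * b) * (a * B + A * b) +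
        (c * A * B - C * A * b - C * a * B - c * a * b) * (A * B - a * b) = c := by
      linear_combination c * (B ^ 2 + b ^ 2) * hA + c * hB
    have n5 : (a * B + A * b) ^ 2 + (A * B - a * b) ^ 2 = 1 := by
      linear_combination (B ^ 2 + b ^ 2) * hA + hB
    have vx : 2 * R * ((c * A - C * a) * (C * B + c * b)) -
        (-2 * R * (a * B) - t * (a * B + A * b)) =
        2 * R * c * (A * C * B + c * A * b + c * a * B - C * a * b) + t * (a * B + A * b) := by
      linear_combination (-2 * R * a * B) * hC
    have vy : 2 * R * ((c * A - C * a) * (c * B - C * b)) -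
        (2 * R * (a * b) - t * (A * B - a * b)) =
        2 * R * c * (c * A * B - C * A * b - C * a * B - c * a * b) + t * (A * B - a * b) := by
      linear_combination (2 * R * a * b) * hC
    have ux : 2 * R * (b * A - a * B) - (-2 * R * (a * B) - t * (a * B + A * b)) =
        2 * R * b * A + t * (a * B + A * b) := by ring
    simp only [delt]
    rw [coeffS3_eq_gram, coeffS2T_eq_gram, coeffST2_eq_gram, coeffT3_eq_gram]
    simp only [gAA, gBB, gCC, gAB, gAC, gBC, vx, vy, ux]
    have g1 : (-2 * R * (a * B) - t * (a * B + A * b)) ^ 2 +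
        (2 * R * (a * b) - t * (A * B - a * b)) ^ 2 + z ^ 2 =
        z ^ 2 + 4 * R ^ 2 * a ^ 2 + 2 * R * (a ^ 2 + a ^ 2) * t + t ^ 2 := by
      linear_combination (4 * R ^ 2 * a ^ 2 + 4 * R * t * a ^ 2) * hB + t ^ 2 * n5
    have g2 : (2 * R * b * A + t * (a * B + A * b)) ^ 2 +
        (2 * R * (a * b) - t * (A * B - a * b)) ^ 2 + z ^ 2 =
        z ^ 2 + 4 * R ^ 2 * b ^ 2 + 2 * R * (b ^ 2 + b ^ 2) * t + t ^ 2 := by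
      linear_combination (4 * R ^ 2 * b ^ 2 + 4 * R * t * b ^ 2) * hA + t ^ 2 * n5
    have g3 : (2 * R * c * (A * C * B + c * A * b + c * a * B - C * a * b) +
          t * (a * B + A * b)) ^ 2 +
        (2 * R * c * (c * A * B - C * A * b - C * a * B - c * a * b) + t * (A * B - a * b)) ^ 2 +
          z ^ 2 =
        z ^ 2 + 4 * R ^ 2 * c ^ 2 + 2 * R * (c ^ 2 + c ^ 2) * t + t ^ 2 := by
      linear_combination 4 * R ^ 2 * c ^ 2 * n1 + 4 * R * t * c * n4 + t ^ 2 * n5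
    have g4 : -(-2 * R * (a * B) - t * (a * B + A * b)) * (2 * R * b * A + t * (a * B + A * b)) +
        (2 * R * (a * b) - t * (A * B - a * b)) ^ 2 + z ^ 2 =
        z ^ 2 + 4 * R ^ 2 * (a * b * (A * B + a * b)) + 2 * R * (a ^ 2 + b ^ 2) * t + t ^ 2 := by
      linear_combination 2 * R * t * (b ^ 2 * hA + a ^ 2 * hB) + t ^ 2 * n5
    have g5 : -(-2 * R * (a * B) - t * (a * B + A * b)) *
          (2 * R * c * (A * C * B + c * A * b + c * a * B - C * a * b) + t * (a * B + A * b)) -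
        (2 * R * (a * b) - t * (A * B - a * b)) *
          (2 * R * c * (c * A * B - C * A * b - C * a * B - c * a * b) + t * (A * B - a * b)) +
          z ^ 2 =
        z ^ 2 + 4 * R ^ 2 * (a * c * (A * C + a * c)) + 2 * R * (a ^ 2 + c ^ 2) * t + t ^ 2 := by
      linear_combination 4 * R ^ 2 * a * c * n2 + 2 * R * t * c * n4 + 2 * R * t * a ^ 2 * hB +
        t ^ 2 * n5
    have g6 : (2 * R * b * A + t * (a * B + A * b)) *
          (2 * R * c * (A * C * B + c * A * b + c * a * B - C * a * b) + t * (a * B + A * b)) -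
        (2 * R * (a * b) - t * (A * B - a * b)) *
          (2 * R * c * (c * A * B - C * A * b - C * a * B - c * a * b) + t * (A * B - a * b)) +
          z ^ 2 =
        z ^ 2 + 4 * R ^ 2 * (b * c * (B * C + b * c)) + 2 * R * (b ^ 2 + c ^ 2) * t + t ^ 2 := by
      linear_combination 4 * R ^ 2 * b * c * n3 + 2 * R * t * c * n4 + 2 * R * t * b ^ 2 * hA +
        t ^ 2 * n5
    rw [g1, g2, g3, g4, g5, g6]

end Radial

/-! ### Tangency along the generatrices of contact -/

lemma eval_deltoidalPoly (b c h : ℝ) (v : Fin 3 → ℝ) :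
    eval v (deltoidalPoly b c h) = delt b c h (v 0) (v 1) (v 2 ^ 2) :=
  evalAt_deltoidalPoly b c h (WithLp.toLp 2 v)

/-- The gradient is determined from three curves through a point of contact: the generatrix, the
horizontal circle and the radius. -/
lemma hasDerivAt_deltoidalPoly (b c h : ℝ) (P : Space) {x y z : ℝ → ℝ} {x' y' z' t : ℝ}
    (hx : HasDerivAt x x' t) (hy : HasDerivAt y y' t) (hz : HasDerivAt z z' t)
    (h0 : x t = P 0) (h1 : y t = P 1) (h2 : z t = P 2) :
    HasDerivAt (fun s => delt b c h (x s) (y s) (z s ^ 2))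
      (gradAt (deltoidalPoly b c h) P 0 * x' + gradAt (deltoidalPoly b c h) P 1 * y' +
        gradAt (deltoidalPoly b c h) P 2 * z') t := by
  have hφ : ∀ i, HasDerivAt ((![x, y, z] : Fin 3 → ℝ → ℝ) i) ((![x', y', z'] : Fin 3 → ℝ) i) t := by
    intro i
    fin_cases i
    · exact hx
    · exact hy
    · exact hz
  have key := hasDerivAt_eval (p := deltoidalPoly b c h) hφ
  simp only [eval_deltoidalPoly] at key
  refine key.congr_deriv ?_
  have hP : (fun i => (![x, y, z] : Fin 3 → ℝ → ℝ) i t) = fun i => P i := by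
    funext i
    fin_cases i
    · exact h0
    · exact h1
    · exact h2
  rw [hP, Fin.sum_univ_three]
  rfl

section Tangency

variable {b c h R α γ u : ℝ} (hb : b = 2 * R * Real.sin γ)
  (hc : c = 2 * R * Real.sin (α + γ) * Real.cos α) (hh : h = 2 * R * Real.sin (α + γ) * Real.sin α)
  {P : Space}

include hb hc hh in
lemma gradAt_cylinderPoly (h0 : h ≠ 0) : gradAt (cylinderPoly b c h) P =
    ![2 * (P 0 - R * Real.sin γ), 2 * (P 1 - R * Real.cos γ), 0] := by
  have e : (b * c - c ^ 2 - h ^ 2) / h = -(2 * R * Real.cos γ) := by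
    rw [div_eq_iff h0, hb, hc, hh, Real.sin_add]
    linear_combination (-(4 * R ^ 2 * (Real.sin α * Real.cos γ + Real.cos α * Real.sin γ) ^ 2)) *
      Real.sin_sq_add_cos_sq α
  have e' : cylinderPoly b c h =
      X 0 ^ 2 + X 1 ^ 2 - C (2 * R * Real.sin γ) * X 0 + C (-(2 * R * Real.cos γ)) * X 1 := by
    rw [cylinderPoly, e, ← hb]
  rw [e']
  funext i
  fin_cases i <;> simp [gradAt, evalAt, pderiv_X] <;> ring

section Contact

variable (h0 : h ≠ 0) (hx : P 0 = R * Real.sin γ - R * Real.sin (2 * u + γ))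
  (hy : P 1 = R * Real.cos γ - R * Real.cos (2 * u + γ))
  (hu : Real.cos (3 * u + 2 * γ + α) = 0)

include hb hc hh hx hy hu in
-- The equation vanishes identically along the generatrix.
lemma gradAt_deltoidalPoly_two : gradAt (deltoidalPoly b c h) P 2 = 0 := by
  have key := hasDerivAt_deltoidalPoly b c h P (hasDerivAt_const (P 2) (P 0))
    (hasDerivAt_const (P 2) (P 1)) (hasDerivAt_id' (P 2)) rfl rfl rfl
  have : (fun s : ℝ => delt b c h (P 0) (P 1) (s ^ 2)) = fun _ => 0 := by
    funext s
    rw [hb, hc, hh, hx, hy, mul_assoc (2 * R) _ (Real.cos α), mul_assoc (2 * R) _ (Real.sin α),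
      delt_circle, hu]
    ring
  rw [this] at key
  have := key.unique (hasDerivAt_const (P 2) (0 : ℝ))
  linarith

include hb hc hh hx hy hu in
-- Along the horizontal circle the equation has the factor cos²(3u + 2γ + α), which vanishes to
-- second order, so the gradient has no tangential component.
lemma gradAt_deltoidalPoly_tangential (hR : R ≠ 0) :
    gradAt (deltoidalPoly b c h) P 0 * Real.cos (2 * u + γ) =
      gradAt (deltoidalPoly b c h) P 1 * Real.sin (2 * u + γ) := by
  have hl : ∀ k w : ℝ, HasDerivAt (fun s : ℝ => k * s + w) k u := by
    intro k w
    simpa using ((hasDerivAt_id' u).const_mul k).add_const w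
  have key := hasDerivAt_deltoidalPoly b c h P (((hl 2 γ).sin.const_mul R).const_sub (R * Real.sin γ))
    (((hl 2 γ).cos.const_mul R).const_sub (R * Real.cos γ)) (hasDerivAt_const u (P 2))
    hx.symm hy.symm rfl
  rw [hb, hc, hh, mul_assoc (2 * R) _ (Real.cos α), mul_assoc (2 * R) _ (Real.sin α)] at key
  simp only [delt_circle] at key
  have h1 : HasDerivAt (fun s => Real.cos (3 * s + 2 * γ + α) ^ 2) 0 u := by
    have := ((hl 3 (2 * γ + α)).cos).fun_pow 2
    simp only [← add_assoc, hu] at this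
    simpa using this
  have h2 : DifferentiableAt ℝ (fun s => 4 * (4 * R ^ 2) ^ 8 *
      (Real.sin α * Real.sin γ * Real.sin (α + γ)) ^ 6 * (P 2 ^ 2) ^ 2 *
      ((P 2 ^ 2) ^ 2 + 4 * R ^ 2 * (Real.sin s ^ 2 + Real.sin (s + γ) ^ 2 +
        Real.sin (s + γ + α) ^ 2 - 1) * P 2 ^ 2 +
        (4 * R ^ 2) ^ 2 * (Real.sin s * Real.sin (s + γ) * Real.sin (s + γ + α)) ^ 2)) u := by
    fun_prop
  have h3 := h1.fun_mul h2.hasDerivAt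
  simp only [hu] at h3
  have h4 := key.unique (h3.congr_of_eventuallyEq (Filter.Eventually.of_forall fun s => by ring))
  rw [← mul_assoc (2 * R) _ (Real.cos α), ← mul_assoc (2 * R) _ (Real.sin α), ← hb, ← hc, ← hh] at h4
  have h5 : -2 * R * (gradAt (deltoidalPoly b c h) P 0 * Real.cos (2 * u + γ) -
      gradAt (deltoidalPoly b c h) P 1 * Real.sin (2 * u + γ)) = 0 := by
    linear_combination h4
  have := (mul_eq_zero.1 h5).resolve_left (by simpa using hR)
  linarith

include hb hc hh h0 hx hy hu in
/-- The gradients are parallel along the generatrices of contact. -/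
lemma exists_gradAt_eq_smul (hR : R ≠ 0) :
    ∃ k : ℝ, gradAt (deltoidalPoly b c h) P = k • gradAt (cylinderPoly b c h) P := by
  have h1 := gradAt_deltoidalPoly_two hb hc hh hx hy hu
  have h2 := gradAt_deltoidalPoly_tangential hb hc hh hx hy hu hR
  have h3 := Real.sin_sq_add_cos_sq (2 * u + γ)
  rw [gradAt_cylinderPoly hb hc hh h0]
  refine ⟨-(gradAt (deltoidalPoly b c h) P 0 * Real.sin (2 * u + γ) +
    gradAt (deltoidalPoly b c h) P 1 * Real.cos (2 * u + γ)) / (2 * R), ?_⟩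
  funext i
  fin_cases i
  · simp [hx]
    field_simp
    linear_combination (-gradAt (deltoidalPoly b c h) P 0) * h3 + Real.cos (2 * u + γ) * h2
  · simp [hy]
    field_simp
    linear_combination (-gradAt (deltoidalPoly b c h) P 1) * h3 - Real.sin (2 * u + γ) * h2
  · simpa using h1

include hb hc hh h0 hx hy in
lemma gradAt_cylinderPoly_ne_zero (hR : R ≠ 0) : gradAt (cylinderPoly b c h) P ≠ 0 := by
  rw [gradAt_cylinderPoly hb hc hh h0, hx, hy]
  intro h
  have h1 := congrFun h 0
  have h2 := congrFun h 1
  simp [hR] at h1 h2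
  have h3 := Real.sin_sq_add_cos_sq (2 * u + γ)
  rw [h1, h2] at h3
  norm_num at h3

include hb hc hh hx hy hu in
-- The radial derivative contains the sine of the angle sum, which is ±1 where the cosine vanishes.
-- The condition `hY` keeps the double root of the cubic from becoming triple.
lemma gradAt_deltoidalPoly_ne_zero (hR : R ≠ 0) (hz : P 2 ≠ 0)
    (hp : Real.sin α * Real.sin γ * Real.sin (α + γ) ≠ 0)
    (hY : (P 2 ^ 2) ^ 2 + 4 * R ^ 2 * (Real.sin u ^ 2 + Real.sin (u + γ) ^ 2 +
      Real.sin (u + γ + α) ^ 2 - 1) * P 2 ^ 2 +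
      (4 * R ^ 2) ^ 2 * (Real.sin u * Real.sin (u + γ) * Real.sin (u + γ + α)) ^ 2 ≠ 0) :
    gradAt (deltoidalPoly b c h) P ≠ 0 := by
  have e1 : Real.sin (u + γ) * Real.cos u - Real.sin u * Real.cos (u + γ) = Real.sin γ := by
    rw [show γ = (u + γ) - u by ring, Real.sin_sub]; ring_nf
  have e2 : Real.sin (u + γ + α) * Real.cos u - Real.cos (u + γ + α) * Real.sin u =
      Real.sin (α + γ) := by
    rw [show α + γ = (u + γ + α) - u by ring, Real.sin_sub]
  have e3 : Real.cos (u + γ + α) * Real.cos (u + γ) + Real.sin (u + γ + α) * Real.sin (u + γ) =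
      Real.cos α := by
    rw [← Real.cos_sub]; ring_nf
  have e4 : Real.sin (u + γ + α) * Real.cos (u + γ) - Real.cos (u + γ + α) * Real.sin (u + γ) =
      Real.sin α := by
    rw [← Real.sin_sub]; ring_nf
  have e5 : Real.sin u * Real.cos (u + γ) + Real.cos u * Real.sin (u + γ) =
      Real.sin (2 * u + γ) := by
    rw [← Real.sin_add]; ring_nf
  have e6 : Real.cos u * Real.cos (u + γ) - Real.sin u * Real.sin (u + γ) =
      Real.cos (2 * u + γ) := by
    rw [← Real.cos_add]; ring_nf
  have e7 : -2 * R * (Real.sin u * Real.cos (u + γ)) = P 0 := by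
    rw [hx, ← e5, ← e1]; ring
  have e8 : 2 * R * (Real.sin u * Real.sin (u + γ)) = P 1 := by
    have h2 : Real.cos γ = Real.cos (u + γ) * Real.cos u + Real.sin (u + γ) * Real.sin u := by
      rw [← Real.cos_sub]; ring_nf
    rw [hy, ← e6, h2]; ring
  have e9 : cosSum (Real.sin u) (Real.cos u) (Real.sin (u + γ)) (Real.cos (u + γ))
      (Real.sin (u + γ + α)) (Real.cos (u + γ + α)) = 0 := by
    rw [← hu, show 3 * u + 2 * γ + α = u + (u + γ) + (u + γ + α) by ring,
      Real.cos_add (u + (u + γ)) (u + γ + α), Real.cos_add u (u + γ), Real.sin_add u (u + γ), cosSum]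
    ring
  have e10 : Real.sin u * Real.cos (u + γ) * Real.cos (u + γ + α) +
      Real.cos u * Real.sin (u + γ) * Real.cos (u + γ + α) +
      Real.cos u * Real.cos (u + γ) * Real.sin (u + γ + α) -
      Real.sin u * Real.sin (u + γ) * Real.sin (u + γ + α) ≠ 0 := by
    intro h
    have h1 : Real.sin (3 * u + 2 * γ + α) = 0 := by
      rw [← h, show 3 * u + 2 * γ + α = u + (u + γ) + (u + γ + α) by ring,
        Real.sin_add (u + (u + γ)) (u + γ + α), Real.cos_add u (u + γ), Real.sin_add u (u + γ)]
      ring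
    have h3 := Real.sin_sq_add_cos_sq (3 * u + 2 * γ + α)
    rw [h1, hu] at h3
    norm_num at h3
  have e11 : sinProd (Real.sin u) (Real.cos u) (Real.sin (u + γ)) (Real.cos (u + γ))
      (Real.sin (u + γ + α)) (Real.cos (u + γ + α)) ≠ 0 := by
    rw [← e1, ← e2, ← e4] at hp
    rw [sinProd]
    convert hp using 1
    ring
  obtain ⟨d, hd, key⟩ := exists_hasDerivAt_delt_radial (Real.cos_sq_add_sin_sq u)
    (Real.cos_sq_add_sin_sq (u + γ)) (Real.cos_sq_add_sin_sq (u + γ + α)) hR hz e11 e9 e10 hY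
  rw [e1, e2, e3, e4, ← mul_assoc (2 * R) _ (Real.cos α), ← mul_assoc (2 * R) _ (Real.sin α), e5,
    e6, e7, e8, ← hb, ← hc, ← hh] at key
  have key' := hasDerivAt_deltoidalPoly b c h P
    (((hasDerivAt_id' (0 : ℝ)).mul_const (Real.sin (2 * u + γ))).const_sub (P 0))
    (((hasDerivAt_id' (0 : ℝ)).mul_const (Real.cos (2 * u + γ))).const_sub (P 1))
    (hasDerivAt_const 0 (P 2)) (by simp) (by simp) rfl
  intro hg
  rw [key.unique key', hg] at hd
  simp at hd

end Contact

end Tangency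

/-! ### Morley triangles -/

/-- `Y` is reached from `X` by going a distance `L` in the horizontal direction `θ`. -/
structure IsPolar (X Y : Space) (L θ : ℝ) : Prop where
  fst : Y 0 = X 0 + L * Real.cos θ
  snd : Y 1 = X 1 + L * Real.sin θ
  trd : Y 2 = X 2

lemma real_inner_eq (v w : Space) : inner ℝ v w = v 0 * w 0 + v 1 * w 1 + v 2 * w 2 := by
  simp [PiLp.inner_apply, Fin.sum_univ_three]
  ring

namespace IsPolar

variable {X Y W P : Space} {L L' θ φ : ℝ}

lemma symm (h : IsPolar X Y L θ) : IsPolar Y X L (θ + Real.pi) :=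
  ⟨by rw [h.fst, Real.cos_add_pi]; ring, by rw [h.snd, Real.sin_add_pi]; ring, h.trd.symm⟩

lemma norm_vsub (h : IsPolar X Y L θ) (hL : 0 ≤ L) : ‖Y -ᵥ X‖ = L := by
  have : ‖Y -ᵥ X‖ ^ 2 = L ^ 2 := by
    rw [← real_inner_self_eq_norm_sq, real_inner_eq]
    simp only [vsub_eq_sub, PiLp.sub_apply, h.fst, h.snd, h.trd]
    linear_combination L ^ 2 * Real.sin_sq_add_cos_sq θ
  exact (pow_left_inj₀ (norm_nonneg _) hL two_ne_zero).1 this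

lemma angle_eq (h : IsPolar X Y L θ) (h' : IsPolar X W L' (θ + φ)) (hL : 0 < L) (hL' : 0 < L')
    (h0 : 0 ≤ φ) (hπ : φ ≤ Real.pi) : EuclideanGeometry.angle Y X W = φ := by
  rw [EuclideanGeometry.angle, InnerProductGeometry.angle, h.norm_vsub hL.le, h'.norm_vsub hL'.le,
    real_inner_eq]
  simp only [vsub_eq_sub, PiLp.sub_apply, h.fst, h.snd, h.trd, h'.fst, h'.snd, h'.trd]
  rw [← Real.arccos_cos h0 hπ]
  congr 1
  rw [div_eq_iff (by positivity), Real.cos_add, Real.sin_add, Real.arccos_cos h0 hπ]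
  linear_combination L * L' * Real.cos φ * Real.sin_sq_add_cos_sq θ

/-- A point of the upper half plane that is seen under an acute angle. -/
lemma exists_of_angle (h : IsPolar X Y L θ) (hL : 0 < L) {a : ℝ} (ha : 0 < a)
    (ha' : a < Real.pi / 2) (h2 : P 2 = X 2)
    (hq : 0 ≤ (P 1 - X 1) * Real.cos θ - (P 0 - X 0) * Real.sin θ)
    (h1 : EuclideanGeometry.angle P X Y = a) : ∃ r, 0 < r ∧
      (P 0 - X 0) * Real.cos θ + (P 1 - X 1) * Real.sin θ = r * Real.cos a ∧
      (P 1 - X 1) * Real.cos θ - (P 0 - X 0) * Real.sin θ = r * Real.sin a := by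
  have hne : P ≠ X := by
    rintro rfl
    rw [EuclideanGeometry.angle_self_left] at h1
    linarith
  have hr : 0 < ‖P -ᵥ X‖ := norm_pos_iff.2 (vsub_ne_zero.2 hne)
  have hcos := InnerProductGeometry.cos_angle_mul_norm_mul_norm (P -ᵥ X) (Y -ᵥ X)
  rw [show InnerProductGeometry.angle (P -ᵥ X) (Y -ᵥ X) = a from h1, h.norm_vsub hL.le,
    real_inner_eq] at hcos
  have hsq := real_inner_self_eq_norm_sq (P -ᵥ X)
  rw [real_inner_eq] at hsq
  simp only [vsub_eq_sub, PiLp.sub_apply, h.fst, h.snd, h.trd, h2] at hcos hsq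
  simp only [vsub_eq_sub] at hr
  generalize ‖P - X‖ = r at *
  have e1 : (P 0 - X 0) * Real.cos θ + (P 1 - X 1) * Real.sin θ = r * Real.cos a := by
    have : L * ((P 0 - X 0) * Real.cos θ + (P 1 - X 1) * Real.sin θ - r * Real.cos a) = 0 := by
      linear_combination -hcos
    have := (mul_eq_zero.1 this).resolve_left hL.ne'
    linarith
  refine ⟨r, hr, e1, ?_⟩
  have hs : 0 < Real.sin a := Real.sin_pos_of_pos_of_lt_pi ha (by linarith [Real.pi_pos])
  refine (pow_left_inj₀ hq (by positivity) two_ne_zero).1 ?_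
  linear_combination hsq + ((P 0 - X 0) ^ 2 + (P 1 - X 1) ^ 2) * Real.sin_sq_add_cos_sq θ -
    r ^ 2 * Real.sin_sq_add_cos_sq a -
    ((P 0 - X 0) * Real.cos θ + (P 1 - X 1) * Real.sin θ + r * Real.cos a) * e1

/-- The apex of a triangle with given base and base angles. -/
lemma of_angles (h : IsPolar X Y L θ) (hL : 0 < L) {a b : ℝ} (ha : 0 < a)
    (ha' : a < Real.pi / 2) (hb : 0 < b) (hb' : b < Real.pi / 2) (h2 : P 2 = X 2)
    (hq : 0 ≤ (P 1 - X 1) * Real.cos θ - (P 0 - X 0) * Real.sin θ)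
    (h1 : EuclideanGeometry.angle P X Y = a) (h3 : EuclideanGeometry.angle P Y X = b) :
    IsPolar X P (L * Real.sin b / Real.sin (a + b)) (θ + a) ∧
      IsPolar Y P (L * Real.sin a / Real.sin (a + b)) (θ + Real.pi - b) := by
  obtain ⟨r, hr, e1, e2⟩ := h.exists_of_angle hL ha ha' h2 hq h1
  have hs : 0 < Real.sin (a + b) := Real.sin_pos_of_pos_of_lt_pi (by linarith) (by linarith)
  have e5 := Real.sin_sq_add_cos_sq θ
  -- the reflection in the base exchanges the two ends
  have hsq := real_inner_self_eq_norm_sq (P -ᵥ Y)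
  have hne : P ≠ Y := by
    rintro rfl
    rw [EuclideanGeometry.angle_self_left] at h3
    linarith
  have hr' : 0 < ‖P -ᵥ Y‖ := norm_pos_iff.2 (vsub_ne_zero.2 hne)
  have hcos := InnerProductGeometry.cos_angle_mul_norm_mul_norm (P -ᵥ Y) (X -ᵥ Y)
  rw [show InnerProductGeometry.angle (P -ᵥ Y) (X -ᵥ Y) = b from h3, h.symm.norm_vsub hL.le,
    real_inner_eq] at hcos
  rw [real_inner_eq] at hsq
  simp only [vsub_eq_sub, PiLp.sub_apply, h.fst, h.snd, h.trd, h2] at hcos hsq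
  simp only [vsub_eq_sub] at hr'
  generalize ‖P - Y‖ = r' at *
  have e3 : L - r * Real.cos a = r' * Real.cos b := by
    have : L * (L - r * Real.cos a - r' * Real.cos b) = 0 := by
      linear_combination -hcos + L * e1 - L ^ 2 * e5
    have := (mul_eq_zero.1 this).resolve_left hL.ne'
    linarith
  have hsa : 0 < Real.sin a := Real.sin_pos_of_pos_of_lt_pi ha (by linarith [Real.pi_pos])
  have hsb : 0 < Real.sin b := Real.sin_pos_of_pos_of_lt_pi hb (by linarith [Real.pi_pos])
  have e4 : r * Real.sin a = r' * Real.sin b := by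
    refine (pow_left_inj₀ (by positivity) (by positivity) two_ne_zero).1 ?_
    rw [← e2]
    linear_combination hsq - r' ^ 2 * Real.sin_sq_add_cos_sq b + ((P 0 - X 0) ^ 2 + (P 1 - X 1) ^ 2 - L ^ 2) * e5 -
      (L - ((P 0 - X 0) * Real.cos θ + (P 1 - X 1) * Real.sin θ) + r' * Real.cos b) * (e3 - e1)
  have hr1 : r = L * Real.sin b / Real.sin (a + b) := by
    rw [eq_div_iff hs.ne', Real.sin_add]
    linear_combination Real.cos b * e4 - Real.sin b * e3
  have hr2 : r' = L * Real.sin a / Real.sin (a + b) := by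
    rw [eq_div_iff hs.ne', Real.sin_add]
    linear_combination (-Real.cos a) * e4 - Real.sin a * e3
  refine ⟨?_, ?_⟩
  · rw [← hr1]
    refine ⟨?_, ?_, h2⟩
    · rw [Real.cos_add]
      linear_combination (-(P 0 - X 0)) * e5 + Real.cos θ * e1 - Real.sin θ * e2
    · rw [Real.sin_add]
      linear_combination (-(P 1 - X 1)) * e5 + Real.sin θ * e1 + Real.cos θ * e2
  · rw [← hr2, show θ + Real.pi - b = θ - b + Real.pi by ring]
    refine ⟨?_, ?_, h2.trans h.trd.symm⟩
    · rw [Real.cos_add_pi, Real.cos_sub, h.fst]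
      linear_combination (-(P 0 - X 0)) * e5 + Real.cos θ * (e1 - e3) - Real.sin θ * (e2 + e4)
    · rw [Real.sin_add_pi, Real.sin_sub, h.snd]
      linear_combination (-(P 1 - X 1)) * e5 + Real.sin θ * (e1 - e3) + Real.cos θ * (e2 + e4)

end IsPolar

/-- The two angles determine the vertex up to the choice of plane and of the side of XY; membership
in the convex hull makes these choices. -/
lemma IsMorleyVertex.isPolar {X Y W P : Space} (hM : IsMorleyVertex X Y W P)
    {L L₁ L₂ θ a b : ℝ} (h : IsPolar X Y L θ) (h₁ : IsPolar X W L₁ (θ + 3 * a))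
    (h₂ : IsPolar Y W L₂ (θ + Real.pi - 3 * b)) (hL : 0 < L) (hL₁ : 0 < L₁) (hL₂ : 0 < L₂)
    (ha : 0 < a) (hb : 0 < b) (ha' : 3 * a < Real.pi) (hb' : 3 * b < Real.pi) :
    IsPolar X P (L * Real.sin b / Real.sin (a + b)) (θ + a) ∧
      IsPolar Y P (L * Real.sin a / Real.sin (a + b)) (θ + Real.pi - b) := by
  have e1 : EuclideanGeometry.angle W X Y = 3 * a := by
    rw [EuclideanGeometry.angle_comm]
    exact h.angle_eq h₁ hL hL₁ (by linarith) ha'.le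
  have e2 : EuclideanGeometry.angle W Y X = 3 * b := by
    refine h₂.angle_eq (φ := 3 * b) ?_ hL₂ hL (by linarith) hb'.le
    rw [sub_add_cancel]
    exact h.symm
  have hP := hM.mem
  rw [convexHull_insert (Set.insert_nonempty _ _), convexHull_pair, mem_convexJoin] at hP
  obtain ⟨X', hX', Q, hQ, hPQ⟩ := hP
  rw [Set.mem_singleton_iff] at hX'
  subst X'
  obtain ⟨s, t, hs, ht, hst, rfl⟩ := hQ
  obtain ⟨v, w, hv, hw, hvw, rfl⟩ := hPQ
  have k := Real.sin_sq_add_cos_sq θ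
  refine h.of_angles hL ha (by linarith) hb (by linarith) ?_ ?_ (by rw [hM.angle_left, e1]; ring)
    (by rw [hM.angle_right, e2]; ring)
  · simp only [PiLp.add_apply, PiLp.smul_apply, smul_eq_mul, h.trd, h₁.trd]
    linear_combination (X 2) * (w * hst + hvw)
  · have hsin : 0 ≤ Real.sin (3 * a) := (Real.sin_pos_of_pos_of_lt_pi (by linarith) ha').le
    simp only [PiLp.add_apply, PiLp.smul_apply, smul_eq_mul, h.fst, h.snd, h₁.fst, h₁.snd,
      Real.cos_add, Real.sin_add]
    have : 0 ≤ w * t * L₁ * Real.sin (3 * a) := by positivity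
    obtain rfl : v = 1 - w := by linarith
    obtain rfl : s = 1 - t := by linarith
    convert this using 1
    linear_combination (w * t * L₁ * Real.sin (3 * a)) * k

/-! ### The directions of the Morley triangle -/

/-- Directions are real numbers and not classes modulo 2π, so both reversals, by +π and by -π, are
needed to match angles exactly. -/
lemma IsPolar.symm' {X Y : Space} {L θ : ℝ} (h : IsPolar X Y L θ) : IsPolar Y X L (θ - Real.pi) :=
  ⟨by rw [h.fst, Real.cos_sub_pi]; ring, by rw [h.snd, Real.sin_sub_pi]; ring, h.trd.symm⟩

/-- It cancels the denominators sin(π/3 - x) in the law of sines for the triangles cut off by the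
trisectors. -/
lemma sin_three_mul_eq (x : ℝ) : Real.sin (3 * x) =
    4 * Real.sin x * Real.sin (Real.pi / 3 + x) * Real.sin (Real.pi / 3 - x) := by
  have h3 : √3 ^ 2 = 3 := Real.sq_sqrt (by norm_num)
  rw [Real.sin_three_mul, Real.sin_add, Real.sin_sub, Real.sin_pi_div_three, Real.cos_pi_div_three]
  linear_combination (-(Real.sin x * Real.cos x ^ 2)) * h3 - 3 * Real.sin x * Real.sin_sq_add_cos_sq x

/-- A side of the Morley triangle. -/
lemma IsPolar.morley_side {X P Q : Space} {K θ a b c : ℝ} (habc : a + b + c = Real.pi / 3)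
    (hP : IsPolar X P (K * Real.sin (Real.pi / 3 + c)) (θ + a))
    (hQ : IsPolar X Q (K * Real.sin (Real.pi / 3 + b)) (θ + 2 * a)) :
    IsPolar Q P (K * Real.sin a) (θ + a - (Real.pi / 3 + b)) := by
  -- The triangle XPQ has the angles a, π/3 + b and π/3 + c, whose sum is π.
  have e1 : Real.sin (Real.pi / 3 + c) = Real.sin (a + (Real.pi / 3 + b)) := by
    rw [← Real.sin_pi_sub, show Real.pi - (Real.pi / 3 + c) = a + (Real.pi / 3 + b) by
      linear_combination -habc]
  have e2 : θ + 2 * a = θ + a + a := by ring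
  rw [e1] at hP
  rw [e2] at hQ
  generalize Real.pi / 3 + b = q at *
  generalize θ + a = φ at *
  refine ⟨?_, ?_, hP.trd.trans hQ.trd.symm⟩
  · rw [hP.fst, hQ.fst, Real.sin_add, Real.cos_add, Real.cos_sub]
    ring
  · rw [hP.snd, hQ.snd, Real.sin_add a, Real.sin_add φ, Real.sin_sub]
    ring

section Directions

variable {b c h R α γ : ℝ} (hb : b = 2 * R * Real.sin γ)
  (hc : c = 2 * R * Real.sin (α + γ) * Real.cos α) (hh : h = 2 * R * Real.sin (α + γ) * Real.sin α)

include hb in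
lemma isPolar_A_B : IsPolar vertexA (vertexB b) (2 * R * Real.sin γ) 0 := by
  constructor <;> simp [vertexA, vertexB, hb]

include hc hh in
lemma isPolar_A_C : IsPolar vertexA (vertexC c h) (2 * R * Real.sin (α + γ)) α := by
  constructor <;> simp [vertexA, vertexC, hc, hh]

include hb hc hh in
lemma isPolar_B_C : IsPolar (vertexB b) (vertexC c h) (2 * R * Real.sin α) (α + γ) := by
  constructor
  · simp [vertexB, vertexC, hb, hc]
    rw [Real.sin_add, Real.cos_add]
    linear_combination 2 * R * Real.sin γ * Real.sin_sq_add_cos_sq α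
  · simp [vertexB, vertexC, hh]
    ring
  · simp [vertexB, vertexC]

section Angles

variable (hR : 0 < R) (hα : 0 < α) (hγ : 0 < γ) (hαγ : α + γ < Real.pi)

include hb hc hh hR hα hγ hαγ in
/-- The directions of the sides of the Morley triangle. -/
lemma IsMorleyTriangle.exists_isPolar {D E F : Space}
    (hM : IsMorleyTriangle vertexA (vertexB b) (vertexC c h) D E F) :
    ∃ m ψ : ℝ, 0 < m ∧ 3 * ψ = 2 * α + γ - Real.pi ∧ IsPolar F D m (ψ - Real.pi / 3) ∧
      IsPolar D E m (ψ + Real.pi / 3) := by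
  obtain ⟨a, ha⟩ : ∃ a, α = 3 * a := ⟨α / 3, by ring⟩
  obtain ⟨k, hk⟩ : ∃ k, γ = 3 * k := ⟨γ / 3, by ring⟩
  obtain ⟨l, hl⟩ : ∃ l, Real.pi - α - γ = 3 * l := ⟨(Real.pi - α - γ) / 3, by ring⟩
  have hsum : a + l + k = Real.pi / 3 := by linarith
  have pos : ∀ {x : ℝ}, 0 < x → x < Real.pi → 0 < Real.sin x := fun h1 h2 =>
    Real.sin_pos_of_pos_of_lt_pi h1 h2
  have sα := pos hα (by linarith)
  have sγ := pos hγ (by linarith)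
  have sβ := pos (x := α + γ) (by linarith) hαγ
  have sa : 0 < Real.sin a := pos (by linarith) (by linarith)
  have sk : 0 < Real.sin k := pos (by linarith) (by linarith)
  have sl : 0 < Real.sin l := pos (by linarith) (by linarith)
  have hAB := isPolar_A_B hb
  have hAC := isPolar_A_C hc hh
  have hBC := isPolar_B_C hb hc hh
  obtain ⟨hAD, hBD⟩ := hM.adjacent_AB.isPolar (a := a) (b := l) hAB
    (by rw [zero_add, ← ha]; exact hAC)
    (by rw [show 0 + Real.pi - 3 * l = α + γ by linarith]; exact hBC)
    (by positivity) (by positivity) (by positivity) (by linarith) (by linarith) (by linarith)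
    (by linarith)
  obtain ⟨hBE, -⟩ := hM.adjacent_BC.isPolar (a := l) (b := k) hBC
    (by rw [show α + γ + 3 * l = 0 + Real.pi by linarith]; exact hAB.symm)
    (by rw [show α + γ + Real.pi - 3 * k = α + Real.pi by linarith]; exact hAC.symm)
    (by positivity) (by positivity) (by positivity) (by linarith) (by linarith) (by linarith)
    (by linarith)
  obtain ⟨-, hAF⟩ := hM.adjacent_CA.isPolar (a := k) (b := a) hAC.symm'
    (by rw [show α - Real.pi + 3 * k = α + γ - Real.pi by linarith]; exact hBC.symm')
    (by rw [show α - Real.pi + Real.pi - 3 * a = 0 by linarith]; exact hAB)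
    (by positivity) (by positivity) (by positivity) (by linarith) (by linarith) (by linarith)
    (by linarith)
  -- In each small triangle the two base angles add up to π/3 minus the third trisected angle x, and
  -- the base is 2R sin 3x.
  have len : ∀ {x y z w : ℝ}, 0 < x → x < Real.pi / 3 → y = Real.pi / 3 - x → z = 3 * x →
      2 * R * Real.sin z * Real.sin w / Real.sin y =
        8 * R * Real.sin w * Real.sin x * Real.sin (Real.pi / 3 + x) := by
    rintro x y z w h0 h1 rfl rfl
    have := pos (x := Real.pi / 3 - x) (by linarith) (by linarith)
    rw [div_eq_iff this.ne', sin_three_mul_eq]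
    ring
  have sβ' : Real.sin (α + γ) = Real.sin (3 * l) := by
    rw [← hl, ← Real.sin_pi_sub]
    congr 1
    ring
  rw [len (x := k) (by linarith) (by linarith) (by linarith) hk] at hAD hBD
  rw [len (x := a) (by linarith) (by linarith) (by linarith) ha] at hBE
  rw [sβ', len (x := l) (by linarith) (by linarith) (by linarith) rfl] at hAF
  refine ⟨8 * R * Real.sin a * Real.sin l * Real.sin k, a - l, by positivity, by linarith, ?_, ?_⟩
  · have := IsPolar.morley_side (X := vertexA) (P := D) (Q := F) (θ := 0)
      (K := 8 * R * Real.sin l * Real.sin k) hsum hAD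
      (by
        convert hAF using 1
        · ring
        · linarith)
    convert this using 1
    · ring
    · linarith
  · have := IsPolar.morley_side (X := vertexB b) (P := E) (Q := D) (θ := α + γ) (a := l) (b := k)
      (c := a) (K := 8 * R * Real.sin a * Real.sin k) (by linarith)
      (by
        convert hBE using 1
        ring)
      (by
        convert hBD using 1
        linarith)
    convert this using 1
    · ring
    · linarith

include hb hc hh in
lemma circumcentre_eq (h0 : h ≠ 0) :
    circumcentre b c h = !₂[R * Real.sin γ, R * Real.cos γ, 0] := by
  have e : (c ^ 2 + h ^ 2 - b * c) / (2 * h) = R * Real.cos γ := by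
    rw [div_eq_iff (by simpa using h0), hb, hc, hh, Real.sin_add]
    linear_combination (4 * R ^ 2 * (Real.sin α * Real.cos γ + Real.cos α * Real.sin γ) ^ 2) *
      Real.sin_sq_add_cos_sq α
  rw [circumcentre, e, hb]
  congr 3
  ring

include hb hc hh hR hα hγ hαγ in
/-- The Morley generatrices in terms of the half angle of a point of the danger cylinder. -/
lemma mem_morleyGeneratrices_iff (h0 : 0 < h) {D E F : Space}
    (hM : IsMorleyTriangle vertexA (vertexB b) (vertexC c h) D E F) {P : Space} {u : ℝ}
    (hx : P 0 = R * Real.sin γ - R * Real.sin (2 * u + γ))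
    (hy : P 1 = R * Real.cos γ - R * Real.cos (2 * u + γ)) (hP : P ∈ dangerCylinder b c h) :
    P ∈ morleyGeneratrices b c h D E F ↔ Real.cos (3 * u + 2 * γ + α) = 0 := by
  obtain ⟨m, ψ, hm, hψ, hFD, hDE⟩ := hM.exists_isPolar hb hc hh hR hα hγ hαγ
  -- The direction from the circumcentre to P, measured from the axis ψ of the Morley triangle. In
  -- this frame FD and DE have the directions ∓π/3, and the altitudes have χ = -π/2, π/6, 5π/6, the
  -- solutions of sin 3χ = 1.
  obtain ⟨χ, hχ⟩ : ∃ χ, -(Real.pi / 2) - (2 * u + γ) = χ + ψ :=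
    ⟨-(Real.pi / 2) - (2 * u + γ) - ψ, by ring⟩
  have p0 : P 0 - R * Real.sin γ = R * Real.cos (χ + ψ) := by
    rw [← hχ, hx, show -(Real.pi / 2) - (2 * u + γ) = -(2 * u + γ + Real.pi / 2) by ring,
      Real.cos_neg, Real.cos_add_pi_div_two]
    ring
  have p1 : P 1 - R * Real.cos γ = R * Real.sin (χ + ψ) := by
    rw [← hχ, hy, show -(Real.pi / 2) - (2 * u + γ) = -(2 * u + γ + Real.pi / 2) by ring,
      Real.sin_neg, Real.sin_add_pi_div_two]
    ring
  have hc2 : Real.cos (3 * u + 2 * γ + α) = 0 ↔ Real.sin (3 * χ) = 1 := by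
    rw [show 3 * χ = -(2 * (3 * u + 2 * γ + α) + Real.pi / 2) by linarith, Real.sin_neg,
      Real.sin_add_pi_div_two, Real.cos_two_mul]
    constructor
    · intro h
      rw [h]
      norm_num
    · intro h
      exact pow_eq_zero_iff two_ne_zero |>.1 (by linarith)
  have h3 : √3 ^ 2 = 3 := Real.sq_sqrt (by norm_num)
  have h3' : 0 < √3 := by positivity
  have s1 := Real.sin_sq_add_cos_sq χ
  have sψ := Real.sin_sq_add_cos_sq ψ
  have i1 : inner ℝ (P - circumcentre b c h) (D - F) =
      R * m * (Real.cos χ - √3 * Real.sin χ) / 2 := by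
    rw [circumcentre_eq hb hc hh h0.ne', real_inner_eq]
    simp [p0, p1, hFD.fst, hFD.snd, hFD.trd]
    rw [Real.cos_add, Real.sin_add, Real.cos_sub, Real.sin_sub, Real.cos_pi_div_three,
      Real.sin_pi_div_three]
    linear_combination (R * m * (Real.cos χ - √3 * Real.sin χ) / 2) * sψ
  have i2 : inner ℝ (P - circumcentre b c h) (E - D) =
      R * m * (Real.cos χ + √3 * Real.sin χ) / 2 := by
    rw [circumcentre_eq hb hc hh h0.ne', real_inner_eq]
    simp [p0, p1, hDE.fst, hDE.snd, hDE.trd]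
    rw [Real.cos_add, Real.sin_add, Real.cos_add, Real.sin_add, Real.cos_pi_div_three,
      Real.sin_pi_div_three]
    linear_combination (R * m * (Real.cos χ + √3 * Real.sin χ) / 2) * sψ
  have i3 : inner ℝ (P - circumcentre b c h) (F - E) = -(R * m * Real.cos χ) := by
    rw [show F - E = -((D - F) + (E - D)) by abel, inner_neg_right, inner_add_right, i1, i2]
    ring
  have j1 : inner ℝ (P - circumcentre b c h) (F - D) =
      -(R * m * (Real.cos χ - √3 * Real.sin χ) / 2) := by
    rw [← neg_sub D F, inner_neg_right, i1]
  have j2 : inner ℝ (P - circumcentre b c h) (D - E) =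
      -(R * m * (Real.cos χ + √3 * Real.sin χ) / 2) := by
    rw [← neg_sub E D, inner_neg_right, i2]
  have j3 : inner ℝ (P - circumcentre b c h) (E - F) = R * m * Real.cos χ := by
    rw [← neg_sub F E, inner_neg_right, i3, neg_neg]
  have hRm : 0 < R * m := by positivity
  simp only [morleyGeneratrices, morleyGeneratrix, Set.mem_union, Set.mem_ofPred_eq, hP, true_and,
    i1, i2, i3, j1, j2, j3]
  rw [hc2, Real.sin_three_mul]
  generalize Real.sin χ = S at *
  generalize Real.cos χ = T at *
  generalize R * m = k at *
  constructor
  · rintro ((⟨h1, h2⟩ | ⟨h1, h2⟩) | ⟨h1, h2⟩)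
    · have hT : T = 0 := (mul_eq_zero.1 (neg_eq_zero.1 h1)).resolve_left hRm.ne'
      subst hT
      have hS : S < 0 := by
        by_contra! hS
        have : 0 ≤ k * (0 + √3 * S) / 2 := by positivity
        linarith
      have : (S - 1) * (S + 1) = 0 := by linear_combination s1
      rcases mul_eq_zero.1 this with h | h
      · linarith
      · rw [show S = -1 by linarith]
        norm_num
    · have hT : T - √3 * S = 0 := by
        have : k * (T - √3 * S) = 0 := by linarith
        exact (mul_eq_zero.1 this).resolve_left hRm.ne'
      have hT0 : 0 < T := pos_of_mul_pos_right h2 hRm.le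
      have hS : 0 < S := by
        by_contra! hS
        have : √3 * S ≤ 0 := mul_nonpos_of_nonneg_of_nonpos h3'.le hS
        linarith
      have : (2 * S - 1) * (2 * S + 1) = 0 := by
        linear_combination s1 - (T + √3 * S) * hT - S ^ 2 * h3
      rcases mul_eq_zero.1 this with h | h
      · rw [show S = 1 / 2 by linarith]
        norm_num
      · linarith
    · have hT : T + √3 * S = 0 := by
        have : k * (T + √3 * S) = 0 := by linarith
        exact (mul_eq_zero.1 this).resolve_left hRm.ne'
      have hT0 : 0 < k * (√3 * S) := by
        rw [show T = -(√3 * S) by linarith] at h2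
        linarith
      have hS : 0 < S := pos_of_mul_pos_right (pos_of_mul_pos_right hT0 hRm.le) h3'.le
      have : (2 * S - 1) * (2 * S + 1) = 0 := by
        linear_combination s1 - (T - √3 * S) * hT - S ^ 2 * h3
      rcases mul_eq_zero.1 this with h | h
      · rw [show S = 1 / 2 by linarith]
        norm_num
      · linarith
  · intro h
    -- The simple root S = -1 is the altitude from D; the double root S = 1/2 splits by the sign of
    -- the cosine into the altitudes from E and F.
    have h4 : (S + 1) * (2 * S - 1) ^ 2 = 0 := by linear_combination -h
    rcases mul_eq_zero.1 h4 with h5 | h5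
    · have hS : S = -1 := by linarith
      subst hS
      have hT : T = 0 := by
        have : T ^ 2 = 0 := by linarith
        exact pow_eq_zero_iff two_ne_zero |>.1 this
      subst hT
      refine Or.inl (Or.inl ⟨by ring, ?_⟩)
      have : 0 < k * √3 := by positivity
      linarith
    · have hS : S = 1 / 2 := by
        have := pow_eq_zero_iff two_ne_zero |>.1 h5
        linarith
      subst hS
      have hT : (T - √3 / 2) * (T + √3 / 2) = 0 := by linear_combination s1 - h3 / 4
      have hk : 0 < k * √3 := by positivity
      rcases mul_eq_zero.1 hT with h6 | h6
      · rw [show T = √3 / 2 by linarith]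
        exact Or.inl (Or.inr ⟨by ring, by linarith⟩)
      · rw [show T = -(√3 / 2) by linarith]
        exact Or.inr ⟨by ring, by linarith⟩

end Angles

end Directions

/-! ### The intersection with the danger cylinder -/

/-- The points of a circle in terms of the half angle. -/
lemma exists_half_angle {R x y : ℝ} (γ : ℝ) (h : x ^ 2 + y ^ 2 = R ^ 2) (hR : 0 < R) :
    ∃ u, x = -(R * Real.sin (2 * u + γ)) ∧ y = -(R * Real.cos (2 * u + γ)) := by
  obtain ⟨φ, h1, h2⟩ : ∃ φ, y / -R = Real.cos φ ∧ x / -R = Real.sin φ := by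
    have : (y / -R) ^ 2 + (x / -R) ^ 2 = 1 := by
      field_simp
      linarith
    let w : ℂ := ⟨y / -R, x / -R⟩
    have hw : ‖w‖ = 1 := by
      rw [Complex.norm_def, Complex.normSq_mk, ← sq, ← sq, this, Real.sqrt_one]
    refine ⟨Complex.arg w, ?_, ?_⟩
    · have := Complex.norm_mul_cos_arg w
      rw [hw, one_mul] at this
      exact this.symm
    · have := Complex.norm_mul_sin_arg w
      rw [hw, one_mul] at this
      exact this.symm
  refine ⟨(φ - γ) / 2, ?_, ?_⟩
  · rw [show 2 * ((φ - γ) / 2) + γ = φ by ring, ← h2]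
    field_simp
  · rw [show 2 * ((φ - γ) / 2) + γ = φ by ring, ← h1]
    field_simp

/-- The angles at A, C and B are α, γ and π - α - γ, so cos(α + γ) is minus the cosine of the angle
at B. -/
lemma cos_angles_of_isNonObtuse {b c h R α γ : ℝ} (hb : b = 2 * R * Real.sin γ)
    (hc : c = 2 * R * Real.sin (α + γ) * Real.cos α)
    (hh : h = 2 * R * Real.sin (α + γ) * Real.sin α) (hR : 0 < R) (hα : 0 < α) (hγ : 0 < γ)
    (hαγ : α + γ < Real.pi) (hN : IsNonObtuse vertexA (vertexB b) (vertexC c h)) :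
    Real.cos α * Real.cos (α + γ) * Real.cos γ ≤ 0 := by
  have pos : ∀ {x : ℝ}, 0 < x → x < Real.pi → 0 < Real.sin x := fun h1 h2 =>
    Real.sin_pos_of_pos_of_lt_pi h1 h2
  have sα := pos hα (by linarith)
  have sγ := pos hγ (by linarith)
  have sβ := pos (x := α + γ) (by linarith) hαγ
  have hAB := isPolar_A_B hb
  have hAC := isPolar_A_C hc hh
  have hBC := isPolar_B_C hb hc hh
  have hA := hN.angle_A
  have hB := hN.angle_B
  have hC := hN.angle_C
  rw [hAB.angle_eq (φ := α) (by rw [zero_add]; exact hAC) (by positivity) (by positivity) hα.le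
    (by linarith)] at hA
  rw [EuclideanGeometry.angle_comm, hBC.angle_eq (φ := Real.pi - α - γ)
    (by rw [show α + γ + (Real.pi - α - γ) = 0 + Real.pi by ring]; exact hAB.symm) (by positivity)
    (by positivity) (by linarith) (by linarith)] at hB
  rw [hAC.symm'.angle_eq (φ := γ)
    (by rw [show α - Real.pi + γ = α + γ - Real.pi by ring]; exact hBC.symm') (by positivity)
    (by positivity) hγ.le (by linarith)] at hC
  have c1 : 0 ≤ Real.cos α := Real.cos_nonneg_of_mem_Icc ⟨by linarith, hA⟩
  have c2 : 0 ≤ Real.cos γ := Real.cos_nonneg_of_mem_Icc ⟨by linarith, hC⟩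
  have c3 : Real.cos (α + γ) ≤ 0 :=
    Real.cos_nonpos_of_pi_div_two_le_of_le (by linarith) (by linarith)
  exact mul_nonpos_of_nonpos_of_nonneg (mul_nonpos_of_nonneg_of_nonpos c1 c3) c2

lemma exists_half_angle_of_mem {b c h R α γ : ℝ} (hb : b = 2 * R * Real.sin γ)
    (hc : c = 2 * R * Real.sin (α + γ) * Real.cos α)
    (hh : h = 2 * R * Real.sin (α + γ) * Real.sin α) (hR : 0 < R) (h0 : 0 < h) {P : Space}
    (hP : P ∈ dangerCylinder b c h) : ∃ u, P 0 = R * Real.sin γ - R * Real.sin (2 * u + γ) ∧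
      P 1 = R * Real.cos γ - R * Real.cos (2 * u + γ) := by
  rw [mem_dangerCylinder_iff b c P h0, circ_eq hb hc hh] at hP
  have := (mul_eq_zero.1 hP).resolve_left h0.ne'
  obtain ⟨u, h1, h2⟩ := exists_half_angle γ (sub_eq_zero.1 this) hR
  exact ⟨u, by linarith, by linarith⟩

section Cylinder

variable {b c h R α γ u : ℝ} (hb : b = 2 * R * Real.sin γ)
  (hc : c = 2 * R * Real.sin (α + γ) * Real.cos α) (hh : h = 2 * R * Real.sin (α + γ) * Real.sin α)
  {P : Space} (hx : P 0 = R * Real.sin γ - R * Real.sin (2 * u + γ))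
  (hy : P 1 = R * Real.cos γ - R * Real.cos (2 * u + γ))

include hb hc hh hx hy in
lemma evalAt_deltoidalPoly_of_mem : evalAt (deltoidalPoly b c h) P =
    4 * (4 * R ^ 2) ^ 8 * (Real.sin α * Real.sin γ * Real.sin (α + γ)) ^ 6 * (P 2 ^ 2) ^ 2 *
      Real.cos (3 * u + 2 * γ + α) ^ 2 *
      ((P 2 ^ 2) ^ 2 + 4 * R ^ 2 * (Real.sin u ^ 2 + Real.sin (u + γ) ^ 2 +
        Real.sin (u + γ + α) ^ 2 - 1) * P 2 ^ 2 +
        (4 * R ^ 2) ^ 2 * (Real.sin u * Real.sin (u + γ) * Real.sin (u + γ + α)) ^ 2) := by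
  rw [evalAt_deltoidalPoly, hx, hy, ← delt_circle, hb, hc, hh]
  simp only [mul_assoc]

end Cylinder

/-- By `one_le_sum_sin_sq` the coefficient of z² is nonnegative, and z⁴ is positive. -/
lemma quadratic_pos_of_cos {R α γ u z : ℝ} (hcos : Real.cos α * Real.cos (α + γ) * Real.cos γ ≤ 0)
    (hz : z ≠ 0) : 0 < (z ^ 2) ^ 2 + 4 * R ^ 2 * (Real.sin u ^ 2 + Real.sin (u + γ) ^ 2 +
      Real.sin (u + γ + α) ^ 2 - 1) * z ^ 2 +
      (4 * R ^ 2) ^ 2 * (Real.sin u * Real.sin (u + γ) * Real.sin (u + γ + α)) ^ 2 := by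
  have h1 := sub_nonneg.2 (one_le_sum_sin_sq hcos u)
  positivity

/-- There are three generatrices of contact. -/
lemma exists_lt_three_of_cos_eq_zero {α γ u : ℝ} (hu : Real.cos (3 * u + 2 * γ + α) = 0) :
    ∃ i < 3, ∃ u' : ℝ, u' = (Real.pi / 2 + (i : ℕ) * Real.pi - 2 * γ - α) / 3 ∧
      Real.cos (3 * u' + 2 * γ + α) = 0 ∧ Real.sin (2 * u' + γ) = Real.sin (2 * u + γ) ∧
      Real.cos (2 * u' + γ) = Real.cos (2 * u + γ) := by
  obtain ⟨k, hk⟩ := Real.cos_eq_zero_iff.1 hu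
  have h1 : ((k % 3).toNat : ℤ) = k % 3 := Int.toNat_of_nonneg (by omega)
  have h2 : (k : ℝ) = 3 * (k / 3 : ℤ) + ((k % 3).toNat : ℕ) := by
    have : k = 3 * (k / 3) + ((k % 3).toNat : ℕ) := by omega
    exact_mod_cast this
  refine ⟨(k % 3).toNat, by omega, u - (k / 3 : ℤ) * Real.pi, ?_, ?_, ?_, ?_⟩
  · rw [h2] at hk
    linear_combination hk / 3
  · refine Real.cos_eq_zero_iff.2 ⟨((k % 3).toNat : ℕ), ?_⟩
    rw [h2] at hk
    push_cast
    linear_combination hk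
  · rw [← Real.sin_sub_int_mul_two_pi (2 * u + γ) (k / 3)]
    ring_nf
  · rw [← Real.cos_sub_int_mul_two_pi (2 * u + γ) (k / 3)]
    ring_nf

/-- On a vertical line the possible points of failure of tangency are roots of a monic quintic in z.
-/
lemma finite_setOf_vertical {x y p q : ℝ} :
    {P : Space | P 0 = x ∧ P 1 = y ∧
      P 2 * ((P 2 ^ 2) ^ 2 + p * P 2 ^ 2 + q) = 0}.Finite := by
  let Q : Polynomial ℝ :=
    Polynomial.X ^ 5 + Polynomial.C p * Polynomial.X ^ 3 + Polynomial.C q * Polynomial.X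
  have hQ : Q ≠ 0 := by
    intro h
    have := congrArg (fun f => Polynomial.coeff f 5) h
    simp [Q, Polynomial.coeff_X_pow] at this
  refine Set.Finite.of_finite_image (f := fun P : Space => P 2)
    ((Polynomial.finite_setOfPred_isRoot hQ).subset ?_) ?_
  · rintro _ ⟨P, ⟨-, -, h⟩, rfl⟩
    simp only [Q, Polynomial.IsRoot, Set.mem_ofPred_eq, Polynomial.eval_add, Polynomial.eval_mul, Polynomial.eval_pow,
      Polynomial.eval_X, Polynomial.eval_C]
    linear_combination h
  · rintro P ⟨h0, h1, -⟩ P' ⟨h0', h1', -⟩ h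
    ext i
    fin_cases i
    · exact h0.trans h0'.symm
    · exact h1.trans h1'.symm
    · exact h

end P3P

end

/-! ### Conclusion: surface, tangency and intersection -/

theorem mainTheorem5 (x₂ x₃ y₃ : ℝ) (hx₂ : 0 < x₂) (hy₃ : 0 < y₃) (D E F : P3P.Space)
    (hM : P3P.IsMorleyTriangle P3P.vertexA (P3P.vertexB x₂) (P3P.vertexC x₃ y₃) D E F) :
    -- complementary solutions lie on the deltoidal surface
    (∀ O O' : P3P.Space, O ∈ P3P.dangerCylinder x₂ x₃ y₃ →
      P3P.IsComplementary P3P.vertexA (P3P.vertexB x₂) (P3P.vertexC x₃ y₃) O O' →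
      O' ∈ P3P.deltoidalSurface x₂ x₃ y₃) ∧
    -- which is an algebraic surface of degree 12,
    (∃ f : MvPolynomial (Fin 3) ℝ,
      P3P.deltoidalIdeal x₂ x₃ y₃ = Ideal.span {f} ∧
      f.totalDegree = 12 ∧
      P3P.deltoidalSurface x₂ x₃ y₃ = {P | P3P.evalAt f P = 0} ∧
      -- tangent to the danger cylinder along the Morley generatrices;
      (∀ P ∈ P3P.morleyGeneratrices x₂ x₃ y₃ D E F,
        ∃ c : ℝ, P3P.gradAt f P = c • P3P.gradAt (P3P.cylinderPoly x₂ x₃ y₃) P) ∧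
      {P | P ∈ P3P.morleyGeneratrices x₂ x₃ y₃ D E F ∧
        ¬ P3P.TangentAt f (P3P.cylinderPoly x₂ x₃ y₃) P}.Finite ∧
      (P3P.IsNonObtuse P3P.vertexA (P3P.vertexB x₂) (P3P.vertexC x₃ y₃) →
        ∀ P ∈ P3P.morleyGeneratrices x₂ x₃ y₃ D E F, P ∉ P3P.circumcircle x₂ x₃ y₃ →
          P3P.TangentAt f (P3P.cylinderPoly x₂ x₃ y₃) P)) ∧
    -- it meets the danger cylinder in the Morley generatrices and the circumcircle,
    P3P.morleyGeneratrices x₂ x₃ y₃ D E F ∪ P3P.circumcircle x₂ x₃ y₃ ⊆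
      P3P.deltoidalSurface x₂ x₃ y₃ ∩ P3P.dangerCylinder x₂ x₃ y₃ ∧
    -- and, if the triangle is not obtuse, nowhere else.
    (P3P.IsNonObtuse P3P.vertexA (P3P.vertexB x₂) (P3P.vertexC x₃ y₃) →
      P3P.deltoidalSurface x₂ x₃ y₃ ∩ P3P.dangerCylinder x₂ x₃ y₃ =
        P3P.morleyGeneratrices x₂ x₃ y₃ D E F ∪ P3P.circumcircle x₂ x₃ y₃) := by
  obtain ⟨R, α, γ, hR, hα, hγ, hαγ, hb, hc, hh⟩ := P3P.exists_angles (c := x₃) hx₂ hy₃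
  have hzero : ∀ P ∈ P3P.deltoidalSurface x₂ x₃ y₃,
      P3P.evalAt (P3P.deltoidalPoly x₂ x₃ y₃) P = 0 := by
    intro P hP
    rwa [P3P.deltoidalSurface_eq hx₂ hy₃] at hP
  have hsin : 0 < Real.sin α * Real.sin γ * Real.sin (α + γ) := by
    have h1 := Real.sin_pos_of_pos_of_lt_pi hα (by linarith)
    have h2 := Real.sin_pos_of_pos_of_lt_pi hγ (by linarith)
    have h3 := Real.sin_pos_of_pos_of_lt_pi (by linarith : 0 < α + γ) hαγ
    positivity
  have hmem : ∀ P ∈ P3P.morleyGeneratrices x₂ x₃ y₃ D E F,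
      P ∈ P3P.dangerCylinder x₂ x₃ y₃ := by
    rintro P ((hP | hP) | hP) <;> exact hP.1
  have hgen : ∀ P ∈ P3P.morleyGeneratrices x₂ x₃ y₃ D E F, ∃ u,
      P 0 = R * Real.sin γ - R * Real.sin (2 * u + γ) ∧
      P 1 = R * Real.cos γ - R * Real.cos (2 * u + γ) ∧ Real.cos (3 * u + 2 * γ + α) = 0 := by
    intro P hP
    obtain ⟨u, hx, hy⟩ := P3P.exists_half_angle_of_mem hb hc hh hR hy₃ (hmem P hP)
    exact ⟨u, hx, hy, (P3P.mem_morleyGeneratrices_iff hb hc hh hR hα hγ hαγ hy₃ hM hx hy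
      (hmem P hP)).1 hP⟩
  have hsub : P3P.morleyGeneratrices x₂ x₃ y₃ D E F ∪ P3P.circumcircle x₂ x₃ y₃ ⊆
      P3P.deltoidalSurface x₂ x₃ y₃ ∩ P3P.dangerCylinder x₂ x₃ y₃ := by
    rw [P3P.deltoidalSurface_eq hx₂ hy₃]
    rintro P (hP | hP)
    · obtain ⟨u, hx, hy, hu⟩ := hgen P hP
      refine ⟨?_, hmem P hP⟩
      change P3P.evalAt _ P = 0
      rw [P3P.evalAt_deltoidalPoly_of_mem hb hc hh hx hy, hu]
      ring
    · obtain ⟨u, hx, hy⟩ := P3P.exists_half_angle_of_mem hb hc hh hR hy₃ hP.1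
      refine ⟨?_, hP.1⟩
      change P3P.evalAt _ P = 0
      rw [P3P.evalAt_deltoidalPoly_of_mem hb hc hh hx hy, hP.2]
      ring
  -- The nonvanishing condition excludes the plane z = 0 and the zeros of the quadratic factor; only
  -- there can the gradient of the surface vanish on a Morley generatrix.
  have htan : ∀ P ∈ P3P.morleyGeneratrices x₂ x₃ y₃ D E F, ∀ u,
      P 0 = R * Real.sin γ - R * Real.sin (2 * u + γ) →
      P 1 = R * Real.cos γ - R * Real.cos (2 * u + γ) → Real.cos (3 * u + 2 * γ + α) = 0 →
      P 2 * ((P 2 ^ 2) ^ 2 + 4 * R ^ 2 * (Real.sin u ^ 2 + Real.sin (u + γ) ^ 2 +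
        Real.sin (u + γ + α) ^ 2 - 1) * P 2 ^ 2 +
        (4 * R ^ 2) ^ 2 * (Real.sin u * Real.sin (u + γ) * Real.sin (u + γ + α)) ^ 2) ≠ 0 →
      P3P.TangentAt (P3P.deltoidalPoly x₂ x₃ y₃) (P3P.cylinderPoly x₂ x₃ y₃) P := by
    intro P hP u hx hy hu hne
    exact
      { left_mem := hzero P (hsub (Or.inl hP)).1
        right_mem := hmem P hP
        left_regular := P3P.gradAt_deltoidalPoly_ne_zero hb hc hh hx hy hu hR.ne'
          (left_ne_zero_of_mul hne) hsin.ne' (right_ne_zero_of_mul hne)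
        right_regular := P3P.gradAt_cylinderPoly_ne_zero hb hc hh hy₃.ne' hx hy hR.ne'
        parallel := P3P.exists_gradAt_eq_smul hb hc hh hy₃.ne' hx hy hu hR.ne' }
  refine ⟨fun O O' hO hO' p hp => P3P.mem_deltoidalIdeal_iff.1 hp O' ⟨O, hO, hO'⟩,
    ⟨P3P.deltoidalPoly x₂ x₃ y₃, P3P.deltoidalIdeal_eq_span hx₂ hy₃,
      P3P.totalDegree_deltoidalPoly hx₂ hy₃, P3P.deltoidalSurface_eq hx₂ hy₃, ?_, ?_, ?_⟩,
    hsub, ?_⟩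
  · intro P hP
    obtain ⟨u, hx, hy, hu⟩ := hgen P hP
    exact P3P.exists_gradAt_eq_smul hb hc hh hy₃.ne' hx hy hu hR.ne'
  -- Modulo π, which does not change the point of the circle, these are the three solutions of
  -- cos(3u + 2γ + α) = 0. The exceptional points thus lie on three vertical lines, finitely many on
  -- each.
  · let v : ℕ → ℝ := fun i => (Real.pi / 2 + i * Real.pi - 2 * γ - α) / 3
    refine ((Finset.range 3).finite_toSet.biUnion fun i _ =>
      P3P.finite_setOf_vertical (x := R * Real.sin γ - R * Real.sin (2 * v i + γ))
        (y := R * Real.cos γ - R * Real.cos (2 * v i + γ)) (p := 4 * R ^ 2 *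
          (Real.sin (v i) ^ 2 + Real.sin (v i + γ) ^ 2 + Real.sin (v i + γ + α) ^ 2 - 1))
        (q := (4 * R ^ 2) ^ 2 * (Real.sin (v i) * Real.sin (v i + γ) *
          Real.sin (v i + γ + α)) ^ 2)).subset ?_
    rintro P ⟨hP, hnt⟩
    obtain ⟨u, hx, hy, hu⟩ := hgen P hP
    obtain ⟨i, hi, u', hv, hu', hs, hcs⟩ := P3P.exists_lt_three_of_cos_eq_zero hu
    rw [← hs] at hx
    rw [← hcs] at hy
    obtain rfl : u' = v i := hv
    refine Set.mem_biUnion (Finset.mem_coe.2 (Finset.mem_range.2 hi)) ⟨hx, hy, ?_⟩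
    by_contra hne
    exact hnt (htan P hP _ hx hy hu' hne)
  · intro hN P hP hPc
    obtain ⟨u, hx, hy, hu⟩ := hgen P hP
    have hz : P 2 ≠ 0 := fun hz => hPc ⟨hmem P hP, hz⟩
    exact htan P hP u hx hy hu (mul_ne_zero hz (P3P.quadratic_pos_of_cos
      (P3P.cos_angles_of_isNonObtuse hb hc hh hR hα hγ hαγ hN) hz).ne')
  · intro hN
    refine Set.Subset.antisymm ?_ hsub
    rintro P ⟨hP, hPg⟩
    obtain ⟨u, hx, hy⟩ := P3P.exists_half_angle_of_mem hb hc hh hR hy₃ hPg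
    by_cases hz : P 2 = 0
    · exact Or.inr ⟨hPg, hz⟩
    · left
      refine (P3P.mem_morleyGeneratrices_iff hb hc hh hR hα hγ hαγ hy₃ hM hx hy hPg).2 ?_
      have h1 := hzero P hP
      have h2 := P3P.quadratic_pos_of_cos (R := R) (u := u)
        (P3P.cos_angles_of_isNonObtuse hb hc hh hR hα hγ hαγ hN) hz
      rw [P3P.evalAt_deltoidalPoly_of_mem hb hc hh hx hy] at h1
      have h3 := (mul_eq_zero.1 h1).resolve_right h2.ne'
      exact pow_eq_zero_iff two_ne_zero |>.1 ((mul_eq_zero.1 h3).resolve_left (by positivity))
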